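/- All spaces are composed of qubits and $\|X\|_{\mathrm{tr}}=\operatorname{tr}\sqrt{X^*X}$. For a linear map $\Phi:\mathrm L(\mathcal H)\to\mathrm L(\mathcal K)$ let $\|\Phi\|_\diamond=\sup_{0\ne X\in \mathrm L(\mathcal H\otimes\mathcal H)}\|(\Phi\otimes \mathrm{id}_{\mathcal H})(X)\|_{\mathrm{tr}}/\|X\|_{\mathrm{tr}}$. Circuits are mixed-state quantum circuits: sequences of unitary gates from a fixed universal set (Hadamard, $T$, controlled-not, Toffoli), gates that introduce an ancilla qubit in state $|0\rangle$, and gates that trace out a qubit. An instance is a circuit $E$ which takes $m$ classical key bits and a quantum state on $\mathcal H$ to a state on $\mathcal K$, where $\dim\mathcal K\ge\dim\mathcal H$ and $\mathcal K$ has at least one qubit; for $k\in\{0,1\}^m$ it implements the channel $E_k$. Regard $\mathcal H$ as the subspace $\mathcal H\otimes|0\cdots0\rangle$ of $\mathcal K$. For $0<\delta\le 1$ and a polynomial $p$, the promise problem $\mathrm{DI}_{\varepsilon,\delta}$ (Detecting Insecure Encryption) is to decide between: * Yes: there is a subspace $S\subseteq\mathcal H$ with $\dim S\ge(\dim\mathcal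 H)^{1-\delta}$ such that for every finite-dimensional reference space $\mathcal R$, every density operator $\rho$ on $S\otimes\mathcal R$ and every key $k$, $\|(E_k\otimes\mathrm{id}_{\mathcal R})(\rho)-\rho\|_{\mathrm{tr}}\le\varepsilon$. * No: $\|\Omega-2^{-m}\sum_kE_k\|_\diamond\le\varepsilon$, where $\Omega(X)=\operatorname{tr}(X)\,\mathbb 1_{\mathcal K}/\dim\mathcal K$, and there is a circuit $D$, of size at most $p$ of the size of $E$, such that $\|D_k\circ E_k-\mathrm{id}_{\mathcal H}\|_\diamond\le\varepsilon$ for all $k$. Protocol. On input $E$ and a proof state on $(\mathcal H\otimes\mathcal R)^{\otimes2}$ with $\dim\mathcal R=\dim\mathcal H$, the verifier picks independent uniformly random keys $k_1,k_2\in\{0,1\}^m$, applies $(E_{k_1}\otimes\mathrm{id}_{\mathcal R})\otimes(E_{k_2}\otimes\mathrm{id}_{\mathcal R})$ to the proof state, performs the swap test (the projective measurement $\{(\mathbb 1+W)/2,(\mathbb 1-W)/2\}$, $W$ the swap of the two copies of $\mathcal K\otimes\mathcal R$), and accepts if the outcome is symmetric. Proposition. For $0<\varepsilon<1/8$, $0<\delta\le1$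 and every polynomial $p$, this protocol is a QMA protocol for $\mathrm{DI}_{\varepsilon,\delta}$, with completeness $1-\varepsilon$ and soundness $\tfrac34+\varepsilon<1-\varepsilon$. That is, there are circuits $V_E$, whose descriptions are computed from the description of $E$ by a deterministic Turing machine in polynomial time (and which do not depend on $\varepsilon,\delta,p$), such that measuring the single output qubit of $V_E$ gives $1$ with exactly the acceptance probability of the protocol on every proof state, and: * if $E$ is a yes instance, some proof state of the form $|\psi\rangle\otimes|\psi\rangle$ with a unit vector $|\psi\rangle\in\mathcal H\otimes\mathcal R$ is accepted with probability at least $1-\varepsilon$; * if $E$ is a no instance, every proof state is accepted with probability at most $\tfrac12+\tfrac1{2\dim\mathcal K}+\varepsilon\ (\le\tfrac34+\varepsilon)$. -/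

import Mathlib

open scoped ENNReal ComplexOrder

noncomputable section

/-! ### States, trace norm, diamond norm -/

/-- Labels of the computational basis of an `n`-qubit space. -/
abbrev Qubits (n : ℕ) : Type := Fin n → Bool

/-- Linear operators on the Hilbert space `ℂ^A`. -/
abbrev Op (A : Type) : Type := Matrix A A ℂ

/-- Density operators. -/
def IsDensity {A : Type} [Fintype A] (ρ : Op A) : Prop :=
  ρ.PosSemidef ∧ ρ.trace = 1

/-- The trace norm `tr √(X* X)`, i.e. the sum of the singular values of `X`. -/
def traceNorm {A : Type} [Fintype A] [DecidableEq A] (X : Op A) : ℝ :=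
  ∑ i, Real.sqrt ((Matrix.isHermitian_conjTranspose_mul_self X).eigenvalues i)

/-- `Φ ⊗ id_R`, acting blockwise. -/
def tensorId {A B : Type} (Φ : Op A →ₗ[ℂ] Op B) (R : Type) : Op (A × R) →ₗ[ℂ] Op (B × R) where
  toFun X := Matrix.of fun x y => Φ (fun a a' => X (a, x.2) (a', y.2)) x.1 y.1
  map_add' X Y := by
    ext x y
    exact congrFun (congrFun (Φ.map_add (fun a a' => X (a, x.2) (a', y.2))
      (fun a a' => Y (a, x.2) (a', y.2))) x.1) y.1
  map_smul' c X := by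
    ext x y
    exact congrFun (congrFun (Φ.map_smul c (fun a a' => X (a, x.2) (a', y.2))) x.1) y.1

/-- `id_R ⊗ Φ`, acting blockwise. -/
def idTensor {A B : Type} (R : Type) (Φ : Op A →ₗ[ℂ] Op B) : Op (R × A) →ₗ[ℂ] Op (R × B) where
  toFun X := Matrix.of fun x y => Φ (fun a a' => X (x.1, a) (y.1, a')) x.2 y.2
  map_add' X Y := by
    ext x y
    exact congrFun (congrFun (Φ.map_add (fun a a' => X (x.1, a) (y.1, a'))
      (fun a a' => Y (x.1, a) (y.1, a'))) x.2) y.2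
  map_smul' c X := by
    ext x y
    exact congrFun (congrFun (Φ.map_smul c (fun a a' => X (x.1, a) (y.1, a'))) x.2) y.2

/-- `Φ ⊗ Ψ`. -/
def mapTensor {A A' B B' : Type} (Φ : Op A →ₗ[ℂ] Op B) (Ψ : Op A' →ₗ[ℂ] Op B') :
    Op (A × A') →ₗ[ℂ] Op (B × B') :=
  tensorId Φ B' ∘ₗ idTensor A Ψ

/-- The diamond norm `sup_X ‖(Φ ⊗ id_H)(X)‖_tr / ‖X‖_tr` over nonzero `X ∈ L(H ⊗ H)`,
for `Φ : L(H) → L(K)`. -/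
def diamondNorm {A B : Type} [Fintype A] [DecidableEq A] [Fintype B] [DecidableEq B]
    (Φ : Op A →ₗ[ℂ] Op B) : ℝ≥0∞ :=
  ⨆ (X : Op (A × A)) (_ : X ≠ 0),
    ENNReal.ofReal (traceNorm (tensorId Φ A X)) / ENNReal.ofReal (traceNorm X)

/-- The completely depolarizing channel, `X ↦ tr(X) 𝟙 / dim K`. -/
def depolarizing (A B : Type) [Fintype A] [Fintype B] [DecidableEq B] :
    Op A →ₗ[ℂ] Op B :=
  LinearMap.smulRight (Matrix.traceLinearMap A ℂ ℂ) ((Fintype.card B : ℂ)⁻¹ • (1 : Op B))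

/-! ### Mixed-state quantum circuits -/

/-- Gates with `n` input wires and `m` output wires: Hadamard, the `π/8` gate `T`,
controlled-not, Toffoli (targets come last), the introduction of an ancilla in state `|0⟩` (it
becomes wire `0`, the old wire `i` becomes wire `i + 1`), and tracing out a wire. -/
inductive QGate : ℕ → ℕ → Type
  | hadamard {n : ℕ} (i : Fin n) : QGate n n
  | tGate {n : ℕ} (i : Fin n) : QGate n n
  | cnot {n : ℕ} (i j : Fin n) (hij : i ≠ j) : QGate n n
  | toffoli {n : ℕ} (i j k : Fin n) (hij : i ≠ j) (hik : i ≠ k) (hjk : j ≠ k) : QGate n n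
  | ancilla {n : ℕ} : QGate n (n + 1)
  | discard {n : ℕ} (i : Fin (n + 1)) : QGate (n + 1) n

/-- Circuits with `n` input qubits and `m` output qubits: sequences of gates, the first gate of the
sequence being applied first. -/
inductive QCircuit : ℕ → ℕ → Type
  | nil {n : ℕ} : QCircuit n n
  | cons {n k m : ℕ} (g : QGate n k) (c : QCircuit k m) : QCircuit n m

/-- Hadamard gate on wire `i`. -/
def hadamardOp {n : ℕ} (i : Fin n) : Op (Qubits n) := fun x y =>
  if ∀ j, j ≠ i → x j = y j then
    ((Real.sqrt 2 : ℝ) : ℂ)⁻¹ * (if x i = true ∧ y i = true then -1 else 1)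
  else 0

/-- The gate `diag(1, exp(iπ/4))` on wire `i`. -/
def tOp {n : ℕ} (i : Fin n) : Op (Qubits n) :=
  Matrix.diagonal fun x => if x i = true then Complex.exp (Complex.I * (Real.pi / 4 : ℝ)) else 1

/-- Controlled-not with control `i` and target `j`. -/
def cnotOp {n : ℕ} (i j : Fin n) : Op (Qubits n) := fun x y =>
  if x = Function.update y j (xor (y j) (y i)) then 1 else 0

/-- Toffoli gate with controls `i`, `j` and target `k`. -/
def toffoliOp {n : ℕ} (i j k : Fin n) : Op (Qubits n) := fun x y =>
  if x = Function.update y k (xor (y k) (y i && y j)) then 1 else 0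

/-- `ρ ↦ U ρ U*`. -/
def conjMap {A : Type} [Fintype A] (U : Op A) : Op A →ₗ[ℂ] Op A :=
  LinearMap.mulLeft ℂ U ∘ₗ LinearMap.mulRight ℂ U.conjTranspose

/-- `ρ ↦ |0⟩⟨0| ⊗ ρ`, the new qubit being wire `0`. -/
def ancillaMap (n : ℕ) : Op (Qubits n) →ₗ[ℂ] Op (Qubits (n + 1)) where
  toFun ρ := Matrix.of fun x y => if x 0 = false ∧ y 0 = false then ρ (Fin.tail x) (Fin.tail y) else 0
  map_add' ρ σ := by
    ext x y
    by_cases h : x 0 = false ∧ y 0 = false <;> simp [h]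
  map_smul' c ρ := by
    ext x y
    by_cases h : x 0 = false ∧ y 0 = false <;> simp [h]

/-- The partial trace over wire `i`. -/
def discardMap {n : ℕ} (i : Fin (n + 1)) : Op (Qubits (n + 1)) →ₗ[ℂ] Op (Qubits n) where
  toFun ρ := Matrix.of fun x y =>
    ∑ b : Bool, ρ (Fin.insertNth (α := fun _ => Bool) i b x)
      (Fin.insertNth (α := fun _ => Bool) i b y)
  map_add' ρ σ := by
    ext x y
    simp [Finset.sum_add_distrib]
  map_smul' c ρ := by
    ext x y
    simp [mul_add]

/-- The channel of a gate. -/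
def QGate.channel {n m : ℕ} : QGate n m → (Op (Qubits n) →ₗ[ℂ] Op (Qubits m))
  | .hadamard i => conjMap (hadamardOp i)
  | .tGate i => conjMap (tOp i)
  | .cnot i j _ => conjMap (cnotOp i j)
  | .toffoli i j k _ _ _ => conjMap (toffoliOp i j k)
  | .ancilla => ancillaMap _
  | .discard i => discardMap i

/-- The channel implemented by a circuit. -/
def QCircuit.channel {n m : ℕ} : QCircuit n m → (Op (Qubits n) →ₗ[ℂ] Op (Qubits m))
  | .nil => LinearMap.id
  | .cons g c => c.channel ∘ₗ g.channel

/-- The number of gates. -/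
def QCircuit.gateCount {n m : ℕ} : QCircuit n m → ℕ
  | .nil => 0
  | .cons _ c => c.gateCount + 1

/-- The size of a circuit: its number of input qubits plus its number of gates. -/
def QCircuit.size {n m : ℕ} (c : QCircuit n m) : ℕ := n + c.gateCount

/-- `ρ ↦ |k⟩⟨k| ⊗ ρ`, the `m` qubits of `|k⟩` being the first ones. -/
def attachKey {m : ℕ} (n : ℕ) (k : Qubits m) : Op (Qubits n) →ₗ[ℂ] Op (Qubits (m + n)) where
  toFun ρ := Matrix.of fun x y =>
    if (fun i => x (Fin.castAdd n i)) = k ∧ (fun i => y (Fin.castAdd n i)) = k then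
      ρ (fun i => x (Fin.natAdd m i)) (fun i => y (Fin.natAdd m i)) else 0
  map_add' ρ σ := by
    ext x y
    by_cases h : (fun i => x (Fin.castAdd n i)) = k ∧ (fun i => y (Fin.castAdd n i)) = k <;>
      simp [h]
  map_smul' c ρ := by
    ext x y
    by_cases h : (fun i => x (Fin.castAdd n i)) = k ∧ (fun i => y (Fin.castAdd n i)) = k <;>
      simp [h]

/-- The channel implemented by a circuit whose first `m` input qubits are set to the classical
string `k`. -/
def QCircuit.keyed {m n l : ℕ} (c : QCircuit (m + n) l) (k : Qubits m) :
    Op (Qubits n) →ₗ[ℂ] Op (Qubits l) :=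
  c.channel ∘ₗ attachKey n k

/-! ### Descriptions of circuits as strings over a finite alphabet -/

/-- The alphabet used to write down circuits. -/
inductive CircuitSym
  | one | sep | hadamard | tGate | cnot | toffoli | ancilla | discard
  deriving DecidableEq

instance : Fintype CircuitSym where
  elems := {.one, .sep, .hadamard, .tGate, .cnot, .toffoli, .ancilla, .discard}
  complete x := by cases x <;> decide

/-- A natural number in unary, with an end marker. -/
def unary (i : ℕ) : List CircuitSym := List.replicate i CircuitSym.one ++ [CircuitSym.sep]

/-- The description of a gate: its name, followed by the wires it acts on. -/
def QGate.symbols {n m : ℕ} : QGate n m → List CircuitSym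
  | .hadamard i => CircuitSym.hadamard :: unary i
  | .tGate i => CircuitSym.tGate :: unary i
  | .cnot i j _ => CircuitSym.cnot :: (unary i ++ unary j)
  | .toffoli i j k _ _ _ => CircuitSym.toffoli :: (unary i ++ unary j ++ unary k)
  | .ancilla => [CircuitSym.ancilla]
  | .discard i => CircuitSym.discard :: unary i

/-- The description of a gate sequence. -/
def QCircuit.symbols {n m : ℕ} : QCircuit n m → List CircuitSym
  | .nil => []
  | .cons g c => g.symbols ++ c.symbols

theorem unary_append_inj {i j : ℕ} {l l' : List CircuitSym} (h : unary i ++ l = unary j ++ l') :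
    i = j ∧ l = l' := by
  induction i generalizing j with
  | zero => cases j with
    | zero => simpa [unary] using h
    | succ j => simp [unary, List.replicate_succ] at h
  | succ i ih => cases j with
    | zero => simp [unary, List.replicate_succ] at h
    | succ j =>
      have := @ih j (by simpa [unary, List.replicate_succ] using h)
      exact ⟨by omega, this.2⟩

theorem QGate.symbols_append_inj {n k k' : ℕ} (g : QGate n k) (g' : QGate n k')
    {l l' : List CircuitSym} (h : g.symbols ++ l = g'.symbols ++ l') :
    k = k' ∧ HEq g g' ∧ l = l' := by
  cases g <;> cases g' <;> simp only [QGate.symbols, List.cons_append, List.append_assoc,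
    List.cons.injEq, reduceCtorEq, false_and, true_and, List.nil_append] at h
  · obtain ⟨h1, h2⟩ := unary_append_inj h
    simp [Fin.ext h1, h2]
  · obtain ⟨h1, h2⟩ := unary_append_inj h
    simp [Fin.ext h1, h2]
  · obtain ⟨h1, h2⟩ := unary_append_inj h
    obtain ⟨h3, h4⟩ := unary_append_inj h2
    simp [Fin.ext h1, Fin.ext h3, h4]
  · obtain ⟨h1, h2⟩ := unary_append_inj h
    obtain ⟨h3, h4⟩ := unary_append_inj h2
    obtain ⟨h5, h6⟩ := unary_append_inj h4
    simp [Fin.ext h1, Fin.ext h3, Fin.ext h5, h6]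
  · simp [h]
  · obtain ⟨h1, h2⟩ := unary_append_inj h
    simp [Fin.ext h1, h2]

theorem QCircuit.symbols_inj {n m m' : ℕ} (c : QCircuit n m) (c' : QCircuit n m')
    (h : c.symbols = c'.symbols) : m = m' ∧ HEq c c' := by
  induction c with
  | nil => cases c' with
    | nil => simp
    | cons g c => cases g <;> simp [QCircuit.symbols, QGate.symbols] at h
  | cons g c ih => cases c' with
    | nil => cases g <;> simp [QCircuit.symbols, QGate.symbols] at h
    | cons g' c' =>
      obtain ⟨rfl, h2, h3⟩ := QGate.symbols_append_inj g g' h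
      obtain ⟨rfl, h4⟩ := ih c' h3
      cases h2
      cases h4
      simp

/-! ### QMA protocols -/

/-- A circuit with a single output qubit, bundled with the number of its input qubits. -/
abbrev VerifierCircuit : Type := Σ w : ℕ, QCircuit w 1

/-- The description of a verifier circuit. -/
def VerifierCircuit.encode (V : VerifierCircuit) : List CircuitSym := unary V.1 ++ V.2.symbols

theorem VerifierCircuit.encode_injective : Function.Injective VerifierCircuit.encode := by
  rintro ⟨w, c⟩ ⟨w', c'⟩ h
  obtain ⟨h1, h2⟩ := unary_append_inj h
  dsimp only at h1 h2
  subst h1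
  obtain ⟨-, h3⟩ := QCircuit.symbols_inj c c' h2
  rw [eq_of_heq h3]

/-- The probability that measuring the output qubit of a one-output circuit in the computational
basis gives `|1⟩`. -/
def QCircuit.acceptProb {w : ℕ} (c : QCircuit w 1) (ρ : Op (Qubits w)) : ℝ :=
  (c.channel ρ (fun _ => true) (fun _ => true)).re

/-- A promise problem. -/
structure PromiseProblem (α : Type) where
  yes : Set α
  no : Set α

/-- `V` is a QMA protocol for the promise problem `L` with completeness `c` and soundness `s`: from
an instance `x`, written with the encoding `enc`, a deterministic Turing machine finds in polynomial
time the description of the circuit that the verifier applies to the witness; there is a gap between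
the constants `s` and `c`; on a yes instance some witness state is accepted with probability at
least `c`, and on a no instance every state is accepted with probability at most `s`. -/
structure IsQMAProtocol {α : Type} (enc : α → List CircuitSym) (L : PromiseProblem α) (c s : ℝ)
    (V : α → VerifierCircuit) : Prop where
  polyTime : Nonempty (Turing.TM2ComputableInPolyTime enc VerifierCircuit.encode V)
  gap : 0 ≤ s ∧ s < c ∧ c ≤ 1
  complete : ∀ x ∈ L.yes, ∃ ρ, IsDensity ρ ∧ c ≤ (V x).2.acceptProb ρ
  sound : ∀ x ∈ L.no, ∀ ρ, IsDensity ρ → (V x).2.acceptProb ρ ≤ s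

/-! ### Detecting insecure encryption -/

/-- A circuit that takes `m` classical key bits and `n` qubits to `l ≥ n` qubits (at least one). -/
structure EncryptionCircuit where
  m : ℕ
  n : ℕ
  l : ℕ
  le : n ≤ l
  pos : 0 < l
  circuit : QCircuit (m + n) l

namespace EncryptionCircuit

/-- The description of an instance. -/
def encode (E : EncryptionCircuit) : List CircuitSym :=
  unary E.m ++ unary E.n ++ unary E.l ++ E.circuit.symbols

theorem encode_injective : Function.Injective encode := by
  rintro ⟨m, n, l, h, hp, c⟩ ⟨m', n', l', h', hp', c'⟩ e
  simp only [encode, List.append_assoc] at e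
  obtain ⟨rfl, e⟩ := unary_append_inj e
  obtain ⟨rfl, e⟩ := unary_append_inj e
  obtain ⟨rfl, e⟩ := unary_append_inj e
  obtain ⟨-, h3⟩ := QCircuit.symbols_inj c c' e
  rw [eq_of_heq h3]

/-- The channel `E_k`. -/
def chan (E : EncryptionCircuit) (k : Qubits E.m) : Op (Qubits E.n) →ₗ[ℂ] Op (Qubits E.l) :=
  E.circuit.keyed k

/-- The average `2^{-m} ∑_k E_k`. -/
def average (E : EncryptionCircuit) : Op (Qubits E.n) →ₗ[ℂ] Op (Qubits E.l) :=
  ((2 : ℂ) ^ E.m)⁻¹ • ∑ k : Qubits E.m, E.chan k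

end EncryptionCircuit

/-- The inclusion of the `n`-qubit space into the `l`-qubit space, `|x⟩ ↦ |x⟩|0…0⟩`. It is the
identity if `n = l`. -/
def padding {n l : ℕ} (h : n ≤ l) : Matrix (Qubits l) (Qubits n) ℂ := fun y x =>
  if (∀ i : Fin n, y (Fin.castLE h i) = x i) ∧ (∀ j : Fin l, n ≤ j → y j = false) then 1 else 0

/-- `X ↦ J X J*` on operators, with `J` the inclusion `padding h`. -/
def paddingMap {n l : ℕ} (h : n ≤ l) : Op (Qubits n) →ₗ[ℂ] Op (Qubits l) where
  toFun X := padding h * X * (padding h).conjTranspose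
  map_add' X Y := by rw [Matrix.mul_add, Matrix.add_mul]
  map_smul' c X := by simp

/-- `ρ` is a density operator on `S ⊗ ℂ^R`: a density operator whose range is contained in
`S ⊗ ℂ^R`, the space of the vectors all of whose `R`-slices lie in `S`. -/
def IsDensityOn {A R : Type} [Fintype A] [Fintype R] (S : Submodule ℂ (A → ℂ))
    (ρ : Op (A × R)) : Prop :=
  IsDensity ρ ∧ ∀ v : A × R → ℂ, ∀ r : R, (fun a => (ρ.mulVec v) (a, r)) ∈ S

/-- The problem of detecting insecure encryption. The decryption circuit of a no instance has size
at most `p` of the size of the encryption circuit. -/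
def detectInsecure (ε δ : ℝ) (p : Polynomial ℕ) : PromiseProblem EncryptionCircuit where
  yes := {E | ∃ S : Submodule ℂ (Qubits E.n → ℂ),
    ((2 : ℝ) ^ E.n) ^ (1 - δ) ≤ (Module.finrank ℂ S : ℝ) ∧
    ∀ (R : Type) [Fintype R] [DecidableEq R] (ρ : Op (Qubits E.n × R)), IsDensityOn S ρ →
      ∀ k : Qubits E.m,
        traceNorm (tensorId (E.chan k) R ρ - tensorId (paddingMap E.le) R ρ) ≤ ε}
  no := {E | diamondNorm (depolarizing (Qubits E.n) (Qubits E.l) - E.average) ≤ ENNReal.ofReal ε ∧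
    ∃ D : QCircuit (E.m + E.l) E.n, D.size ≤ p.eval E.circuit.size ∧
      ∀ k : Qubits E.m,
        diamondNorm (D.keyed k ∘ₗ E.chan k - LinearMap.id) ≤ ENNReal.ofReal ε}

/-! ### The protocol -/

/-- The swap operator `W (ψ ⊗ φ) = φ ⊗ ψ`. -/
def swapOp (A : Type) [DecidableEq A] : Op (A × A) := fun x y => if x = y.swap then 1 else 0

/-- The projection `(𝟙 + W) / 2` onto the symmetric subspace. -/
def symProj (A : Type) [DecidableEq A] : Op (A × A) := (2 : ℂ)⁻¹ • (1 + swapOp A)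

/-- The acceptance probability of the protocol on a proof state `ρ` on `(H ⊗ R) ⊗ (H ⊗ R)` with
`R = H`: for independent uniformly random keys `k₁, k₂`, the probability of the symmetric outcome of
the swap test on `((E_{k₁} ⊗ id_R) ⊗ (E_{k₂} ⊗ id_R))(ρ)`. -/
def EncryptionCircuit.protocolAcceptProb (E : EncryptionCircuit)
    (ρ : Op ((Qubits E.n × Qubits E.n) × (Qubits E.n × Qubits E.n))) : ℝ :=
  ((2 : ℝ) ^ E.m * 2 ^ E.m)⁻¹ * ∑ k₁ : Qubits E.m, ∑ k₂ : Qubits E.m,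
    (symProj (Qubits E.l × Qubits E.n) *
      mapTensor (tensorId (E.chan k₁) (Qubits E.n)) (tensorId (E.chan k₂) (Qubits E.n)) ρ).trace.re

/-- Concatenation of the four registers `H, R, H, R` of a proof state. -/
def joinRegisters {n : ℕ} (x : (Qubits n × Qubits n) × (Qubits n × Qubits n)) :
    Qubits ((n + n) + (n + n)) :=
  Fin.append (Fin.append x.1.1 x.1.2) (Fin.append x.2.1 x.2.2)

end

/-!
Apply the encryption with independent uniform keys to both copies: the swap test accepts with
probability `1/2 + Re tr (W σ) / 2`, where `σ = (Ē ⊗ id)^{⊗2}(ρ)` and `Ē` is the average channel.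

If `Ē` is within `ε` of the depolarizing channel `Ω` in the diamond norm, then replacing one copy
of `Ē` at a time by `Ω` changes `tr (W σ)` by at most `2ε`, since `‖W‖ ≤ 1`. For `Ω` the
ciphertext registers contribute the factor `tr W_K / (dim K)^2 = 1 / dim K`, and what is left is
the expectation in `ρ` of the swap of the reference registers, which is at most `1`.

If every `E_k` nearly fixes the states on `S ⊗ R`, take a unit vector `ψ ∈ S ⊗ R` and the proof
state `ψ ⊗ ψ`. Then `tr (W σ) = tr τ²` for `τ = (Ē ⊗ id)(|ψ⟩⟨ψ|)`, and
`tr τ² ≥ 2 Re tr (τ P) - 1 ≥ 1 - 2ε` for the pure state `P = |ψ⟩⟨ψ|`.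

The verifier makes key bits by copying Hadamard-rotated ancillas to qubits that it traces out,
runs the given circuit, rotates the wires, runs the circuit again on fresh key bits, and performs
the swap test by controlled swaps whose control starts in `(|0⟩ - |1⟩) / √2`. Its description
consists of two copies of the given description and of words that nested loops over `m`, `n` and
`l` print, which is why a stack machine writes it in polynomial time.
-/

noncomputable section

/-! ### Structured programs for multi-stack machines -/

/-- Structured programs acting on stacks indexed by `K` over the alphabet `Γ`. `emit k w` pushes a
word on `k`, its first letter ending up on top; `transfer f k ts` pops symbols from `k` and pushes
each of them on all stacks in `ts`, until `k` is empty or the popped symbol violates `f` (that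
symbol is lost); `loop k p` runs `p` once for each symbol popped from `k`, until `k` is empty. -/
inductive StackProg (K Γ : Type)
  | emit (k : K) (w : List Γ)
  | transfer (f : Γ → Bool) (k : K) (ts : List K)
  | seq (p q : StackProg K Γ)
  | loop (k : K) (p : StackProg K Γ)

namespace StackProg

open Turing StateTransition

variable {K Γ Λ : Type}

/-- The control points of a program, which become the labels of a machine. -/
def Label : StackProg K Γ → Type
  | emit _ _ => Unit
  | transfer _ _ _ => Unit
  | seq p q => p.Label ⊕ q.Label
  | loop _ p => Option p.Label

instance labelFintype : (p : StackProg K Γ) → Fintype p.Label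
  | emit _ _ => inferInstanceAs (Fintype Unit)
  | transfer _ _ _ => inferInstanceAs (Fintype Unit)
  | seq p q =>
    letI := labelFintype p
    letI := labelFintype q
    inferInstanceAs (Fintype (p.Label ⊕ q.Label))
  | loop _ p =>
    letI := labelFintype p
    inferInstanceAs (Fintype (Option p.Label))

/-- The control point at which a program starts. -/
def entry : (p : StackProg K Γ) → p.Label
  | emit _ _ => ()
  | transfer _ _ _ => ()
  | seq p _ => Sum.inl p.entry
  | loop _ _ => none

/-- Statements of a machine whose only register holds the symbol popped last. -/
abbrev Instr (K Γ Λ : Type) : Type := TM2.Stmt (fun _ : K => Γ) Λ (Option Γ)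

/-- Configurations of a machine whose only register holds the symbol popped last. -/
abbrev Config (K Γ Λ : Type) : Type := TM2.Cfg (fun _ : K => Γ) Λ (Option Γ)

/-- Stack contents, the top of a stack being the head of the list. -/
abbrev Stacks (K Γ : Type) : Type := K → List Γ

/-- The statement that pushes a word and continues with another statement. -/
def pushWord (k : K) : List Γ → Instr K Γ Λ → Instr K Γ Λ
  | [], q => q
  | a :: w, q => pushWord k w (.push k (fun _ => a) q)

/-- The statement that pushes the register on several stacks and continues with another
statement. The default symbol stands for an empty register, which is never pushed. -/
def pushAll [Inhabited Γ] : List K → Instr K Γ Λ → Instr K Γ Λ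
  | [], q => q
  | k :: ks, q => .push k (fun v => v.getD default) (pushAll ks q)

/-- The statements of a program, its control points being embedded into `Λ` by `emb`; the control
is passed to `exit` in the end. -/
def code [Inhabited Γ] : (p : StackProg K Γ) → (p.Label → Λ) → Λ → p.Label → Instr K Γ Λ
  | emit k w, _, exit, _ => pushWord k w (.goto fun _ => exit)
  | transfer f k ts, emb, exit, _ =>
    .pop k (fun _ a => a) (.branch (Option.any f) (pushAll ts (.goto fun _ => emb ()))
      (.goto fun _ => exit))
  | seq p q, emb, exit, l =>
    Sum.rec (p.code (emb ∘ Sum.inl) (emb (Sum.inr q.entry))) (q.code (emb ∘ Sum.inr) exit) l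
  | loop k p, emb, exit, l =>
    Option.rec (.pop k (fun _ a => a) (.branch Option.isSome
        (.goto fun _ => emb (some p.entry)) (.goto fun _ => exit)))
      (p.code (emb ∘ some) (emb none)) l

variable [DecidableEq K]

theorem stepAux_pushWord (k : K) (w : List Γ) (q : Instr K Γ Λ) (v : Option Γ) (S : Stacks K Γ) :
    TM2.stepAux (pushWord k w q) v S = TM2.stepAux q v (Function.update S k (w ++ S k)) := by
  induction w generalizing q with
  | nil => simp [pushWord]
  | cons a w ih => simp [pushWord, ih]

theorem stepAux_pushAll [Inhabited Γ] {ts : List K} (hts : ts.Nodup) (q : Instr K Γ Λ) (a : Γ)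
    (S : Stacks K Γ) :
    TM2.stepAux (pushAll ts q) (some a) S =
      TM2.stepAux q (some a) fun x => if x ∈ ts then a :: S x else S x := by
  induction ts generalizing S with
  | nil => simp [pushAll]
  | cons k ts ih =>
    rw [List.nodup_cons] at hts
    simp only [pushAll, TM2.stepAux, Option.getD_some, ih hts.2]
    congr 1
    funext x
    obtain rfl | hx := eq_or_ne x k
    · simp [hts.1]
    · simp [hx]

/-- The machine `M` gets from the configuration `a` to `b` within `t` steps. -/
def ReachesIn (M : Λ → Instr K Γ Λ) (a b : Config K Γ Λ) (t : ℕ) : Prop :=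
  Nonempty (EvalsToInTime (TM2.step M) a (some b) t)

theorem ReachesIn.single {M : Λ → Instr K Γ Λ} {l : Λ} {v : Option Γ} {S : Stacks K Γ}
    {b : Config K Γ Λ} (h : TM2.stepAux (M l) v S = b) : ReachesIn M ⟨some l, v, S⟩ b 1 :=
  ⟨⟨⟨1, congrArg some h⟩, le_rfl⟩⟩

theorem ReachesIn.trans {M : Λ → Instr K Γ Λ} {a b c : Config K Γ Λ} {s t : ℕ}
    (h : ReachesIn M a b s) (h' : ReachesIn M b c t) : ReachesIn M a c (s + t) :=
  Nat.add_comm t s ▸ h.elim fun h => h'.elim fun h' => ⟨h.trans _ _ _ _ _ _ h'⟩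

theorem ReachesIn.mono {M : Λ → Instr K Γ Λ} {a b : Config K Γ Λ} {s t : ℕ}
    (h : ReachesIn M a b s) (hst : s ≤ t) : ReachesIn M a b t :=
  h.elim fun h => ⟨⟨h.toEvalsTo, h.steps_le_m.trans hst⟩⟩

variable [Inhabited Γ]

/-- Started with the stacks `S`, the program `p` terminates within `t` steps with the stacks `S'`,
in every machine that contains its code and whatever the register holds. -/
def Runs (p : StackProg K Γ) (S S' : Stacks K Γ) (t : ℕ) : Prop :=
  ∀ ⦃Λ : Type⦄ (emb : p.Label → Λ) (exit : Λ) (M : Λ → Instr K Γ Λ),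
    (∀ l, M (emb l) = p.code emb exit l) → ∀ v, ∃ v',
      ReachesIn M ⟨some (emb p.entry), v, S⟩ ⟨some exit, v', S'⟩ t

theorem Runs.mono {p : StackProg K Γ} {S S' : Stacks K Γ} {s t : ℕ} (h : p.Runs S S' s)
    (hst : s ≤ t) : p.Runs S S' t := fun _ emb exit M hM v =>
  (h emb exit M hM v).imp fun _ h => h.mono hst

theorem runs_emit (k : K) (w : List Γ) (S : Stacks K Γ) :
    (emit k w).Runs S (Function.update S k (w ++ S k)) 1 := fun _ emb exit M hM v =>
  ⟨v, .single (by rw [hM, code, stepAux_pushWord, TM2.stepAux])⟩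

theorem Runs.seq {p q : StackProg K Γ} {S S' S'' : Stacks K Γ} {s t : ℕ} (hp : p.Runs S S' s)
    (hq : q.Runs S' S'' t) : (p.seq q).Runs S S'' (s + t) := by
  intro Λ emb exit M hM v
  obtain ⟨v', h⟩ := hp (emb ∘ Sum.inl) (emb (Sum.inr q.entry)) M (fun l => hM (Sum.inl l)) v
  obtain ⟨v'', h'⟩ := hq (emb ∘ Sum.inr) exit M (fun l => hM (Sum.inr l)) v'
  exact ⟨v'', h.trans h'⟩

theorem runs_transfer (f : Γ → Bool) {k : K} {ts : List K} (hts : ts.Nodup) (hk : k ∉ ts)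
    (S : Stacks K Γ) :
    (transfer f k ts).Runs S
      (fun x => if x = k then ((S k).dropWhile f).tail else
        if x ∈ ts then ((S k).takeWhile f).reverse ++ S x else S x) ((S k).length + 1) := by
  intro Λ emb exit M hM v
  have hM : M (emb (entry _)) = _ := hM ()
  generalize hw : S k = w
  induction w generalizing S v with
  | nil =>
    refine ⟨none, .single ?_⟩
    rw [hM]
    simp only [code, TM2.stepAux, hw, List.head?_nil, Option.any_none, cond_false]
    congr 1
    funext x
    obtain rfl | hx := eq_or_ne x k <;> simp [*]
  | cons a w ih =>
    cases hf : f a with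
    | false =>
      refine ⟨some a, ReachesIn.mono (.single ?_) (Nat.le_add_left 1 _)⟩
      rw [hM]
      simp only [code, TM2.stepAux, hw, List.head?_cons, Option.any_some, hf, cond_false]
      congr 1
      funext x
      obtain rfl | hx := eq_or_ne x k <;> simp [*]
    | true =>
      let S₁ : Stacks K Γ := fun x =>
        if x ∈ ts then a :: Function.update S k w x else Function.update S k w x
      have hstep : TM2.stepAux (M (emb (entry (transfer f k ts)))) v S =
          ⟨some (emb (entry _)), some a, S₁⟩ := by
        rw [hM]
        simp only [code, TM2.stepAux, hw, List.head?_cons, Option.any_some, hf, cond_true,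
          stepAux_pushAll hts]
        rfl
      obtain ⟨v', h⟩ := ih S₁ (some a) (by simp [S₁, hk])
      refine ⟨v', ?_⟩
      convert (ReachesIn.single hstep).trans h using 1
      · congr 1
        funext x
        obtain rfl | hx := eq_or_ne x k
        · simp [hf]
        · by_cases hx' : x ∈ ts <;> simp [S₁, hx, hx', hf]
      · rw [List.length_cons, Nat.add_comm]

theorem runs_loop_nil {k : K} (p : StackProg K Γ) {S : Stacks K Γ} (h : S k = []) :
    (loop k p).Runs S S 1 := by
  intro Λ emb exit M hM v
  have hM : M (emb (entry _)) = _ := hM none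
  have hS : Function.update S k [] = S := Function.update_eq_self_iff.mpr h.symm
  exact ⟨none, .single (by simp [hM, code, h, hS])⟩

theorem runs_loop_cons {k : K} {p : StackProg K Γ} {S S' S'' : Stacks K Γ} {a : Γ}
    {w : List Γ} {s t : ℕ} (h : S k = a :: w) (hp : p.Runs (Function.update S k w) S' s)
    (hloop : (loop k p).Runs S' S'' t) : (loop k p).Runs S S'' (1 + s + t) := by
  intro Λ emb exit M hM v
  obtain ⟨v', hbody⟩ := hp (emb ∘ some) (emb none) M (fun l => hM (some l)) (some a)
  obtain ⟨v'', hrest⟩ := hloop emb exit M hM v'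
  have hM : M (emb (entry _)) = _ := hM none
  refine ⟨v'', ReachesIn.trans (ReachesIn.trans (.single ?_) hbody) hrest⟩
  simp only [hM, code, TM2.stepAux, h, List.head?_cons, List.tail_cons,
    Option.isSome_some, cond_true]
  rfl

/-- The program that adds a copy of the stack `k` to the stack `d`. The detour through `aux` undoes
the reversal of the order of the symbols. -/
def copy (aux k d : K) : StackProg K Γ :=
  (transfer (fun _ => true) k [aux]).seq (transfer (fun _ => true) aux [k, d])

theorem runs_copy {aux k d : K} (hka : k ≠ aux) (hda : d ≠ aux) (hkd : k ≠ d) {S : Stacks K Γ}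
    (hS : S aux = []) :
    (copy aux k d).Runs S (Function.update S d (S k ++ S d)) (2 * (S k).length + 2) := by
  have htake (w : List Γ) : w.takeWhile (fun _ => true) = w :=
    List.takeWhile_eq_self_iff.mpr fun _ _ => rfl
  have hdrop (w : List Γ) : w.dropWhile (fun _ => true) = [] :=
    List.dropWhile_eq_nil_iff.mpr fun _ _ => rfl
  have hthere := runs_transfer (fun _ : Γ => true) (List.nodup_singleton aux) (by simpa using hka) S
  refine (hthere.seq ?_).mono (s := (S k).length + 1 + ((S k).length + 1)) (by omega)
  convert runs_transfer (fun _ : Γ => true) (k := aux) (ts := [k, d]) (by simpa using hkd)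
    (by simp [hka.symm, hda.symm]) _ using 1
  · funext x
    obtain rfl | hxd := eq_or_ne x d
    · simp [hda, hka.symm, hkd.symm, hS, htake]
    obtain rfl | hxk := eq_or_ne x k
    · simp [hka, hka.symm, hS, hxd, htake, hdrop]
    obtain rfl | hxa := eq_or_ne x aux
    · simp [hda.symm, hS, hdrop]
    · simp [hxd, hxk, hxa]
  · simp [hka.symm, hS, htake]

/-- The machine that runs a program, clears its register and halts. -/
def machine [Fintype K] [Fintype Γ] (p : StackProg K Γ) (inp out : K) : FinTM2 where
  K := K
  k₀ := inp
  k₁ := out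
  Γ _ := Γ
  Λ := Option p.Label
  main := some p.entry
  σ := Option Γ
  initialState := none
  Γk₀Fin := inferInstanceAs (Fintype Γ)
  m
    | none => .load (fun _ => none) .halt
    | some l => p.code some none l

theorem initList_eq_update (tm : FinTM2) (w : List (tm.Γ tm.k₀)) :
    initList tm w = (⟨some tm.main, tm.initialState, Function.update (fun _ => []) tm.k₀ w⟩ :
      TM2.Cfg tm.Γ tm.Λ tm.σ) := by
  have hstk : (initList tm w).stk = Function.update (fun _ => []) tm.k₀ w := by
    funext k
    by_cases hk : k = tm.k₀
    · subst hk
      rw [Function.update_self]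
      exact dif_pos rfl
    · rw [Function.update_of_ne hk]
      exact dif_neg hk
  rw [← hstk]
  rfl

theorem haltList_eq_update (tm : FinTM2) (w : List (tm.Γ tm.k₁)) :
    haltList tm w = (⟨none, tm.initialState, Function.update (fun _ => []) tm.k₁ w⟩ :
      TM2.Cfg tm.Γ tm.Λ tm.σ) := by
  have hstk : (haltList tm w).stk = Function.update (fun _ => []) tm.k₁ w := by
    funext k
    by_cases hk : k = tm.k₁
    · subst hk
      rw [Function.update_self]
      exact dif_pos rfl
    · rw [Function.update_of_ne hk]
      exact dif_neg hk
  rw [← hstk]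
  rfl

theorem nonempty_outputsInTime {tm : FinTM2} {w : List (tm.Γ tm.k₀)} {w' : List (tm.Γ tm.k₁)}
    {t : ℕ} (h : Nonempty (EvalsToInTime tm.step
      (⟨some tm.main, tm.initialState, Function.update (fun _ => []) tm.k₀ w⟩ : tm.Cfg)
      (some ⟨none, tm.initialState, Function.update (fun _ => []) tm.k₁ w'⟩) t)) :
    Nonempty (TM2OutputsInTime tm w (some w') t) := by
  rw [TM2OutputsInTime, Option.map_some, initList_eq_update, haltList_eq_update]
  exact h

theorem computableInPolyTime [Finite K] [Finite Γ] {α β : Type} {ea : α → List Γ}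
    {eb : β → List Γ} {f : α → β} (p : StackProg K Γ) (inp out : K) (time : Polynomial ℕ)
    (h : ∀ a, p.Runs (Function.update (fun _ => []) inp (ea a))
      (Function.update (fun _ => []) out (eb (f a))) (time.eval (ea a).length)) :
    Nonempty (TM2ComputableInPolyTime ea eb f) := by
  cases nonempty_fintype K
  cases nonempty_fintype Γ
  have hrun (a : α) : ReachesIn (p.machine inp out).m
      ⟨some (some p.entry), none, Function.update (fun _ => []) inp ((ea a).map id)⟩
      ⟨none, none, Function.update (fun _ => []) out ((eb (f a)).map id)⟩
      ((time + 1).eval (ea a).length) := by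
    obtain ⟨v, hv⟩ := h a some none (p.machine inp out).m (fun _ => rfl) none
    rw [List.map_id, List.map_id]
    exact ReachesIn.mono (hv.trans (.single rfl)) (by simp)
  exact ⟨{ tm := p.machine inp out
           inputAlphabet := Equiv.refl _
           outputAlphabet := Equiv.refl _
           time := time + 1
           outputsFun := fun a => (nonempty_outputsInTime (hrun a)).some }⟩

end StackProg

/-! ### Programs that write circuits -/

instance : Inhabited CircuitSym := ⟨.one⟩

/-- The concatenation of the words `w 0, …, w (c - 1)`. -/
def wordLoop (c : ℕ) (w : ℕ → List CircuitSym) : List CircuitSym := (List.range c).flatMap w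

theorem wordLoop_succ (c : ℕ) (w : ℕ → List CircuitSym) :
    wordLoop (c + 1) w = wordLoop c w ++ w c := by
  simp [wordLoop, List.range_succ]

theorem replicate_append_unary (i j : ℕ) :
    List.replicate i CircuitSym.one ++ unary j = unary (i + j) := by
  simp only [unary, List.replicate_add, List.append_assoc]

/-- The stacks of a program that writes circuits: input, output, scratch space, and registers
indexed by `R` holding natural numbers in unary. -/
inductive Tape (R : Type)
  | inp | out | scratch
  | reg (r : R)
  deriving DecidableEq, Fintype

namespace StackProg

open Tape

variable {R : Type}

/-- The stacks with input `s`, output `o` and register values `c`. -/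
@[simp]
def contents (s : List CircuitSym) (c : R → ℕ) (o : List CircuitSym) : Stacks (Tape R) CircuitSym
  | inp => s
  | out => o
  | scratch => []
  | reg r => List.replicate (c r) .one

variable [DecidableEq R]

theorem contents_zero_output (s : List CircuitSym) :
    contents s (0 : R → ℕ) [] = Function.update (fun _ => []) inp s := by
  funext k
  cases k <;> simp

theorem contents_zero_input (o : List CircuitSym) :
    contents [] (0 : R → ℕ) o = Function.update (fun _ => []) out o := by
  funext k
  cases k <;> simp

@[simp]
theorem update_contents_out (s : List CircuitSym) (c : R → ℕ) (o o' : List CircuitSym) :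
    Function.update (contents s c o) out o' = contents s c o' := by
  funext k
  cases k <;> simp

@[simp]
theorem update_contents_reg (s : List CircuitSym) (c : R → ℕ) (o : List CircuitSym) (r : R)
    (j : ℕ) :
    Function.update (contents s c o) (reg r) (List.replicate j .one) =
      contents s (Function.update c r j) o := by
  funext k
  cases k with
  | reg r' => obtain rfl | h := eq_or_ne r' r <;> simp [*]
  | _ => simp

/-- Within `t` steps the program `p`, started with input `s` and register values `c`, adds the word
`w` in front of the output and changes nothing else. -/
def Emits (p : StackProg (Tape R) CircuitSym) (s : List CircuitSym) (c : R → ℕ)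
    (w : List CircuitSym) (t : ℕ) : Prop :=
  ∀ o, p.Runs (contents s c o) (contents s c (w ++ o)) t

variable {p q : StackProg (Tape R) CircuitSym} {s : List CircuitSym} {c : R → ℕ}

theorem Emits.seq {w w' : List CircuitSym} {t t' : ℕ} (hp : p.Emits s c w t)
    (hq : q.Emits s c w' t') : (p.seq q).Emits s c (w' ++ w) (t + t') := fun o => by
  rw [List.append_assoc]
  exact (hp o).seq (hq (w ++ o))

theorem Emits.congr {w w' : List CircuitSym} {t t' : ℕ} (hp : p.Emits s c w t) (hw : w = w')
    (ht : t ≤ t') : p.Emits s c w' t' :=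
  hw ▸ fun o => (hp o).mono ht

theorem emits_emit (s : List CircuitSym) (c : R → ℕ) (w : List CircuitSym) :
    (emit out w).Emits s c w 1 := fun o => by
  simpa only [update_contents_out, contents] using runs_emit out w (contents s c o)

theorem emits_copy_input (s : List CircuitSym) (c : R → ℕ) :
    (copy scratch inp out).Emits s c s (2 * s.length + 2) := fun o => by
  simpa only [contents, update_contents_out] using
    runs_copy (S := contents s c o) (aux := scratch) (k := inp) (d := out) (by simp) (by simp)
      (by simp) rfl

theorem emits_copy_reg (s : List CircuitSym) (c : R → ℕ) (r : R) :
    (copy scratch (reg r) out).Emits s c (List.replicate (c r) .one) (2 * c r + 2) := fun o => by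
  simpa only [contents, List.length_replicate, update_contents_out] using
    runs_copy (S := contents s c o) (aux := scratch) (k := reg r) (d := out) (by simp) (by simp)
      (by simp) rfl

/-- Write the sum of `e` and the values of the registers `rs` in unary. -/
def emitNumber (e : ℕ) : List R → StackProg (Tape R) CircuitSym
  | [] => emit out (unary e)
  | r :: rs => (emitNumber e rs).seq (copy scratch (reg r) out)

theorem emits_emitNumber (s : List CircuitSym) {x : ℕ} (hx : ∀ r, c r ≤ x) (e : ℕ) (rs : List R) :
    (emitNumber e rs).Emits s c (unary ((rs.map c).sum + e)) (rs.length * (2 * x + 2) + 1) := by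
  induction rs with
  | nil => exact (emits_emit s c _).congr (by simp) (by simp)
  | cons r rs ih =>
    have hr := hx r
    refine (ih.seq (emits_copy_reg s c r)).congr ?_ ?_
    · rw [replicate_append_unary, List.map_cons, List.sum_cons, Nat.add_assoc]
    · rw [List.length_cons]
      linarith

/-- Run `p` with the register `i` counting down from the value of the register `r`. -/
def forEach (i r : R) (p : StackProg (Tape R) CircuitSym) : StackProg (Tape R) CircuitSym :=
  (copy scratch (reg r) (reg i)).seq (loop (reg i) p)

theorem runs_loop_reg {i : R} {w : ℕ → List CircuitSym} {T : ℕ} (n : ℕ)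
    (h : ∀ j < n, p.Emits s (Function.update c i j) (w j) T) (o : List CircuitSym) :
    (loop (reg i) p).Runs (contents s (Function.update c i n) o)
      (contents s (Function.update c i 0) (wordLoop n w ++ o)) (n * (T + 1) + 1) := by
  induction n generalizing o with
  | zero => exact (runs_loop_nil p (by simp)).mono (by simp)
  | succ n ih =>
    rw [wordLoop_succ, List.append_assoc]
    refine (runs_loop_cons (a := .one) (w := List.replicate n .one)
      (by simp [List.replicate_succ]) ?_ (ih (fun j hj => h j (by omega)) _)).mono
      (s := 1 + T + (n * (T + 1) + 1)) (by linarith)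
    rw [update_contents_reg, Function.update_idem]
    exact h n (Nat.lt_succ_self n) o

theorem emits_forEach {i r : R} (hir : r ≠ i) (hi : c i = 0) {x : ℕ} (hx : c r ≤ x)
    {w : ℕ → List CircuitSym} {T : ℕ}
    (h : ∀ j < c r, p.Emits s (Function.update c i j) (w j) T) :
    (forEach i r p).Emits s c (wordLoop (c r) w) (2 * x + 2 + (x * (T + 1) + 1)) := fun o => by
  have hcopy := runs_copy (S := contents s c o) (aux := scratch) (k := reg r) (d := reg i) (by simp)
    (by simp) (by simpa using hir) rfl
  have hloop := runs_loop_reg (c r) h o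
  have hzero : Function.update c i 0 = c := by rw [← hi, Function.update_eq_self]
  simp only [contents, hi, List.replicate_zero, List.append_nil, List.length_replicate,
    update_contents_reg] at hcopy
  rw [hzero] at hloop
  exact (hcopy.seq hloop).mono (by gcongr)

theorem emits_forEach_emit {i r : R} (hir : r ≠ i) (hi : c i = 0) {x : ℕ} (hx : c r ≤ x)
    (s w : List CircuitSym) :
    (forEach i r (emit out w)).Emits s c (wordLoop (c r) fun _ => w) (4 * x + 3) :=
  (emits_forEach hir hi hx fun _ _ => emits_emit s _ w).congr rfl (by linarith)

/-- Move a number in unary from the input to the register `r`. -/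
def readUnary (r : R) : StackProg (Tape R) CircuitSym := transfer (fun a => a = .one) inp [reg r]

theorem runs_readUnary {r : R} (hr : c r = 0) (j : ℕ) (s o : List CircuitSym) :
    (readUnary r).Runs (contents (unary j ++ s) c o) (contents s (Function.update c r j) o)
      ((unary j ++ s).length + 1) := by
  convert runs_transfer (fun a : CircuitSym => a = .one) (List.nodup_singleton (reg r))
    (k := inp) (by simp) (contents (unary j ++ s) c o) using 1
  · rfl
  · rw [← update_contents_reg]
    funext k
    obtain rfl | hk := eq_or_ne k (reg r)
    · simp [unary, hr]
    · cases k <;> simp_all [unary]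
  · rfl

/-- Empty the stack `k`. -/
def clear (k : Tape R) : StackProg (Tape R) CircuitSym := transfer (fun _ => true) k []

theorem runs_clear (k : Tape R) (S : Stacks (Tape R) CircuitSym) :
    (clear k).Runs S (Function.update S k []) ((S k).length + 1) := by
  convert runs_transfer (fun _ : CircuitSym => true) List.nodup_nil List.not_mem_nil S using 1
  · rfl
  funext x
  obtain rfl | hx := eq_or_ne x k
  · simp [List.dropWhile_eq_nil_iff.mpr]
  · simp [hx]

theorem runs_clear_input (s : List CircuitSym) (c : R → ℕ) (o : List CircuitSym) :
    (clear inp).Runs (contents s c o) (contents [] c o) (s.length + 1) := by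
  convert runs_clear inp (contents s c o) using 1
  · funext k
    cases k <;> simp
  · rfl

theorem runs_clear_reg (r : R) (s : List CircuitSym) (c : R → ℕ) (o : List CircuitSym) :
    (clear (reg r)).Runs (contents s c o) (contents s (Function.update c r 0) o) (c r + 1) := by
  convert runs_clear (reg r) (contents s c o) using 1
  · rw [← update_contents_reg, List.replicate_zero]
  · simp

end StackProg

/-! ### The description of the verifier -/

/-- Gates that introduce a uniformly random classical bit as wire `0`. -/
def keyWord : List CircuitSym :=
  .ancilla :: .hadamard :: unary 0 ++ .ancilla :: .cnot :: unary 1 ++ unary 0 ++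
    .discard :: unary 0

/-- Gates that move wire `j - 1` to the front. -/
def moveWord (j : ℕ) : List CircuitSym :=
  .ancilla :: .cnot :: unary j ++ unary 0 ++ .cnot :: unary 0 ++ unary j ++ .discard :: unary j

/-- Gates that swap wires `a` and `b`, controlled by wire `0`. -/
def cswapWord (a b : ℕ) : List CircuitSym :=
  .cnot :: unary b ++ unary a ++ .toffoli :: unary 0 ++ unary a ++ unary b ++
    .cnot :: unary b ++ unary a

/-- Gates that introduce a qubit in state `(|0⟩ - |1⟩) / √2` as wire `0`. -/
def minusWord : List CircuitSym :=
  .ancilla :: .hadamard :: unary 0 ++ .tGate :: unary 0 ++ .tGate :: unary 0 ++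
    .tGate :: unary 0 ++ .tGate :: unary 0

/-- The gates of the verifier for an encryption circuit with `m` key bits, `n` input qubits, `l`
output qubits and the gates `s`. -/
def verifierWord (m n l : ℕ) (s : List CircuitSym) : List CircuitSym :=
  wordLoop m (fun _ => keyWord) ++ (s ++ (wordLoop n (fun _ => moveWord (l + (n + n))) ++
    (wordLoop m (fun _ => keyWord) ++ (s ++ (minusWord ++
      (wordLoop l (fun i => cswapWord (i + 1) (l + i + 1)) ++
        (wordLoop n (fun i => cswapWord (l + (l + i) + 1) (l + (l + (n + i)) + 1)) ++
          (wordLoop l (fun _ => .discard :: unary 1) ++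
            (wordLoop l (fun _ => .discard :: unary 1) ++
              (wordLoop n (fun _ => .discard :: unary 1) ++
                (wordLoop n (fun _ => .discard :: unary 1) ++ .hadamard :: unary 0)))))))))))

namespace StackProg

open Tape

variable {R : Type} [DecidableEq R] {c : R → ℕ} {x : ℕ}

/-- Write the gates that move a wire to the front, the wire being given by the sum of the values of
the registers `rs`. -/
def emitMove (rs : List R) : StackProg (Tape R) CircuitSym :=
  (emitNumber 0 rs).seq <| (emit out [.discard]).seq <|
    (emitNumber 0 rs).seq <| (emit out (unary 0 ++ .cnot :: unary 0)).seq <|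
    (emitNumber 0 rs).seq <| emit out [.ancilla, .cnot]

theorem emits_emitMove (s : List CircuitSym) (hx : ∀ r, c r ≤ x) (rs : List R) :
    (emitMove rs).Emits s c (moveWord (rs.map c).sum) (3 * rs.length * (2 * x + 2) + 6) := by
  have hj := emits_emitNumber s hx 0 rs
  refine (hj.seq <| (emits_emit s c _).seq <| hj.seq <| (emits_emit s c _).seq <|
    hj.seq <| emits_emit s c _).congr ?_ (by linarith)
  simp [moveWord]

/-- Write the gates of a controlled swap of two wires, each of them being given by one plus the sum
of the values of some registers. -/
def emitCswap (as bs : List R) : StackProg (Tape R) CircuitSym :=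
  (emitNumber 1 as).seq <| (emitNumber 1 bs).seq <| (emit out [.cnot]).seq <|
    (emitNumber 1 bs).seq <| (emitNumber 1 as).seq <| (emit out (.toffoli :: unary 0)).seq <|
    (emitNumber 1 as).seq <| (emitNumber 1 bs).seq <| emit out [.cnot]

theorem emits_emitCswap (s : List CircuitSym) (hx : ∀ r, c r ≤ x) (as bs : List R) :
    (emitCswap as bs).Emits s c (cswapWord ((as.map c).sum + 1) ((bs.map c).sum + 1))
      (3 * (as.length + bs.length) * (2 * x + 2) + 9) := by
  have ha := emits_emitNumber s hx 1 as
  have hb := emits_emitNumber s hx 1 bs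
  refine (ha.seq <| hb.seq <| (emits_emit s c _).seq <| hb.seq <| ha.seq <|
    (emits_emit s c _).seq <| ha.seq <| hb.seq <| emits_emit s c _).congr ?_ (by linarith)
  simp [cswapWord]

theorem emits_forEach_emitCswap {i r : R} (hir : r ≠ i) (hi : c i = 0) (s : List CircuitSym)
    (hx : ∀ r, c r ≤ x) {as bs : List R} (ha : i ∉ as) (hb : i ∉ bs) :
    (forEach i r (emitCswap (i :: as) (i :: bs))).Emits s c
      (wordLoop (c r) fun j => cswapWord ((as.map c).sum + j + 1) ((bs.map c).sum + j + 1))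
      (x * (3 * (as.length + bs.length + 2) * (2 * x + 2) + 12) + 3) := by
  refine (emits_forEach hir hi (hx r) fun j hj => (emits_emitCswap (x := x) s ?_ _ _).congr ?_
    le_rfl).congr rfl ?_
  · intro r'
    obtain rfl | h := eq_or_ne r' i
    · simpa using hj.le.trans (hx r)
    · simpa [h] using hx r'
  · have hsum {rs : List R} (h : i ∉ rs) :
        ((i :: rs).map (Function.update c i j)).sum = (rs.map c).sum + j := by
      rw [List.map_cons, List.sum_cons, Function.update_self, Nat.add_comm,
        List.map_congr_left fun r hr => Function.update_of_ne (ne_of_mem_of_not_mem hr h) j c]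
    rw [hsum ha, hsum hb]
  · simp only [List.length_cons]
    linarith

/-- The registers of the program that writes the verifier: the numbers of key bits, input qubits
and output qubits of the encryption circuit, and a loop counter. -/
inductive Size
  | keys | ins | outs | counter
  deriving DecidableEq

instance : Fintype Size where
  elems := {.keys, .ins, .outs, .counter}
  complete x := by cases x <;> decide

open Size

/-- The values of the registers while the verifier is written. -/
def sizes (m n l : ℕ) : Size → ℕ
  | keys => m
  | ins => n
  | outs => l
  | counter => 0

/-- Write the gates of the verifier, starting with the last one. -/
def emitVerifier : StackProg (Tape Size) CircuitSym :=
  (emit out (.hadamard :: unary 0)).seq <|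
  (forEach counter ins (emit out (.discard :: unary 1))).seq <|
  (forEach counter ins (emit out (.discard :: unary 1))).seq <|
  (forEach counter outs (emit out (.discard :: unary 1))).seq <|
  (forEach counter outs (emit out (.discard :: unary 1))).seq <|
  (forEach counter ins (emitCswap [counter, outs, outs] [counter, outs, outs, ins])).seq <|
  (forEach counter outs (emitCswap [counter] [counter, outs])).seq <|
  (emit out minusWord).seq <| (copy scratch inp out).seq <|
  (forEach counter keys (emit out keyWord)).seq <|
  (forEach counter ins (emitMove [outs, ins, ins])).seq <| (copy scratch inp out).seq <|
  forEach counter keys (emit out keyWord)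

theorem emits_forEach_emitMove {m n l : ℕ} (hx : ∀ r, sizes m n l r ≤ x) (s : List CircuitSym) :
    (forEach counter ins (emitMove [outs, ins, ins])).Emits s (sizes m n l)
      (wordLoop n fun _ => moveWord (l + (n + n))) (18 * x ^ 2 + 27 * x + 3) := by
  refine (emits_forEach (i := counter) (by simp) rfl (hx ins) fun j hj =>
    (emits_emitMove (x := x) s ?_ _).congr rfl le_rfl).congr (by simp [sizes]) ?_
  · rintro (_ | _ | _ | _)
    · exact hx keys
    · exact hx ins
    · exact hx outs
    · exact hj.le.trans (hx ins)
  · simp only [List.length_cons, List.length_nil]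
    linarith

theorem emits_emitVerifier {m n l : ℕ} {s : List CircuitSym} (hx : ∀ r, sizes m n l r ≤ x)
    (hs : s.length ≤ x) :
    emitVerifier.Emits s (sizes m n l) (verifierWord m n l s) (200 * x ^ 2 + 200 * x + 200) := by
  have hrepeat (r : Size) (hr : r ≠ counter) (w : List CircuitSym) :=
    emits_forEach_emit hr (c := sizes m n l) rfl (hx r) s w
  have hdiscardIns := hrepeat ins (by simp) (.discard :: unary 1)
  have hdiscardOuts := hrepeat outs (by simp) (.discard :: unary 1)
  have hkeys := hrepeat keys (by simp) keyWord
  have hinp := (emits_copy_input s (sizes m n l)).congr rfl (t' := 2 * x + 2) (by gcongr)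
  have hmove := emits_forEach_emitMove hx s
  have hswapIns := emits_forEach_emitCswap (i := counter) (r := ins) (as := [outs, outs])
    (bs := [outs, outs, ins]) (by simp) rfl s hx (by simp) (by simp)
  have hswapOuts := emits_forEach_emitCswap (i := counter) (r := outs) (as := [])
    (bs := [outs]) (by simp) rfl s hx (by simp) (by simp)
  refine ((emits_emit s _ (.hadamard :: unary 0)).seq <| hdiscardIns.seq <| hdiscardIns.seq <|
    hdiscardOuts.seq <| hdiscardOuts.seq <| hswapIns.seq <| hswapOuts.seq <|
    (emits_emit s _ minusWord).seq <| hinp.seq <| hkeys.seq <| hmove.seq <|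
    hinp.seq hkeys).congr ?_ ?_
  · simp [verifierWord, sizes, add_assoc]
  · simp only [List.length_cons, List.length_nil]
    nlinarith

/-- Read the numbers of key bits, input qubits and output qubits. -/
def readSizes : StackProg (Tape Size) CircuitSym :=
  (readUnary keys).seq <| (readUnary ins).seq <| readUnary outs

theorem runs_readSizes {m n l : ℕ} {s : List CircuitSym}
    (hx : (unary m ++ (unary n ++ (unary l ++ s))).length ≤ x) (o : List CircuitSym) :
    readSizes.Runs (contents (unary m ++ (unary n ++ (unary l ++ s))) 0 o)
      (contents s (sizes m n l) o) (3 * x + 3) := by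
  have hsizes : Function.update (Function.update (Function.update (0 : Size → ℕ) keys m) ins n)
      outs l = sizes m n l := by
    funext r
    cases r <;> simp [sizes]
  simp only [List.length_append] at hx
  rw [← hsizes]
  refine ((runs_readUnary (by simp) m _ o).seq <| (runs_readUnary (by simp) n _ o).seq <|
    runs_readUnary (by simp) l s o).mono ?_
  simp only [List.length_append]
  linarith

/-- Empty all stacks but the output. -/
def clearAll : StackProg (Tape Size) CircuitSym :=
  (clear inp).seq <| (clear (reg keys)).seq <| (clear (reg ins)).seq <| clear (reg outs)

theorem runs_clearAll {m n l : ℕ} {s : List CircuitSym} (hx : ∀ r, sizes m n l r ≤ x)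
    (hs : s.length ≤ x) (o : List CircuitSym) :
    clearAll.Runs (contents s (sizes m n l) o) (contents [] 0 o) (4 * x + 4) := by
  have hzero : Function.update (Function.update (Function.update (sizes m n l) keys 0) ins 0)
      outs 0 = 0 := by
    funext r
    cases r <;> simp [sizes]
  rw [← hzero]
  refine ((runs_clear_input s _ o).seq <| (runs_clear_reg keys _ _ o).seq <|
    (runs_clear_reg ins _ _ o).seq <| runs_clear_reg outs _ _ o).mono ?_
  have := hx keys
  have := hx ins
  have := hx outs
  simp only [sizes, ne_eq, reduceCtorEq, not_false_eq_true, Function.update_of_ne] at *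
  linarith

/-- Read a description of an encryption circuit and write the description of the verifier. -/
def writeVerifier : StackProg (Tape Size) CircuitSym :=
  readSizes.seq <| emitVerifier.seq <| (emitNumber 0 [ins, ins, ins, ins]).seq clearAll

theorem runs_writeVerifier (m n l : ℕ) (s : List CircuitSym) {x : ℕ}
    (hx : (unary m ++ (unary n ++ (unary l ++ s))).length = x) :
    writeVerifier.Runs (contents (unary m ++ (unary n ++ (unary l ++ s))) 0 [])
      (contents [] 0 (unary ((n + n) + (n + n)) ++ verifierWord m n l s))
      (200 * x ^ 2 + 220 * x + 300) := by
  have hlen : m + n + l + s.length ≤ x := by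
    simp only [unary, List.length_append, List.length_replicate] at hx
    omega
  have hsizes (r : Size) : sizes m n l r ≤ x := by
    cases r <;> simp only [sizes] <;> omega
  have hs : s.length ≤ x := by omega
  have hwires : (List.map (sizes m n l) [ins, ins, ins, ins]).sum + 0 = (n + n) + (n + n) := by
    simp [sizes, add_assoc]
  have hnumber := emits_emitNumber s hsizes 0 [ins, ins, ins, ins]
  rw [hwires] at hnumber
  have hemit := emits_emitVerifier hsizes hs []
  rw [List.append_nil] at hemit
  refine ((runs_readSizes hx.le []).seq <| hemit.seq <| (hnumber _).seq
    (runs_clearAll hsizes hs _)).mono ?_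
  simp only [List.length_cons, List.length_nil]
  linarith

end StackProg

theorem computableInPolyTime_of_symbols_eq
    (V : (E : EncryptionCircuit) → QCircuit ((E.n + E.n) + (E.n + E.n)) 1)
    (hV : ∀ E, (V E).symbols = verifierWord E.m E.n E.l E.circuit.symbols) :
    Nonempty (Turing.TM2ComputableInPolyTime EncryptionCircuit.encode VerifierCircuit.encode
      fun E => ⟨_, V E⟩) := by
  refine StackProg.writeVerifier.computableInPolyTime .inp .out
    (200 * Polynomial.X ^ 2 + 220 * Polynomial.X + 300) fun E => ?_
  rw [← StackProg.contents_zero_output, ← StackProg.contents_zero_input]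
  have h := StackProg.runs_writeVerifier E.m E.n E.l E.circuit.symbols rfl
  simpa [VerifierCircuit.encode, hV E, EncryptionCircuit.encode] using h

/-! ### Matrix entries of the channels of gates -/

theorem conjMap_apply_of_involutive {A : Type} [Fintype A] [DecidableEq A] {f : A → A}
    (hf : Function.Involutive f) {U : Op A} (hU : ∀ x y, U x y = if x = f y then 1 else 0)
    (ρ : Op A) (x y : A) : conjMap U ρ x y = ρ (f x) (f y) := by
  have hU' (a b : A) : U a b = if b = f a then 1 else 0 := by
    simp only [hU, hf.eq_iff.symm.trans eq_comm, eq_comm (a := a)]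
  simp only [conjMap, LinearMap.comp_apply, LinearMap.mulLeft_apply, LinearMap.mulRight_apply,
    Matrix.mul_apply, Matrix.conjTranspose_apply, hU', apply_ite star, star_one, star_zero,
    mul_ite, mul_one, mul_zero, Finset.sum_ite_eq', Finset.mem_univ, if_true, ite_mul, one_mul,
    zero_mul]

theorem involutive_cnot {N : ℕ} {i j : Fin N} (hij : i ≠ j) :
    Function.Involutive fun y : Qubits N => Function.update y j (xor (y j) (y i)) :=
  fun y => by simp [hij]

theorem involutive_toffoli {N : ℕ} {i j k : Fin N} (hik : i ≠ k) (hjk : j ≠ k) :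
    Function.Involutive fun y : Qubits N => Function.update y k (xor (y k) (y i && y j)) :=
  fun y => by simp [hik, hjk]

theorem cnot_channel_apply {N : ℕ} {i j : Fin N} (hij : i ≠ j) (ρ : Op (Qubits N))
    (x y : Qubits N) : (QGate.cnot i j hij).channel ρ x y =
      ρ (Function.update x j (xor (x j) (x i))) (Function.update y j (xor (y j) (y i))) :=
  conjMap_apply_of_involutive (involutive_cnot hij) (fun _ _ => rfl) ρ x y

theorem toffoli_channel_apply {N : ℕ} {i j k : Fin N} (hij : i ≠ j) (hik : i ≠ k) (hjk : j ≠ k)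
    (ρ : Op (Qubits N)) (x y : Qubits N) : (QGate.toffoli i j k hij hik hjk).channel ρ x y =
      ρ (Function.update x k (xor (x k) (x i && x j)))
        (Function.update y k (xor (y k) (y i && y j))) :=
  conjMap_apply_of_involutive (involutive_toffoli hik hjk) (fun _ _ => rfl) ρ x y

theorem tGate_channel_apply {N : ℕ} (i : Fin N) (ρ : Op (Qubits N)) (x y : Qubits N) :
    (QGate.tGate i).channel ρ x y =
      (if x i = true then Complex.exp (Complex.I * (Real.pi / 4 : ℝ)) else 1) * ρ x y *
        star (if y i = true then Complex.exp (Complex.I * (Real.pi / 4 : ℝ)) else 1) := by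
  simp only [QGate.channel, conjMap, LinearMap.comp_apply, LinearMap.mulLeft_apply,
    LinearMap.mulRight_apply, tOp, Matrix.diagonal_conjTranspose, Matrix.diagonal_mul,
    Matrix.mul_diagonal, mul_assoc]
  rfl

/-- The sign `(-1)^(ab)` of the entry `⟨a|H|b⟩` of the Hadamard matrix. -/
def hadamardSign (a b : Bool) : ℂ := if a = true ∧ b = true then -1 else 1

theorem sum_ite_eq_off {ι α M : Type*} [Fintype ι] [DecidableEq ι] [Fintype α] [DecidableEq α]
    [AddCommMonoid M] (i : ι) (x : ι → α) (f : (ι → α) → M) :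
    (∑ y, if ∀ j, j ≠ i → x j = y j then f y else 0) = ∑ a, f (Function.update x i a) := by
  rw [← Finset.sum_filter]
  refine (Finset.sum_bij (fun a _ => Function.update x i a) ?_ ?_ ?_ fun _ _ => rfl).symm
  · exact fun a _ => Finset.mem_filter.2
      ⟨Finset.mem_univ _, fun j hj => (Function.update_of_ne hj a x).symm⟩
  · exact fun a _ b _ h => Function.update_injective x i h
  · refine fun y hy => ⟨y i, Finset.mem_univ _, ?_⟩
    exact Function.update_eq_iff.2 ⟨rfl, (Finset.mem_filter.1 hy).2⟩

theorem sum_hadamardOp_mul {N : ℕ} (i : Fin N) (x : Qubits N) (f : Qubits N → ℂ) :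
    ∑ z, hadamardOp i x z * f z =
      ((Real.sqrt 2 : ℝ) : ℂ)⁻¹ * ∑ a, hadamardSign (x i) a * f (Function.update x i a) := by
  have hsum := sum_ite_eq_off i x fun z =>
    ((Real.sqrt 2 : ℝ) : ℂ)⁻¹ * hadamardSign (x i) (z i) * f z
  simp only [Function.update_self, mul_assoc, ← Finset.mul_sum] at hsum
  rw [← hsum]
  refine Finset.sum_congr rfl fun z _ => ?_
  simp only [hadamardOp, hadamardSign, ite_mul, zero_mul, mul_assoc]

theorem star_hadamardOp {N : ℕ} (i : Fin N) (x y : Qubits N) :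
    star (hadamardOp i x y) = hadamardOp i x y := by
  simp only [hadamardOp]
  split_ifs <;> simp [Complex.conj_ofReal]

theorem hadamard_channel_apply {N : ℕ} (i : Fin N) (ρ : Op (Qubits N)) (x y : Qubits N) :
    (QGate.hadamard i).channel ρ x y = 2⁻¹ * ∑ a, ∑ b, hadamardSign (x i) a *
      hadamardSign (y i) b * ρ (Function.update x i a) (Function.update y i b) := by
  have hsqrt : ((Real.sqrt 2 : ℝ) : ℂ)⁻¹ * ((Real.sqrt 2 : ℝ) : ℂ)⁻¹ = 2⁻¹ := by
    rw [← mul_inv, ← Complex.ofReal_mul, Real.mul_self_sqrt zero_le_two, Complex.ofReal_ofNat]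
  simp only [QGate.channel, conjMap, LinearMap.comp_apply, LinearMap.mulLeft_apply,
    LinearMap.mulRight_apply, Matrix.mul_apply, Matrix.conjTranspose_apply, star_hadamardOp,
    mul_comm (ρ _ _), sum_hadamardOp_mul]
  rw [← hsqrt, mul_assoc]
  congr 1
  simp only [Finset.mul_sum]
  exact Finset.sum_congr rfl fun a _ => Finset.sum_congr rfl fun b _ => by ring
/-! ### Circuits in wire coordinates -/

/-- The values on the first `N` wires. All wires are indexed by `ℕ`, which spares the casts between
registers whose sizes are equal but not definitionally so. -/
def takeWires (N : ℕ) (x : ℕ → Bool) : Qubits N := fun i => x i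

/-- Matrix entries, as a function of the values on all wires. -/
abbrev WireKernel : Type := (ℕ → Bool) → (ℕ → Bool) → ℂ

/-- The matrix entries of an operator, as a function of the values on all wires. -/
def kernel {N : ℕ} (ρ : Op (Qubits N)) : WireKernel := fun x y => ρ (takeWires N x) (takeWires N y)

/-- The values on all wires, given a register and the values on the remaining wires. -/
def appendWires {n : ℕ} (u : Qubits n) (x : ℕ → Bool) : ℕ → Bool := fun i =>
  if h : i < n then u ⟨i, h⟩ else x (i - n)

/-- The values on the wires from wire `n` on. -/
def dropWires (n : ℕ) (x : ℕ → Bool) : ℕ → Bool := fun i => x (i + n)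

/-- The values on all wires after the insertion of the value `b` as wire `i`. -/
def insertWire (i : ℕ) (b : Bool) (x : ℕ → Bool) : ℕ → Bool := fun j =>
  if j < i then x j else if j = i then b else x (j - 1)

theorem takeWires_appendWires {n : ℕ} (u : Qubits n) (x : ℕ → Bool) :
    takeWires n (appendWires u x) = u := by
  funext i
  simp [takeWires, appendWires]

theorem dropWires_appendWires {n : ℕ} (u : Qubits n) (x : ℕ → Bool) :
    dropWires n (appendWires u x) = x := by
  funext i
  simp [dropWires, appendWires]

theorem appendWires_takeWires_dropWires (n : ℕ) (x : ℕ → Bool) :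
    appendWires (takeWires n x) (dropWires n x) = x := by
  funext i
  by_cases h : i < n
  · simp [appendWires, takeWires, h]
  · simp [appendWires, dropWires, h, Nat.sub_add_cancel (not_lt.1 h)]

theorem takeWires_update {N i : ℕ} (hi : i < N) (x : ℕ → Bool) (b : Bool) :
    takeWires N (Function.update x i b) = Function.update (takeWires N x) ⟨i, hi⟩ b := by
  funext j
  by_cases h : j = ⟨i, hi⟩
  · subst h; simp [takeWires]
  · have : (j : ℕ) ≠ i := fun e => h (Fin.ext e)
    simp [takeWires, h, this]

theorem takeWires_insertWire {N : ℕ} (i : Fin (N + 1)) (x : ℕ → Bool) (b : Bool) :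
    takeWires (N + 1) (insertWire i b x) =
      Fin.insertNth (α := fun _ => Bool) i b (takeWires N x) := by
  funext j
  refine Fin.succAboveCases i ?_ (fun k => ?_) j
  · simp [takeWires, insertWire]
  · simp only [Fin.insertNth_apply_succAbove, takeWires, insertWire]
    rcases lt_or_ge k.castSucc i with h | h
    · have h' : (k : ℕ) < i := h
      simp [Fin.succAbove_of_castSucc_lt _ _ h, h']
    · have h' : (i : ℕ) ≤ k := h
      rw [Fin.succAbove_of_le_castSucc _ _ h]
      simp [show ¬ ((k : ℕ) + 1 < i) by omega, show (k : ℕ) + 1 ≠ i by omega]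

/-- Some circuit with `N` input and `N'` output wires has the description `w` and acts on matrix
entries by `G`. -/
def Realizes (N N' : ℕ) (w : List CircuitSym) (G : WireKernel → WireKernel) : Prop :=
  ∃ c : QCircuit N N', c.symbols = w ∧ ∀ ρ x y, kernel (c.channel ρ) x y = G (kernel ρ) x y

/-- Sequential composition. -/
def QCircuit.append {n k m : ℕ} : QCircuit n k → QCircuit k m → QCircuit n m
  | .nil, d => d
  | .cons g c, d => .cons g (c.append d)

theorem QCircuit.symbols_append {n k m : ℕ} (c : QCircuit n k) (d : QCircuit k m) :
    (c.append d).symbols = c.symbols ++ d.symbols := by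
  induction c with
  | nil => rfl
  | cons g c ih => simp [append, symbols, ih]

theorem QCircuit.channel_append {n k m : ℕ} (c : QCircuit n k) (d : QCircuit k m)
    (ρ : Op (Qubits n)) : (c.append d).channel ρ = d.channel (c.channel ρ) := by
  induction c with
  | nil => rfl
  | cons g c ih => simp [append, channel, ih]

theorem Realizes.nil (N : ℕ) : Realizes N N [] id := ⟨.nil, rfl, fun _ _ _ => rfl⟩

theorem Realizes.trans {N N' N'' : ℕ} {w w' : List CircuitSym} {G G' : WireKernel → WireKernel}
    (h : Realizes N N' w G) (h' : Realizes N' N'' w' G') :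
    Realizes N N'' (w ++ w') fun k => G' (G k) := by
  obtain ⟨c, hc, hG⟩ := h
  obtain ⟨d, hd, hG'⟩ := h'
  refine ⟨c.append d, by rw [QCircuit.symbols_append, hc, hd], fun ρ x y => ?_⟩
  rw [QCircuit.channel_append, hG']
  exact congrArg (fun k => G' k x y) (funext fun x => funext fun y => hG ρ x y)

theorem Realizes.congr {N N' : ℕ} {w w' : List CircuitSym} {G G' : WireKernel → WireKernel}
    (h : Realizes N N' w G) (hw : w = w') (hG : ∀ k x y, G k x y = G' k x y) :
    Realizes N N' w' G' := by
  obtain ⟨c, hc, h⟩ := h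
  exact ⟨c, hc.trans hw, fun ρ x y => (h ρ x y).trans (hG _ x y)⟩

theorem Realizes.gate {N N' : ℕ} (g : QGate N N') {w : List CircuitSym} {G : WireKernel →
    WireKernel}
    (hw : g.symbols = w) (h : ∀ ρ x y, kernel (g.channel ρ) x y = G (kernel ρ) x y) :
    Realizes N N' w G :=
  ⟨.cons g .nil, by simp [QCircuit.symbols, hw], h⟩

/-- The action of a Hadamard gate. -/
def WireKernel.hadamard (i : ℕ) (k : WireKernel) : WireKernel := fun x y => 2⁻¹ * ∑ a, ∑ b,
  hadamardSign (x i) a * hadamardSign (y i) b * k (Function.update x i a) (Function.update y i b)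

/-- The action of a `T` gate. -/
def WireKernel.tGate (i : ℕ) (k : WireKernel) : WireKernel := fun x y =>
  (if x i = true then Complex.exp (Complex.I * (Real.pi / 4 : ℝ)) else 1) * k x y *
    star (if y i = true then Complex.exp (Complex.I * (Real.pi / 4 : ℝ)) else 1)

/-- The action of a change of variables. -/
def WireKernel.comap (f : (ℕ → Bool) → ℕ → Bool) (k : WireKernel) :
    WireKernel := fun x y => k (f x) (f y)

/-- The change of variables of a controlled-not gate. -/
def cnotBits (i j : ℕ) (x : ℕ → Bool) : ℕ → Bool := Function.update x j (xor (x j) (x i))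

/-- The change of variables of a Toffoli gate. -/
def toffoliBits (i j k : ℕ) (x : ℕ → Bool) : ℕ → Bool :=
  Function.update x k (xor (x k) (x i && x j))

/-- The action of the introduction of an ancilla. -/
def WireKernel.ancilla (k : WireKernel) : WireKernel := fun x y =>
  if x 0 = false ∧ y 0 = false then k (dropWires 1 x) (dropWires 1 y) else 0

/-- The action of tracing out a wire. -/
def WireKernel.discard (i : ℕ) (k : WireKernel) : WireKernel := fun x y =>
  ∑ b, k (insertWire i b x) (insertWire i b y)

theorem realizes_hadamard {N i : ℕ} (hi : i < N) :
    Realizes N N (.hadamard :: unary i) (WireKernel.hadamard i) :=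
  Realizes.gate (QGate.hadamard ⟨i, hi⟩) (by simp [QGate.symbols]) fun ρ x y => by
    simp only [kernel, hadamard_channel_apply, WireKernel.hadamard, takeWires_update hi]
    rfl

theorem realizes_tGate {N i : ℕ} (hi : i < N) :
    Realizes N N (.tGate :: unary i) (WireKernel.tGate i) :=
  Realizes.gate (QGate.tGate ⟨i, hi⟩) (by simp [QGate.symbols]) fun ρ x y => by
    simp only [kernel, tGate_channel_apply, WireKernel.tGate]
    rfl

theorem realizes_cnot {N i j : ℕ} (hi : i < N) (hj : j < N) (hij : i ≠ j) :
    Realizes N N (.cnot :: unary i ++ unary j) (WireKernel.comap (cnotBits i j)) :=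
  Realizes.gate (QGate.cnot ⟨i, hi⟩ ⟨j, hj⟩ (by simpa using hij)) (by simp [QGate.symbols])
      fun ρ x y => by
    simp only [kernel, cnot_channel_apply, WireKernel.comap, cnotBits, takeWires_update hj]
    rfl

theorem realizes_toffoli {N i j k : ℕ} (hi : i < N) (hj : j < N) (hk : k < N) (hij : i ≠ j)
    (hik : i ≠ k) (hjk : j ≠ k) :
    Realizes N N (.toffoli :: unary i ++ unary j ++ unary k)
      (WireKernel.comap (toffoliBits i j k)) :=
  Realizes.gate (QGate.toffoli ⟨i, hi⟩ ⟨j, hj⟩ ⟨k, hk⟩ (by simpa using hij) (by simpa using hik)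
    (by simpa using hjk)) (by simp [QGate.symbols]) fun ρ x y => by
    simp only [kernel, toffoli_channel_apply, WireKernel.comap, toffoliBits, takeWires_update hk]
    rfl

theorem realizes_ancilla (N : ℕ) : Realizes N (N + 1) [.ancilla] WireKernel.ancilla :=
  Realizes.gate QGate.ancilla rfl fun ρ x y => by
    simp only [kernel, QGate.channel, WireKernel.ancilla, ancillaMap]
    rfl

theorem realizes_discard {N i : ℕ} (hi : i < N + 1) :
    Realizes (N + 1) N (.discard :: unary i) (WireKernel.discard i) :=
  Realizes.gate (QGate.discard ⟨i, hi⟩) (by simp [QGate.symbols]) fun ρ x y => by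
    have h := fun b x => takeWires_insertWire (N := N) ⟨i, hi⟩ x b
    simp only at h
    simp only [kernel, WireKernel.discard, h]
    rfl

theorem dropWires_update_zero (x : ℕ → Bool) (b : Bool) :
    dropWires 1 (Function.update x 0 b) = dropWires 1 x := by
  funext i
  simp [dropWires]

theorem dropWires_insertWire_zero (x : ℕ → Bool) (b : Bool) :
    dropWires 1 (insertWire 0 b x) = x := by
  funext i
  simp [dropWires, insertWire]

theorem WireKernel.hadamard_ancilla (k : WireKernel) (x y : ℕ → Bool) :
    WireKernel.hadamard 0 (WireKernel.ancilla k) x y = 2⁻¹ * k (dropWires 1 x) (dropWires 1 y) := by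
  simp [WireKernel.hadamard, WireKernel.ancilla, dropWires_update_zero, hadamardSign]

theorem dropWires_one_cnotBits_insertWire (x : ℕ → Bool) (b : Bool) :
    dropWires 1 (cnotBits 1 0 (insertWire 0 b x)) = x := by
  rw [cnotBits, dropWires_update_zero, dropWires_insertWire_zero]

theorem cnotBits_insertWire_zero (x : ℕ → Bool) (b : Bool) :
    cnotBits 1 0 (insertWire 0 b x) 0 = xor b (x 0) := by
  simp [cnotBits, insertWire]

theorem realizes_keyWord (N : ℕ) : Realizes N (N + 1) keyWord fun k x y =>
    if x 0 = y 0 then 2⁻¹ * k (dropWires 1 x) (dropWires 1 y) else 0 := by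
  refine (((((realizes_ancilla N).trans (realizes_hadamard (i := 0) (by omega))).trans
    (realizes_ancilla (N + 1))).trans (realizes_cnot (i := 1) (j := 0) (by omega) (by omega)
    (by simp))).trans (realizes_discard (i := 0) (by omega))).congr (by simp [keyWord])
    fun k x y => ?_
  simp only [WireKernel.discard, WireKernel.comap,
    WireKernel.ancilla.eq_def (WireKernel.hadamard 0 _), dropWires_one_cnotBits_insertWire,
    cnotBits_insertWire_zero, WireKernel.hadamard_ancilla]
  cases x 0 <;> cases y 0 <;> simp

theorem dropWires_dropWires_one (m : ℕ) (x : ℕ → Bool) :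
    dropWires m (dropWires 1 x) = dropWires (m + 1) x := by
  funext i
  simp [dropWires, add_assoc]

theorem takeWires_succ (m : ℕ) (x : ℕ → Bool) :
    takeWires (m + 1) x = Fin.cons (x 0) (takeWires m (dropWires 1 x)) := by
  funext i
  refine Fin.cases rfl (fun i => ?_) i
  simp [takeWires, dropWires]

theorem realizes_keys (N m : ℕ) : Realizes N (N + m) (wordLoop m fun _ => keyWord) fun k x y =>
    if takeWires m x = takeWires m y then (2 ^ m)⁻¹ * k (dropWires m x) (dropWires m y) else 0 := by
  induction m with
  | zero =>
    refine (Realizes.nil N).congr rfl fun k x y => ?_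
    rw [if_pos (Subsingleton.elim _ _), pow_zero, inv_one, one_mul]
    rfl
  | succ m ih =>
    refine (ih.trans (realizes_keyWord (N + m))).congr (wordLoop_succ m _).symm fun k x y => ?_
    simp only [dropWires_dropWires_one, takeWires_succ, Fin.cons_inj, pow_succ, mul_inv]
    split_ifs <;> first | tauto | ring

/-- The action on matrix entries of a channel that is applied to the first `n` wires and replaces
them by `m` wires. -/
def WireKernel.extend {n m : ℕ} (Φ : Op (Qubits n) →ₗ[ℂ] Op (Qubits m)) (k : WireKernel) :
    WireKernel :=
  fun x y => Φ (Matrix.of fun u v => k (appendWires u (dropWires m x))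
    (appendWires v (dropWires m y)))
    (takeWires m x) (takeWires m y)

theorem appendWires_update {n : ℕ} (u : Qubits n) (x : ℕ → Bool) (i : Fin n) (b : Bool) :
    appendWires (Function.update u i b) x = Function.update (appendWires u x) i b := by
  funext j
  by_cases h : j < n
  · by_cases h' : j = i
    · subst h'; simp [appendWires]
    · have : (⟨j, h⟩ : Fin n) ≠ i := fun e => h' (congrArg Fin.val e)
      simp [appendWires, h, h', this]
  · have : j ≠ i := fun e => h (e ▸ i.2)
    simp [appendWires, h, this]

theorem appendWires_update_takeWires (n : ℕ) (x : ℕ → Bool) (i : Fin n) (b : Bool) :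
    appendWires (Function.update (takeWires n x) i b) (dropWires n x) = Function.update x i b := by
  rw [appendWires_update, appendWires_takeWires_dropWires]

theorem appendWires_insertNth {n : ℕ} (x : ℕ → Bool) (i : Fin (n + 1)) (b : Bool) :
    appendWires (Fin.insertNth (α := fun _ => Bool) i b (takeWires n x)) (dropWires n x) =
      insertWire i b x := by
  rw [← takeWires_insertWire]
  have hdrop : dropWires n x = dropWires (n + 1) (insertWire i b x) := by
    funext j
    have := i.2
    simp [dropWires, insertWire, show ¬ (j + (n + 1) < i) by omega,
      show j + (n + 1) ≠ i by omega, show j + (n + 1) - 1 = j + n by omega]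
  rw [hdrop, appendWires_takeWires_dropWires]

theorem appendWires_tail {n : ℕ} (x : ℕ → Bool) :
    appendWires (Fin.tail (takeWires (n + 1) x)) (dropWires (n + 1) x) = dropWires 1 x := by
  rw [takeWires_succ n, Fin.tail_cons, ← dropWires_dropWires_one n,
    appendWires_takeWires_dropWires]

theorem realizes_extend_gate (r : ℕ) {n m : ℕ} (g : QGate n m) :
    Realizes (r + n) (r + m) g.symbols (WireKernel.extend g.channel) := by
  cases g with
  | hadamard i =>
    refine (realizes_hadamard (i := i) (by omega)).congr rfl fun k x y => ?_
    simp only [WireKernel.extend, hadamard_channel_apply, Matrix.of_apply,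
      appendWires_update_takeWires, WireKernel.hadamard]
    rfl
  | tGate i =>
    refine (realizes_tGate (i := i) (by omega)).congr rfl fun k x y => ?_
    simp only [WireKernel.extend, tGate_channel_apply, Matrix.of_apply,
      appendWires_takeWires_dropWires, WireKernel.tGate]
    rfl
  | cnot i j hij =>
    refine (realizes_cnot (i := i) (j := j) (by omega) (by omega) (Fin.val_ne_of_ne hij)).congr
      rfl fun k x y => ?_
    simp only [WireKernel.extend, cnot_channel_apply, Matrix.of_apply, appendWires_update_takeWires,
      WireKernel.comap, cnotBits]
    rfl
  | toffoli i j l hij hil hjl =>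
    refine (realizes_toffoli (i := i) (j := j) (k := l) (by omega) (by omega) (by omega)
      (Fin.val_ne_of_ne hij) (Fin.val_ne_of_ne hil) (Fin.val_ne_of_ne hjl)).congr
      (by simp [QGate.symbols]) fun k x y => ?_
    simp only [WireKernel.extend, toffoli_channel_apply, Matrix.of_apply,
      appendWires_update_takeWires, WireKernel.comap, toffoliBits]
    rfl
  | ancilla =>
    refine (realizes_ancilla (r + n)).congr rfl fun k x y => ?_
    simp only [WireKernel.extend, WireKernel.ancilla, QGate.channel, ancillaMap, LinearMap.coe_mk,
      AddHom.coe_mk, Matrix.of_apply, appendWires_tail]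
    rfl
  | discard i =>
    refine (realizes_discard (N := r + m) (i := i) (by omega)).congr rfl fun k x y => ?_
    simp only [WireKernel.extend, WireKernel.discard, QGate.channel, discardMap, LinearMap.coe_mk,
      AddHom.coe_mk, Matrix.of_apply, appendWires_insertNth]

theorem realizes_extend (r : ℕ) {n m : ℕ} (c : QCircuit n m) :
    Realizes (r + n) (r + m) c.symbols (WireKernel.extend c.channel) := by
  induction c with
  | nil =>
    refine (Realizes.nil _).congr rfl fun k x y => ?_
    simp [WireKernel.extend, QCircuit.channel, appendWires_takeWires_dropWires]
  | cons g c ih =>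
    refine ((realizes_extend_gate r g).trans ih).congr rfl fun k x y => ?_
    simp only [WireKernel.extend, dropWires_appendWires, takeWires_appendWires, QCircuit.channel,
      LinearMap.comp_apply]
    rfl

theorem dropWires_appendWires_add {m n : ℕ} (u : Qubits (m + n)) (x : ℕ → Bool) :
    dropWires m (appendWires u x) = appendWires (fun i => u (Fin.natAdd m i)) x := by
  funext j
  by_cases h : j < n
  · have : (⟨j + m, by omega⟩ : Fin (m + n)) = Fin.natAdd m ⟨j, h⟩ := by
      ext; simp [add_comm]
    simp [dropWires, appendWires, h, show j + m < m + n by omega, this]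
  · simp [dropWires, appendWires, h, show ¬ j + m < m + n by omega,
    show j + m - (m + n) = j - n by omega]

theorem takeWires_appendWires_add {m n : ℕ} (u : Qubits (m + n)) (x : ℕ → Bool) :
    takeWires m (appendWires u x) = fun i => u (Fin.castAdd n i) := by
  funext i
  simp [takeWires, appendWires, show (i : ℕ) < m + n by omega]
  rfl

theorem realizes_average (E : EncryptionCircuit) (r : ℕ) :
    Realizes (r + E.n) (r + E.l) (wordLoop E.m (fun _ => keyWord) ++ E.circuit.symbols)
      (WireKernel.extend E.average) := by
  have h := realizes_keys (r + E.n) E.m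
  rw [show r + E.n + E.m = r + (E.m + E.n) by ring] at h
  refine (h.trans (realizes_extend r E.circuit)).congr rfl fun k x y => ?_
  simp only [WireKernel.extend, EncryptionCircuit.average, LinearMap.smul_apply,
    LinearMap.sum_apply, EncryptionCircuit.chan, QCircuit.keyed, LinearMap.comp_apply]
  rw [← map_sum, ← map_smul]
  refine congrFun (congrFun (congrArg E.circuit.channel ?_) _) _
  ext u v
  simp only [Matrix.of_apply, takeWires_appendWires_add, dropWires_appendWires_add,
    Matrix.smul_apply, Matrix.sum_apply, attachKey, LinearMap.coe_mk, AddHom.coe_mk, smul_eq_mul]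
  by_cases h : (fun i => u (Fin.castAdd E.n i)) = fun i => v (Fin.castAdd E.n i)
  · simp only [h, and_self, if_true, Finset.sum_ite_eq, Finset.mem_univ]
  · rw [if_neg h, Finset.sum_eq_zero, mul_zero]
    exact fun κ _ => if_neg fun hκ => h (hκ.1.trans hκ.2.symm)

/-- The change of variables of moving wire `j - 1` to the front. -/
def moveBits (j : ℕ) (x : ℕ → Bool) : ℕ → Bool := fun i =>
  if i + 1 = j then x 0 else if i + 1 < j then x (i + 1) else x i

theorem realizes_moveWord {N j : ℕ} (hj : 0 < j) (hjN : j ≤ N) :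
    Realizes N N (moveWord j) (WireKernel.comap (moveBits j)) := by
  refine ((((realizes_ancilla N).trans (realizes_cnot (i := j) (j := 0) (by omega) (by omega)
    (by omega))).trans (realizes_cnot (i := 0) (j := j) (by omega) (by omega)
    (by omega))).trans (realizes_discard (i := j) (by omega))).congr
    (by simp [moveWord]) fun k x y => ?_
  have hzero (b : Bool) (x : ℕ → Bool) :
      cnotBits j 0 (cnotBits 0 j (insertWire j b x)) 0 = b := by
    simp only [cnotBits, insertWire, hj, hj.ne, ne_eq, not_false_eq_true, Function.update_self,
      Function.update_of_ne, if_true, if_false, lt_irrefl]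
    cases b <;> cases x 0 <;> rfl
  have hdrop (x : ℕ → Bool) :
      dropWires 1 (cnotBits j 0 (cnotBits 0 j (insertWire j false x))) = moveBits j x := by
    rw [cnotBits, dropWires_update_zero]
    funext i
    rcases lt_trichotomy (i + 1) j with h | rfl | h
    · simp [dropWires, cnotBits, insertWire, moveBits, h, h.ne]
    · simp [dropWires, cnotBits, insertWire, moveBits]
    · simp [dropWires, cnotBits, insertWire, moveBits, h.ne', h.not_gt]
  simp [WireKernel.discard, WireKernel.comap, WireKernel.ancilla, hzero, hdrop]

theorem realizes_wordLoop_moveWord {N j : ℕ} (c : ℕ) (hc : c ≤ j) (hjN : j ≤ N) :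
    Realizes N N (wordLoop c fun _ => moveWord j) (WireKernel.comap fun x i =>
      if c + i < j then x (c + i) else if i < j then x (c + i - j) else x i) := by
  induction c with
  | zero =>
    refine (Realizes.nil N).congr rfl fun k x y => ?_
    have hid (x : ℕ → Bool) : (fun i => if 0 + i < j then x (0 + i) else if i < j then
        x (0 + i - j) else x i) = x := by
      funext i
      by_cases h : i < j <;> simp [h]
    simp only [WireKernel.comap, hid, id]
  | succ c ih =>
    refine ((ih (by omega)).trans (realizes_moveWord (N := N) (j := j) (by omega) hjN)).congr
      (wordLoop_succ c _).symm fun k x y => ?_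
    have hstep (x : ℕ → Bool) : (fun i => if c + i < j then moveBits j x (c + i) else if i < j then
        moveBits j x (c + i - j) else moveBits j x i) = fun i => if c + 1 + i < j then
        x (c + 1 + i) else if i < j then x (c + 1 + i - j) else x i := by
      funext i
      unfold moveBits
      split_ifs <;> first | rfl | omega | (congr 1; omega)
    simp only [WireKernel.comap, hstep]

theorem appendWires_fin {n : ℕ} (u : Qubits n) (x : ℕ → Bool) (i : Fin n) :
    appendWires u x i = u i := by
  simp [appendWires]

theorem appendWires_add {n : ℕ} (u : Qubits n) (x : ℕ → Bool) (i : ℕ) :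
    appendWires u x (n + i) = x i := by
  simp [appendWires]

theorem eq_appendWires {n : ℕ} {u : Qubits n} {x y : ℕ → Bool} (hu : ∀ i : Fin n, y i = u i)
    (hx : (fun i => y (n + i)) = x) : y = appendWires u x := by
  funext i
  by_cases h : i < n
  · rw [appendWires, dif_pos h, ← hu]
  · simp only [appendWires, h, dite_false, ← hx, Nat.add_sub_cancel' (not_lt.1 h)]

theorem realizes_moveRegister {N l n : ℕ} (hN : l + (n + n) ≤ N) :
    ∃ f : (ℕ → Bool) → ℕ → Bool,
      Realizes N N (wordLoop n fun _ => moveWord (l + (n + n))) (WireKernel.comap f) ∧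
      ∀ (h r : Qubits n) (u : Qubits l) (x : ℕ → Bool),
        f (appendWires h (appendWires u (appendWires r x))) =
          appendWires u (appendWires r (appendWires h x)) := by
  refine ⟨_, realizes_wordLoop_moveWord n (by omega) hN, fun h r u x => ?_⟩
  refine eq_appendWires (fun i => ?_) <| eq_appendWires (fun i => ?_) <|
    eq_appendWires (fun i => ?_) <| funext fun i => ?_
  · rw [if_pos (by omega), appendWires_add, appendWires_fin]
  · rw [if_pos (by omega), appendWires_add, appendWires_add, appendWires_fin]
  · rw [if_neg (by omega), if_pos (by omega),
      show n + (l + (n + i)) - (l + (n + n)) = i by omega, appendWires_fin]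
  · rw [if_neg (by omega), if_neg (by omega), Nat.add_left_comm l, appendWires_add,
      appendWires_add, appendWires_add]

/-! ### The swap test -/

/-- The values on all wires after the insertion of the value `b` as wire `0`. -/
def consWire (b : Bool) (x : ℕ → Bool) : ℕ → Bool
  | 0 => b
  | i + 1 => x i

theorem consWire_zero (b : Bool) (x : ℕ → Bool) : consWire b x 0 = b := rfl

theorem consWire_succ (b : Bool) (x : ℕ → Bool) (i : ℕ) : consWire b x (i + 1) = x i := rfl

theorem dropWires_consWire (b : Bool) (x : ℕ → Bool) : dropWires 1 (consWire b x) = x := rfl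

/-- The change of variables of a controlled swap of the wires `a` and `b`. -/
def cswapBits (a b : ℕ) (x : ℕ → Bool) : ℕ → Bool := fun i =>
  if x 0 = true then if i = a then x b else if i = b then x a else x i else x i

theorem realizes_cswapWord {N a b : ℕ} (ha : 0 < a) (hab : a < b) (hb : b < N) :
    Realizes N N (cswapWord a b) (WireKernel.comap (cswapBits a b)) := by
  refine (((realizes_cnot (i := b) (j := a) (by omega) (by omega) (by omega)).trans
    (realizes_toffoli (i := 0) (j := a) (k := b) (by omega) (by omega) (by omega) (by omega)
    (by omega) (by omega))).trans (realizes_cnot (i := b) (j := a) (by omega) (by omega)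
    (by omega))).congr (by simp [cswapWord]) fun k x y => ?_
  have hswap (x : ℕ → Bool) :
      cnotBits b a (toffoliBits 0 a b (cnotBits b a x)) = cswapBits a b x := by
    funext i
    by_cases hia : i = a
    · subst hia
      simp only [cnotBits, toffoliBits, cswapBits, ne_eq, hab.ne, hab.ne', ha.ne,
        not_false_eq_true, Function.update_self, Function.update_of_ne, if_true]
      cases x i <;> cases x b <;> cases x 0 <;> rfl
    · by_cases hib : i = b
      · subst hib
        simp only [cnotBits, toffoliBits, cswapBits, ne_eq, hab.ne', ha.ne,
          not_false_eq_true, Function.update_self, Function.update_of_ne, if_true, if_false]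
        cases x i <;> cases x a <;> cases x 0 <;> rfl
      · simp [cnotBits, toffoliBits, cswapBits, hia, hib]
  simp only [WireKernel.comap, hswap]

/-- The change of variables of a controlled swap of the blocks of `c` wires that start at `p` and at
`p + d`. -/
def cswapBlockBits (p d c : ℕ) (x : ℕ → Bool) : ℕ → Bool := fun i =>
  if x 0 = true then
    if p ≤ i ∧ i < p + c then x (i + d) else
      if p + d ≤ i ∧ i < p + d + c then x (i - d) else x i
  else x i

theorem realizes_cswapBlock {N p d : ℕ} (c : ℕ) (hp : 0 < p) (hc : c ≤ d) (hN : p + d + c ≤ N) :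
    Realizes N N (wordLoop c fun i => cswapWord (p + i) (p + d + i))
      (WireKernel.comap (cswapBlockBits p d c)) := by
  induction c with
  | zero =>
    refine (Realizes.nil N).congr rfl fun k x y => ?_
    have hid (x : ℕ → Bool) : cswapBlockBits p d 0 x = x := by
      funext i
      unfold cswapBlockBits
      split_ifs <;> first | rfl | omega
    simp only [WireKernel.comap, hid, id]
  | succ c ih =>
    refine ((ih (by omega) (by omega)).trans (realizes_cswapWord (N := N) (a := p + c)
      (b := p + d + c) (by omega) (by omega) (by omega))).congr (wordLoop_succ c _).symm
      fun k x y => ?_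
    have hstep (x : ℕ → Bool) : cswapBlockBits p d c (cswapBits (p + c) (p + d + c) x) =
        cswapBlockBits p d (c + 1) x := by
      have hzero : cswapBits (p + c) (p + d + c) x 0 = x 0 := by
        simp [cswapBits, show 0 ≠ p + c by omega, show 0 ≠ p + d + c by omega]
      funext i
      unfold cswapBlockBits
      rw [hzero]
      by_cases hx : x 0 = true
      · simp only [hx, cswapBits, if_true]
        split_ifs <;> first | rfl | omega | (congr 1; omega)
      · simp only [hx, cswapBits]
        rfl
    simp only [WireKernel.comap, hstep]

theorem cswapBlockBits_consWire_false (p d c : ℕ) (x : ℕ → Bool) :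
    cswapBlockBits p d c (consWire false x) = consWire false x := by
  funext i
  simp [cswapBlockBits, consWire_zero]

theorem cswapBlockBits_consWire_true {q n : ℕ} (w : Qubits q) (u v : Qubits n) (x : ℕ → Bool) :
    cswapBlockBits (q + 1) n n
        (consWire true (appendWires w (appendWires u (appendWires v x)))) =
      consWire true (appendWires w (appendWires v (appendWires u x))) := by
  set y := appendWires w (appendWires u (appendWires v x)) with hy
  have hcons : cswapBlockBits (q + 1) n n (consWire true y) = consWire true fun i =>
      if q ≤ i ∧ i < q + n then y (i + n) else if q + n ≤ i ∧ i < q + n + n then y (i - n)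
        else y i := by
    funext i
    cases i with
    | zero => simp [cswapBlockBits, consWire_zero]
    | succ i =>
      simp only [cswapBlockBits, consWire_zero, if_true, consWire_succ]
      split_ifs <;> first
        | rfl
        | omega
        | rw [show i + 1 + n = i + n + 1 by omega, consWire_succ]
        | rw [show i + 1 - n = i - n + 1 by omega, consWire_succ]
  rw [hcons]
  congr 1
  refine eq_appendWires (fun i => ?_) <| eq_appendWires (fun i => ?_) <|
    eq_appendWires (fun i => ?_) <| funext fun i => ?_
  · rw [if_neg (by omega), if_neg (by omega), hy, appendWires_fin]
  · rw [if_pos (by omega), Nat.add_assoc, Nat.add_comm (i : ℕ), hy, appendWires_add,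
      appendWires_add, appendWires_fin]
  · rw [if_neg (by omega), if_pos (by omega), show q + (n + (i : ℕ)) - n = q + i by omega, hy,
      appendWires_add, appendWires_fin]
  · rw [if_neg (by omega), if_neg (by omega), hy, appendWires_add, appendWires_add,
      appendWires_add]

theorem realizes_cswapRegisters {N q n : ℕ} (hN : q + n + n + 1 ≤ N) :
    ∃ f : (ℕ → Bool) → ℕ → Bool,
      Realizes N N (wordLoop n fun i => cswapWord (q + i + 1) (q + n + i + 1))
        (WireKernel.comap f) ∧
      ∀ (a : Bool) (w : Qubits q) (u v : Qubits n) (x : ℕ → Bool),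
        f (consWire a (appendWires w (appendWires u (appendWires v x)))) =
          consWire a (appendWires w (if a = true then appendWires v (appendWires u x)
            else appendWires u (appendWires v x))) := by
  refine ⟨cswapBlockBits (q + 1) n n, ?_, fun a w u v x => ?_⟩
  · have hblock := realizes_cswapBlock (N := N) (p := q + 1) (d := n) n (by omega) le_rfl (by omega)
    convert hblock using 4 <;> omega
  · cases a
    · exact cswapBlockBits_consWire_false _ _ _ _
    · exact cswapBlockBits_consWire_true w u v x

theorem exp_I_mul_pi_div_four_pow_four :
    Complex.exp (Complex.I * (Real.pi / 4 : ℝ)) ^ 4 = -1 := by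
  rw [← Complex.exp_nat_mul]
  convert Complex.exp_pi_mul_I using 2
  push_cast
  ring

theorem realizes_minusWord (N : ℕ) : Realizes N (N + 1) minusWord fun k x y =>
    2⁻¹ * (hadamardSign (x 0) true * hadamardSign (y 0) true *
      k (dropWires 1 x) (dropWires 1 y)) := by
  have hT := realizes_tGate (N := N + 1) (i := 0) (by omega)
  refine ((((((realizes_ancilla N).trans (realizes_hadamard (i := 0) (by omega))).trans hT).trans
    hT).trans hT).trans hT).congr (by simp [minusWord]) fun k x y => ?_
  simp only [WireKernel.tGate, WireKernel.hadamard_ancilla]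
  set z := Complex.exp (Complex.I * (Real.pi / 4 : ℝ)) with hz
  have hphase (b : Bool) : (if b = true then z else 1) ^ 4 = hadamardSign b true := by
    cases b
    · simp [hadamardSign]
    · rw [if_pos rfl, hz, exp_I_mul_pi_div_four_pow_four, hadamardSign, if_pos ⟨rfl, rfl⟩]
  have hphase_star (b : Bool) : star (if b = true then z else 1) ^ 4 = hadamardSign b true := by
    rw [← star_pow, hphase]
    cases b <;> simp [hadamardSign]
  rw [← hphase, ← hphase_star]
  ring

theorem wordLoop_const_succ (c : ℕ) (w : List CircuitSym) :
    wordLoop (c + 1) (fun _ => w) = w ++ wordLoop c fun _ => w := by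
  simp [wordLoop, List.range_succ_eq_map, List.flatMap_map]

theorem appendWires_cons {c : ℕ} (b : Bool) (u : Qubits c) (x : ℕ → Bool) :
    appendWires (Fin.cons (α := fun _ => Bool) b u) x = consWire b (appendWires u x) := by
  refine (eq_appendWires (fun i => ?_) (funext fun i => ?_)).symm
  · refine Fin.cases rfl (fun i => ?_) i
    exact appendWires_fin u x i
  · rw [Nat.add_right_comm]
    exact appendWires_add u x i

theorem sum_qubits_succ {c : ℕ} (f : Qubits (c + 1) → ℂ) :
    ∑ z, f z = ∑ b, ∑ u : Qubits c, f (Fin.cons (α := fun _ => Bool) b u) := by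
  rw [← (Fin.consEquiv fun _ => Bool).sum_comp, Fintype.sum_prod_type]
  rfl

theorem insertWire_one_consWire (a b : Bool) (x : ℕ → Bool) :
    insertWire 1 b (consWire a x) = consWire a (consWire b x) := by
  funext i
  match i with
  | 0 => simp [insertWire, consWire]
  | 1 => simp [insertWire, consWire]
  | i + 2 => simp [insertWire, consWire]

theorem realizes_discards (N c : ℕ) :
    Realizes (N + 1 + c) (N + 1) (wordLoop c fun _ => .discard :: unary 1) fun k x y =>
      ∑ z : Qubits c, k (consWire (x 0) (appendWires z (dropWires 1 x)))
        (consWire (y 0) (appendWires z (dropWires 1 y))) := by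
  induction c with
  | zero =>
    refine (Realizes.nil _).congr rfl fun k x y => ?_
    have hempty (x : ℕ → Bool) (z : Qubits 0) :
        consWire (x 0) (appendWires z (dropWires 1 x)) = x := by
      funext i
      cases i <;> simp [consWire, appendWires, dropWires]
    simp [hempty]
  | succ c ih =>
    refine ((realizes_discard (N := N + 1 + c) (i := 1) (by omega)).trans ih).congr
      (wordLoop_const_succ c _).symm fun k x y => ?_
    simp only [WireKernel.discard, insertWire_one_consWire, sum_qubits_succ, appendWires_cons]
    rw [Finset.sum_comm]

theorem sum_registers {A R : Type} [Fintype A] [Fintype R] (F : (A × R) × (A × R) → ℂ) :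
    ∑ r₂, ∑ r₁, ∑ κ₁, ∑ κ₂, F ((κ₁, r₁), (κ₂, r₂)) = ∑ z, F z := by
  simp only [Fintype.sum_prod_type]
  calc
    _ = ∑ r₂, ∑ κ₁, ∑ r₁, ∑ κ₂, F ((κ₁, r₁), (κ₂, r₂)) :=
      Finset.sum_congr rfl fun _ _ => Finset.sum_comm
    _ = ∑ κ₁, ∑ r₂, ∑ r₁, ∑ κ₂, F ((κ₁, r₁), (κ₂, r₂)) := Finset.sum_comm
    _ = ∑ κ₁, ∑ r₁, ∑ r₂, ∑ κ₂, F ((κ₁, r₁), (κ₂, r₂)) :=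
      Finset.sum_congr rfl fun _ _ => Finset.sum_comm
    _ = _ := Finset.sum_congr rfl fun _ _ => Finset.sum_congr rfl fun _ _ => Finset.sum_comm

theorem trace_swapOp_mul {A : Type} [Fintype A] [DecidableEq A] (σ : Op (A × A)) :
    (swapOp A * σ).trace = ∑ z : A × A, σ z.swap z := by
  simp only [Matrix.trace, Matrix.diag, Matrix.mul_apply, swapOp]
  refine Finset.sum_congr rfl fun z _ => ?_
  have hswap (y : A × A) : z = y.swap ↔ z.swap = y := by
    rw [← Prod.swap_inj, Prod.swap_swap]
  simp [hswap]

theorem trace_symProj_mul {A : Type} [Fintype A] [DecidableEq A] (σ : Op (A × A)) :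
    (symProj A * σ).trace = 2⁻¹ * (σ.trace + (swapOp A * σ).trace) := by
  rw [symProj, Matrix.smul_mul, Matrix.trace_smul, Matrix.add_mul, Matrix.trace_add,
    Matrix.one_mul, smul_eq_mul]

theorem trace_symProj_mul_eq_sum {A : Type} [Fintype A] [DecidableEq A] (σ : Op (A × A)) :
    (symProj A * σ).trace = 2⁻¹ * (2⁻¹ * ∑ z : A × A,
      (σ z.swap z.swap + σ z.swap z + (σ z z.swap + σ z z))) := by
  have hdiag : ∑ z : A × A, σ z.swap z.swap = ∑ z, σ z z :=
    (Equiv.prodComm A A).sum_comp fun z => σ z z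
  have hoff : ∑ z : A × A, σ z z.swap = ∑ z : A × A, σ z.swap z :=
    (Equiv.prodComm A A).sum_comp fun z => σ z.swap z
  rw [trace_symProj_mul, trace_swapOp_mul, Matrix.trace]
  simp only [Finset.sum_add_distrib, hdiag, hoff, Matrix.diag]
  ring

/-- The description of the part of the verifier that performs the swap test on two pairs of
registers of `l` and `n` wires. The output of the test is the only remaining wire. -/
def swapTestWord (n l : ℕ) : List CircuitSym :=
  minusWord ++ (wordLoop l (fun i => cswapWord (i + 1) (l + i + 1)) ++
    (wordLoop n (fun i => cswapWord (l + (l + i) + 1) (l + (l + (n + i)) + 1)) ++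
      (wordLoop l (fun _ => .discard :: unary 1) ++
        (wordLoop l (fun _ => .discard :: unary 1) ++
          (wordLoop n (fun _ => .discard :: unary 1) ++
            (wordLoop n (fun _ => .discard :: unary 1) ++ .hadamard :: unary 0))))))

theorem realizes_swapTestDiscards (n l : ℕ) :
    Realizes (l + (n + n) + l + 1) 1 (wordLoop l (fun _ => .discard :: unary 1) ++
        (wordLoop l (fun _ => .discard :: unary 1) ++
          (wordLoop n (fun _ => .discard :: unary 1) ++
            (wordLoop n (fun _ => .discard :: unary 1) ++ .hadamard :: unary 0))))
      fun k x y => 2⁻¹ * ∑ a, ∑ b, hadamardSign (x 0) a * hadamardSign (y 0) b *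
        ∑ z : (Qubits l × Qubits n) × (Qubits l × Qubits n),
          k (consWire a (appendWires z.2.1 (appendWires z.1.1 (appendWires z.1.2
            (appendWires z.2.2 (dropWires 1 x))))))
          (consWire b (appendWires z.2.1 (appendWires z.1.1 (appendWires z.1.2
            (appendWires z.2.2 (dropWires 1 y)))))) := by
  have hκ₂ := realizes_discards (n + n + l) l
  have hκ₁ := realizes_discards (n + n) l
  have hr₁ := realizes_discards n n
  have hr₂ := realizes_discards 0 n
  rw [show n + n + l + 1 + l = l + (n + n) + l + 1 by omega] at hκ₂
  rw [show n + n + 1 + l = n + n + l + 1 by omega] at hκ₁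
  rw [show n + 1 + n = n + n + 1 by omega] at hr₁
  rw [show 0 + 1 + n = n + 1 by omega] at hr₂
  have hout := realizes_hadamard (N := 0 + 1) (i := 0) (by omega)
  refine (hκ₂.trans <| hκ₁.trans <| hr₁.trans <| hr₂.trans hout).congr rfl fun k x y => ?_
  simp only [WireKernel.hadamard, consWire_zero, dropWires_consWire, dropWires_update_zero,
    Function.update_self, ← sum_registers]

theorem appendWires_append {n m : ℕ} (u : Qubits n) (v : Qubits m) (x : ℕ → Bool) :
    appendWires (Fin.append u v) x = appendWires u (appendWires v x) := by
  refine eq_appendWires (fun i => ?_) <| eq_appendWires (fun i => ?_) <| funext fun i => ?_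
  · rw [← Fin.val_castAdd m i, appendWires_fin, Fin.append_left]
  · rw [← Fin.val_natAdd n i, appendWires_fin, Fin.append_right]
  · rw [← Nat.add_assoc, appendWires_add]

theorem realizes_swapTest (n l : ℕ) : ∃ G, Realizes (l + (n + n) + l) 1 (swapTestWord n l) G ∧
    ∀ (k : WireKernel) (σ : Op ((Qubits l × Qubits n) × (Qubits l × Qubits n))) (t : ℕ → Bool),
      t 0 = true →
      (∀ κ₁ κ₂ κ₁' κ₂' r₁ r₂ r₁' r₂',
        k (appendWires κ₂ (appendWires κ₁ (appendWires r₁ (appendWires r₂ (dropWires 1 t)))))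
            (appendWires κ₂' (appendWires κ₁' (appendWires r₁'
              (appendWires r₂' (dropWires 1 t))))) =
          σ ((κ₁, r₁), (κ₂, r₂)) ((κ₁', r₁'), (κ₂', r₂'))) →
      G k t t = (symProj (Qubits l × Qubits n) * σ).trace := by
  obtain ⟨fκ, hκ, hfκ⟩ := realizes_cswapRegisters
    (N := l + (n + n) + l + 1) (q := 0) (n := l) (by omega)
  obtain ⟨fr, hr, hfr⟩ := realizes_cswapRegisters
    (N := l + (n + n) + l + 1) (q := l + l) (n := n) (by omega)
  simp only [Nat.zero_add] at hκ
  simp only [Nat.add_assoc l l, Nat.add_assoc l (l + n), Nat.add_assoc l n] at hr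
  refine ⟨_, (realizes_minusWord (l + (n + n) + l)).trans <| hκ.trans <| hr.trans <|
    realizes_swapTestDiscards n l, fun k σ t ht hk => ?_⟩
  have hfκ' (a : Bool) (u v : Qubits l) (x : ℕ → Bool) :
      fκ (consWire a (appendWires u (appendWires v x))) = consWire a (if a = true then
        appendWires v (appendWires u x) else appendWires u (appendWires v x)) := by
    have hzero (w : Qubits 0) (x : ℕ → Bool) : appendWires w x = x :=
      (eq_appendWires (fun i => i.elim0) (funext fun i => by rw [Nat.zero_add])).symm
    simpa only [hzero] using hfκ a (takeWires 0 x) u v x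
  have hfr' (a : Bool) (κ κ' : Qubits l) (u v : Qubits n) (x : ℕ → Bool) :
      fr (consWire a (appendWires κ (appendWires κ' (appendWires u (appendWires v x))))) =
        consWire a (appendWires κ (appendWires κ' (if a = true then
          appendWires v (appendWires u x) else appendWires u (appendWires v x)))) := by
    rw [← appendWires_append κ κ', hfr, appendWires_append]
  rw [trace_symProj_mul_eq_sum]
  simp only [WireKernel.comap, hfr', hfκ', Fintype.sum_bool, if_true, Bool.false_eq_true, if_false,
    consWire_zero, dropWires_consWire, hk]
  simp [hadamardSign, ht, Finset.mul_sum, ← Finset.sum_add_distrib, mul_add, Prod.swap]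

/-- The state on which the swap test of the protocol is performed. -/
def EncryptionCircuit.swapTestInput (E : EncryptionCircuit)
    (ρ : Op ((Qubits E.n × Qubits E.n) × (Qubits E.n × Qubits E.n))) :
    Op ((Qubits E.l × Qubits E.n) × (Qubits E.l × Qubits E.n)) :=
  mapTensor (tensorId E.average (Qubits E.n)) (tensorId E.average (Qubits E.n)) ρ

theorem mapTensor_tensorId_apply {A B R A' B' R' : Type} (Φ : Op A →ₗ[ℂ] Op B)
    (Ψ : Op A' →ₗ[ℂ] Op B') (ρ : Op ((A × R) × (A' × R'))) (z w : B) (r s : R) (z' w' : B')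
    (r' s' : R') :
    mapTensor (tensorId Φ R) (tensorId Ψ R') ρ ((z, r), (z', r')) ((w, s), (w', s')) =
      Φ (Matrix.of fun u v => Ψ (Matrix.of fun u' v' => ρ ((u, r), (u', r')) ((v, s), (v', s')))
        z' w') z w :=
  rfl

theorem linearMap_apply_eq_sum {A B : Type} [Fintype A] [DecidableEq A] (Φ : Op A →ₗ[ℂ] Op B)
    (X : Op A) (z w : B) :
    Φ X z w = ∑ p : A × A, X p.1 p.2 * Φ (Matrix.single p.1 p.2 1) z w := by
  conv_lhs => rw [Matrix.matrix_eq_sum_single X]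
  simp only [map_sum, Matrix.sum_apply, Fintype.sum_prod_type]
  refine Finset.sum_congr rfl fun u _ => Finset.sum_congr rfl fun v _ => ?_
  rw [← mul_one (X u v), ← smul_eq_mul, ← Matrix.smul_single, map_smul, Matrix.smul_apply,
    smul_eq_mul, smul_eq_mul, mul_one]

theorem linearMap_apply_comm {A A' B B' : Type} [Finite A] [Finite A']
    (Φ : Op A →ₗ[ℂ] Op B) (Ψ : Op A' →ₗ[ℂ] Op B') (X : A → A' → A → A' → ℂ) (z w : B) (z' w' : B') :
    Φ (Matrix.of fun u v => Ψ (Matrix.of fun u' v' => X u u' v v') z' w') z w =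
      Ψ (Matrix.of fun u' v' => Φ (Matrix.of fun u v => X u u' v v') z w) z' w' := by
  classical
  have := Fintype.ofFinite A
  have := Fintype.ofFinite A'
  rw [linearMap_apply_eq_sum Φ, linearMap_apply_eq_sum Ψ]
  simp only [Matrix.of_apply, linearMap_apply_eq_sum Ψ (Matrix.of fun u' v' => X _ u' _ v') z' w',
    linearMap_apply_eq_sum Φ (Matrix.of fun u v => X u _ v _) z w, Finset.sum_mul]
  rw [Finset.sum_comm]
  simp only [mul_right_comm]

theorem takeWires_joinRegisters {n : ℕ} (h r h' r' : Qubits n) (t : ℕ → Bool) :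
    takeWires ((n + n) + (n + n))
        (appendWires h (appendWires r (appendWires h' (appendWires r' t)))) =
      joinRegisters ((h, r), (h', r')) := by
  rw [← appendWires_append h' r', ← appendWires_append h r, ← appendWires_append,
    takeWires_appendWires]
  rfl

theorem EncryptionCircuit.swapTestInput_eq (E : EncryptionCircuit)
    (ρ : Op ((Qubits E.n × Qubits E.n) × (Qubits E.n × Qubits E.n))) :
    E.swapTestInput ρ = ((2 : ℂ) ^ E.m * 2 ^ E.m)⁻¹ • ∑ k₁ : Qubits E.m, ∑ k₂ : Qubits E.m,
      mapTensor (tensorId (E.chan k₁) (Qubits E.n)) (tensorId (E.chan k₂) (Qubits E.n)) ρ := by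
  ext ⟨⟨z, r⟩, ⟨z', r'⟩⟩ ⟨⟨w, s⟩, ⟨w', s'⟩⟩
  simp only [swapTestInput, Matrix.smul_apply, Matrix.sum_apply, mapTensor_tensorId_apply]
  have hblock : (Matrix.of fun u v => E.average (Matrix.of fun u' v' =>
      ρ ((u, r), (u', r')) ((v, s), (v', s'))) z' w') = ((2 : ℂ) ^ E.m)⁻¹ • ∑ k₂ : Qubits E.m,
      Matrix.of fun u v => E.chan k₂ (Matrix.of fun u' v' =>
      ρ ((u, r), (u', r')) ((v, s), (v', s'))) z' w' := by
    ext u v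
    simp only [average, LinearMap.smul_apply, LinearMap.sum_apply, Matrix.smul_apply,
      Matrix.sum_apply, Matrix.of_apply]
  rw [hblock, average]
  simp only [LinearMap.smul_apply, LinearMap.sum_apply, Matrix.smul_apply, Matrix.sum_apply,
    map_smul, map_sum, smul_eq_mul, Finset.mul_sum, mul_inv, mul_assoc]
  exact Finset.sum_comm

theorem EncryptionCircuit.protocolAcceptProb_eq (E : EncryptionCircuit)
    (ρ : Op ((Qubits E.n × Qubits E.n) × (Qubits E.n × Qubits E.n))) :
    E.protocolAcceptProb ρ = (symProj _ * E.swapTestInput ρ).trace.re := by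
  have hcast : ((2 : ℂ) ^ E.m * 2 ^ E.m)⁻¹ = (((2 : ℝ) ^ E.m * 2 ^ E.m)⁻¹ : ℝ) := by
    push_cast
    rfl
  rw [swapTestInput_eq, protocolAcceptProb, Matrix.mul_smul, Matrix.trace_smul, hcast, smul_eq_mul,
    Complex.re_ofReal_mul]
  simp only [Matrix.mul_sum, Matrix.trace_sum, Complex.re_sum]

theorem realizes_encryptions (E : EncryptionCircuit) :
    ∃ G, Realizes ((E.n + E.n) + (E.n + E.n)) (E.l + (E.n + E.n) + E.l)
      ((wordLoop E.m (fun _ => keyWord) ++ E.circuit.symbols) ++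
        (wordLoop E.n (fun _ => moveWord (E.l + (E.n + E.n))) ++
          (wordLoop E.m (fun _ => keyWord) ++ E.circuit.symbols))) G ∧
      ∀ (ρ : Op (Qubits ((E.n + E.n) + (E.n + E.n)))) (t : ℕ → Bool) κ₁ κ₂ κ₁' κ₂' r₁ r₂ r₁' r₂',
        G (kernel ρ) (appendWires κ₂ (appendWires κ₁ (appendWires r₁ (appendWires r₂ t))))
            (appendWires κ₂' (appendWires κ₁' (appendWires r₁' (appendWires r₂' t)))) =
          E.swapTestInput (ρ.submatrix joinRegisters joinRegisters)
            ((κ₁, r₁), (κ₂, r₂)) ((κ₁', r₁'), (κ₂', r₂')) := by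
  obtain ⟨f, hmove, hf⟩ := realizes_moveRegister
    (N := E.n + (E.n + E.n) + E.l) (l := E.l) (n := E.n) (by omega)
  have hfirst := realizes_average E (E.n + (E.n + E.n))
  have hsecond := realizes_average E (E.l + (E.n + E.n))
  rw [show E.n + (E.n + E.n) + E.n = (E.n + E.n) + (E.n + E.n) by omega] at hfirst
  rw [show E.l + (E.n + E.n) + E.n = E.n + (E.n + E.n) + E.l by omega] at hsecond
  refine ⟨_, hfirst.trans <| hmove.trans hsecond, fun ρ t κ₁ κ₂ κ₁' κ₂' r₁ r₂ r₁' r₂' => ?_⟩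
  rw [EncryptionCircuit.swapTestInput, mapTensor_tensorId_apply, linearMap_apply_comm]
  simp only [WireKernel.extend, WireKernel.comap, dropWires_appendWires, takeWires_appendWires, hf,
    kernel, takeWires_joinRegisters, Matrix.submatrix_apply]

theorem exists_verifier (E : EncryptionCircuit) :
    ∃ V : QCircuit ((E.n + E.n) + (E.n + E.n)) 1,
      V.symbols = verifierWord E.m E.n E.l E.circuit.symbols ∧
      ∀ ρ, V.acceptProb ρ = E.protocolAcceptProb (ρ.submatrix joinRegisters joinRegisters) := by
  obtain ⟨G, hG, hG_apply⟩ := realizes_encryptions E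
  obtain ⟨G', hG', hG'_apply⟩ := realizes_swapTest E.n E.l
  obtain ⟨V, hV, hkernel⟩ := hG.trans hG'
  refine ⟨V, ?_, fun ρ => ?_⟩
  · rw [hV, verifierWord, swapTestWord]
    simp only [List.append_assoc]
  · rw [E.protocolAcceptProb_eq, ← hG'_apply _ _ (fun _ => true) rfl (hG_apply ρ _)]
    exact congrArg Complex.re (hkernel ρ (fun _ => true) fun _ => true)

/-! ### The trace norm and the diamond norm -/

section TraceNorm

open scoped MatrixOrder Matrix.Norms.L2Operator Matrix

/-- The rank-one operator `|v⟩⟨v|`. -/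
def ketbra {A : Type} (v : A → ℂ) : Op A := Matrix.vecMulVec v (star v)

theorem posSemidef_ketbra {A : Type} [Finite A] (v : A → ℂ) : (ketbra v).PosSemidef :=
  Matrix.posSemidef_vecMulVec_self_star v

theorem trace_ketbra {A : Type} [Fintype A] (v : A → ℂ) :
    (ketbra v).trace = (∑ i, ‖v i‖ ^ 2 : ℝ) := by
  simp [ketbra, Matrix.trace, Matrix.vecMulVec, Complex.mul_conj, Complex.normSq_eq_norm_sq]

variable {A : Type} [Fintype A] [DecidableEq A]

theorem traceNorm_nonneg (X : Op A) : 0 ≤ traceNorm X :=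
  Finset.sum_nonneg fun _ _ => Real.sqrt_nonneg _

theorem trace_cfc {X : Op A} (hX : X.IsHermitian) (f : ℝ → ℝ) :
    (cfc f X).trace = ∑ i, (f (hX.eigenvalues i) : ℂ) := by
  rw [hX.cfc_eq, Matrix.IsHermitian.cfc, Unitary.conjStarAlgAut_apply, Matrix.trace_mul_comm,
    ← mul_assoc, Unitary.coe_star_mul_self, one_mul, Matrix.trace_diagonal]
  rfl

theorem trace_abs (X : Op A) : (CFC.abs X).trace = traceNorm X := by
  have hX : (0 : Op A) ≤ star X * X := star_mul_self_nonneg X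
  rw [CFC.abs, CFC.sqrt_eq_cfc, cfc_nnreal_eq_real _ (star X * X)]
  refine (trace_cfc (Matrix.isHermitian_conjTranspose_mul_self X) _).trans ?_
  simp only [traceNorm, Complex.ofReal_sum, Real.sqrt]

theorem traceNorm_of_posSemidef {X : Op A} (hX : X.PosSemidef) : (traceNorm X : ℂ) = X.trace := by
  rw [← trace_abs, CFC.abs_of_nonneg X hX.nonneg]

theorem traceNorm_ketbra (v : A → ℂ) : traceNorm (ketbra v) = ∑ i, ‖v i‖ ^ 2 :=
  Complex.ofReal_injective <|
    (traceNorm_of_posSemidef (posSemidef_ketbra v)).trans (trace_ketbra v)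

theorem norm_mulVec_eigenvectorBasis (X : Op A) (i : A) :
    ‖WithLp.toLp 2 (X *ᵥ (Matrix.isHermitian_conjTranspose_mul_self X).eigenvectorBasis i)‖ =
      √((Matrix.isHermitian_conjTranspose_mul_self X).eigenvalues i) := by
  rw [Matrix.IsHermitian.eigenvalues_eq, ← Matrix.mulVec_mulVec, Matrix.dotProduct_mulVec,
    ← Matrix.star_mulVec, EuclideanSpace.norm_eq, dotProduct, map_sum]
  simp [Complex.conj_mul', ← Complex.ofReal_pow]

theorem norm_trace_mul_le (M X : Op A) : ‖(M * X).trace‖ ≤ ‖M‖ * traceNorm X := by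
  set b := (Matrix.isHermitian_conjTranspose_mul_self X).eigenvectorBasis
  have htrace : (M * X).trace = ∑ i, inner ℂ (b i) (Matrix.toEuclideanLin (M * X) (b i)) := by
    rw [← LinearMap.trace_eq_sum_inner, Matrix.toEuclideanLin_eq_toLin_orthonormal,
      Matrix.trace_toLin_eq]
  rw [htrace, traceNorm, Finset.mul_sum]
  refine (norm_sum_le _ _).trans <| Finset.sum_le_sum fun i _ => ?_
  calc ‖inner ℂ (b i) (Matrix.toEuclideanLin (M * X) (b i))‖
      ≤ ‖b i‖ * ‖Matrix.toEuclideanLin (M * X) (b i)‖ := norm_inner_le_norm _ _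
    _ = ‖WithLp.toLp 2 (M *ᵥ X *ᵥ b i)‖ := by
      rw [b.norm_eq_one, one_mul, Matrix.toLpLin_apply, Matrix.mulVec_mulVec]
    _ ≤ ‖M‖ * ‖WithLp.toLp 2 (X *ᵥ b i)‖ := Matrix.l2_opNorm_mulVec M (WithLp.toLp 2 (X *ᵥ b i))
    _ = _ := by rw [norm_mulVec_eigenvectorBasis]

theorem IsDensity.norm_le_one {ρ : Op A} (h : IsDensity ρ) : ‖ρ‖ ≤ 1 := by
  obtain ⟨hpos, htrace⟩ := h
  have hsum : ∑ i, hpos.isHermitian.eigenvalues i = 1 := by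
    rw [hpos.isHermitian.trace_eq_sum_eigenvalues] at htrace
    exact Complex.ofReal_injective (by simpa using htrace)
  rw [← cfc_id' ℝ ρ hpos.isHermitian]
  refine norm_cfc_le zero_le_one fun x hx => ?_
  obtain ⟨i, rfl⟩ := hpos.isHermitian.spectrum_real_eq_range_eigenvalues ▸ hx
  rw [Real.norm_of_nonneg (hpos.eigenvalues_nonneg i), ← hsum]
  exact Finset.single_le_sum (fun j _ => hpos.eigenvalues_nonneg j) (Finset.mem_univ i)

theorem norm_le_one_of_isStarProjection {B : Type} [Fintype B] {M : Matrix B A ℂ}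
    (h : IsStarProjection (Mᴴ * M)) : ‖M‖ ≤ 1 := by
  have hsq := h.norm_le
  rw [Matrix.l2_opNorm_conjTranspose_mul_self] at hsq
  nlinarith [norm_nonneg M]

theorem cfc_mul_cfc (P : Op A) (f g : ℝ → ℝ) :
    cfc f P * cfc g P = cfc (fun x => f x * g x) P :=
  (cfc_mul f g P (P.finite_real_spectrum.continuousOn f)
    (P.finite_real_spectrum.continuousOn g)).symm

theorem conjTranspose_mul_self_mul_cfc {R : Type} [Fintype R] (Ψ : Matrix R A ℂ) (f : ℝ → ℝ) :
    (Ψ * cfc f (Ψᴴ * Ψ))ᴴ * (Ψ * cfc f (Ψᴴ * Ψ)) = cfc (fun x => f x * (x * f x)) (Ψᴴ * Ψ) := by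
  have hstar : (cfc f (Ψᴴ * Ψ))ᴴ = cfc f (Ψᴴ * Ψ) := cfc_predicate f (Ψᴴ * Ψ)
  have hid := cfc_id' ℝ (Ψᴴ * Ψ) (Matrix.isHermitian_conjTranspose_mul_self Ψ)
  calc (Ψ * cfc f (Ψᴴ * Ψ))ᴴ * (Ψ * cfc f (Ψᴴ * Ψ))
      = cfc f (Ψᴴ * Ψ) * ((Ψᴴ * Ψ) * cfc f (Ψᴴ * Ψ)) := by
        rw [Matrix.conjTranspose_mul, hstar]
        simp only [Matrix.mul_assoc]
    _ = cfc f (Ψᴴ * Ψ) * (cfc (fun x => x) (Ψᴴ * Ψ) * cfc f (Ψᴴ * Ψ)) := by rw [hid]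
    _ = _ := by rw [cfc_mul_cfc, cfc_mul_cfc]

theorem mul_cfc_congr {R : Type} [Fintype R] (Ψ : Matrix R A ℂ) {f g : ℝ → ℝ}
    (h : ∀ x ∈ spectrum ℝ (Ψᴴ * Ψ), x ≠ 0 → f x = g x) :
    Ψ * cfc f (Ψᴴ * Ψ) = Ψ * cfc g (Ψᴴ * Ψ) := by
  have hcont (q : ℝ → ℝ) := (Ψᴴ * Ψ).finite_real_spectrum.continuousOn q
  rw [← sub_eq_zero, ← Matrix.mul_sub, ← cfc_sub f g _ (hcont f) (hcont g),
    ← Matrix.conjTranspose_mul_self_eq_zero, conjTranspose_mul_self_mul_cfc]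
  refine (cfc_congr fun x hx => ?_).trans (cfc_zero ℝ (Ψᴴ * Ψ))
  rcases eq_or_ne x 0 with rfl | hx0
  · simp
  · simp [h x hx hx0]

theorem exists_polar_decomposition {A R : Type} [Fintype A] [Fintype R] (Ψ : Matrix R A ℂ) :
    ∃ (V : Matrix R A ℂ) (B : Op A), Ψ = V * B ∧ IsStarProjection (Vᴴ * V) ∧ Bᴴ * B = Ψᴴ * Ψ := by
  classical
  have hH := Matrix.isHermitian_conjTranspose_mul_self Ψ
  have hone : cfc (fun _ : ℝ => (1 : ℝ)) (Ψᴴ * Ψ) = 1 := cfc_const_one ℝ (Ψᴴ * Ψ) hH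
  have hspec : ∀ x ∈ spectrum ℝ (Ψᴴ * Ψ), 0 ≤ x := fun x hx =>
    spectrum_nonneg_of_nonneg (Matrix.posSemidef_conjTranspose_mul_self Ψ).nonneg hx
  have hstar : (cfc Real.sqrt (Ψᴴ * Ψ))ᴴ = cfc Real.sqrt (Ψᴴ * Ψ) :=
    cfc_predicate Real.sqrt (Ψᴴ * Ψ)
  refine ⟨Ψ * cfc (fun x => (√x)⁻¹) (Ψᴴ * Ψ), cfc Real.sqrt (Ψᴴ * Ψ), ?_,
    ⟨?_, Matrix.isHermitian_conjTranspose_mul_self _⟩, ?_⟩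
  · rw [Matrix.mul_assoc, cfc_mul_cfc, mul_cfc_congr Ψ (g := fun _ => 1), hone,
      Matrix.mul_one]
    intro x hx hx0
    exact inv_mul_cancel₀ (Real.sqrt_ne_zero'.2 ((hspec x hx).lt_of_ne' hx0))
  · rw [IsIdempotentElem, conjTranspose_mul_self_mul_cfc, cfc_mul_cfc]
    refine cfc_congr fun x hx => ?_
    rcases eq_or_ne x 0 with rfl | hx0
    · simp
    · have hsqrt : √x ≠ 0 := Real.sqrt_ne_zero'.2 ((hspec x hx).lt_of_ne' hx0)
      field_simp
      rw [Real.sq_sqrt (hspec x hx)]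
  · rw [hstar, cfc_mul_cfc, cfc_congr fun x hx => Real.mul_self_sqrt (hspec x hx)]
    exact cfc_id' ℝ _ hH

end TraceNorm

section DiamondNorm

open scoped Matrix.Norms.L2Operator Matrix Kronecker

theorem one_kronecker_mul_apply {A R R' Z : Type} [Fintype A] [DecidableEq A] [Fintype R']
    (V : Matrix R R' ℂ) (Y : Matrix (A × R') Z ℂ) (x : A × R) (z : Z) :
    (((1 : Op A) ⊗ₖ V) * Y) x z = ∑ c, V x.2 c * Y (x.1, c) z := by
  rw [Matrix.mul_apply, Fintype.sum_prod_type, Finset.sum_eq_single x.1]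
  · simp
  · intro b _ hb
    simp [Matrix.one_apply_ne hb.symm]
  · simp

theorem one_kronecker_conj_apply {A R R' : Type} [Fintype A] [DecidableEq A] [Fintype R']
    (V : Matrix R R' ℂ) (X : Op (A × R')) (x y : A × R) :
    (((1 : Op A) ⊗ₖ V) * X * ((1 : Op A) ⊗ₖ V)ᴴ) x y =
      ∑ c, ∑ c', V x.2 c * star (V y.2 c') * X (x.1, c) (y.1, c') := by
  rw [← Matrix.conjTranspose_conjTranspose X, Matrix.mul_assoc, ← Matrix.conjTranspose_mul,
    one_kronecker_mul_apply]
  simp only [Matrix.conjTranspose_apply, one_kronecker_mul_apply, star_sum, star_mul', star_star,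
    Finset.mul_sum, mul_assoc]

theorem tensorId_conj_right {A B R R' : Type} [Fintype A] [DecidableEq A] [Fintype B]
    [DecidableEq B] [Fintype R'] (Φ : Op A →ₗ[ℂ] Op B) (V : Matrix R R' ℂ) (X : Op (A × R')) :
    tensorId Φ R (((1 : Op A) ⊗ₖ V) * X * ((1 : Op A) ⊗ₖ V)ᴴ) =
      ((1 : Op B) ⊗ₖ V) * tensorId Φ R' X * ((1 : Op B) ⊗ₖ V)ᴴ := by
  ext ⟨b, r⟩ ⟨b', r'⟩
  have hblock : (Matrix.of fun a a' =>
      (((1 : Op A) ⊗ₖ V) * X * ((1 : Op A) ⊗ₖ V)ᴴ) (a, r) (a', r')) =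
      ∑ c, ∑ c', (V r c * star (V r' c')) • (Matrix.of fun a a' => X (a, c) (a', c')) := by
    ext a a'
    simp only [Matrix.of_apply, one_kronecker_conj_apply, Matrix.sum_apply, Matrix.smul_apply,
      smul_eq_mul]
  rw [one_kronecker_conj_apply]
  refine (congrArg (fun Y => Φ Y b b') hblock).trans ?_
  simp only [map_sum, map_smul, Matrix.sum_apply, Matrix.smul_apply, smul_eq_mul]
  rfl

variable {A B : Type} [Fintype A] [DecidableEq A] [Fintype B] [DecidableEq B]

theorem traceNorm_tensorId_le {Φ : Op A →ₗ[ℂ] Op B} {ε : ℝ} (hε : 0 ≤ ε)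
    (h : diamondNorm Φ ≤ ENNReal.ofReal ε) (X : Op (A × A)) :
    traceNorm (tensorId Φ A X) ≤ ε * traceNorm X := by
  rcases eq_or_ne X 0 with rfl | hX
  · have hzero : traceNorm (0 : Op (B × A)) = 0 :=
      Complex.ofReal_injective <| by
        rw [traceNorm_of_posSemidef Matrix.PosSemidef.zero, Matrix.trace_zero, Complex.ofReal_zero]
    rw [map_zero, hzero]
    exact mul_nonneg hε (traceNorm_nonneg 0)
  · have hratio := (le_iSup₂ (f := fun (X : Op (A × A)) (_ : X ≠ 0) =>
      ENNReal.ofReal (traceNorm (tensorId Φ A X)) / ENNReal.ofReal (traceNorm X)) X hX).trans h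
    rwa [ENNReal.div_le_iff_le_mul (.inr ENNReal.ofReal_ne_top) (.inl ENNReal.ofReal_ne_top),
      ← ENNReal.ofReal_mul hε,
      ENNReal.ofReal_le_ofReal_iff (mul_nonneg hε (traceNorm_nonneg X))] at hratio

variable {R : Type} [Fintype R]

theorem norm_one_kronecker_le_one {V : Matrix R A ℂ} (h : IsStarProjection (Vᴴ * V)) :
    ‖(1 : Op B) ⊗ₖ V‖ ≤ 1 := by
  refine norm_le_one_of_isStarProjection ⟨?_, Matrix.isHermitian_conjTranspose_mul_self _⟩
  rw [Matrix.conjTranspose_kronecker, ← Matrix.mul_kronecker_mul, Matrix.conjTranspose_one,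
    Matrix.one_mul, IsIdempotentElem, ← Matrix.mul_kronecker_mul, h.isIdempotentElem.eq,
    Matrix.one_mul]

theorem exists_ketbra_eq_conj (ψ : A × R → ℂ) :
    ∃ (V : Matrix R A ℂ) (φ : A × A → ℂ), IsStarProjection (Vᴴ * V) ∧
      ketbra ψ = ((1 : Op A) ⊗ₖ V) * ketbra φ * ((1 : Op A) ⊗ₖ V)ᴴ ∧
      ∑ i, ‖φ i‖ ^ 2 = ∑ i, ‖ψ i‖ ^ 2 := by
  obtain ⟨V, B, hΨ, hV, hB⟩ := exists_polar_decomposition (Matrix.of fun r a => ψ (a, r))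
  have hψ (x : A × R) : ψ x = ∑ c, V x.2 c * B c x.1 := congrFun (congrFun hΨ x.2) x.1
  refine ⟨V, fun x => B x.2 x.1, hV, ?_, ?_⟩
  · ext x y
    rw [one_kronecker_conj_apply]
    simp only [ketbra, Matrix.vecMulVec_apply, Pi.star_apply, hψ, star_sum, star_mul',
      Finset.sum_mul_sum, mul_mul_mul_comm]
  · have hfrobenius := congrArg Matrix.trace hB
    simp only [Matrix.trace, Matrix.diag, Matrix.mul_apply, Matrix.conjTranspose_apply,
      Matrix.of_apply, Complex.star_def, Complex.conj_mul'] at hfrobenius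
    simp only [Fintype.sum_prod_type]
    exact_mod_cast hfrobenius

variable [DecidableEq R]

theorem norm_trace_mul_tensorId_ketbra_le {Φ : Op A →ₗ[ℂ] Op B} {ε : ℝ} (hε : 0 ≤ ε)
    (h : diamondNorm Φ ≤ ENNReal.ofReal ε) (M : Op (B × R)) (ψ : A × R → ℂ) :
    ‖(M * tensorId Φ R (ketbra ψ)).trace‖ ≤ ‖M‖ * (ε * ∑ i, ‖ψ i‖ ^ 2) := by
  obtain ⟨V, φ, hV, hψ, hnorm⟩ := exists_ketbra_eq_conj ψ
  set T : Matrix (B × R) (B × A) ℂ := (1 : Op B) ⊗ₖ V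
  have hT : ‖T‖ ≤ 1 := norm_one_kronecker_le_one hV
  have hconj : ‖Tᴴ * M * T‖ ≤ ‖M‖ := by
    calc ‖Tᴴ * M * T‖ ≤ ‖Tᴴ‖ * ‖M‖ * ‖T‖ := (Matrix.l2_opNorm_mul _ _).trans <|
          mul_le_mul_of_nonneg_right (Matrix.l2_opNorm_mul _ _) (norm_nonneg _)
      _ ≤ 1 * ‖M‖ * 1 := by rw [Matrix.l2_opNorm_conjTranspose]; gcongr
      _ = ‖M‖ := by rw [one_mul, mul_one]
  calc ‖(M * tensorId Φ R (ketbra ψ)).trace‖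
      = ‖(Tᴴ * M * T * tensorId Φ A (ketbra φ)).trace‖ := by
        rw [hψ, tensorId_conj_right, ← Matrix.mul_assoc, Matrix.trace_mul_comm]
        simp only [Matrix.mul_assoc]
        rfl
    _ ≤ ‖Tᴴ * M * T‖ * traceNorm (tensorId Φ A (ketbra φ)) := norm_trace_mul_le _ _
    _ ≤ ‖M‖ * (ε * ∑ i, ‖ψ i‖ ^ 2) := by
        rw [← hnorm, ← traceNorm_ketbra]
        exact mul_le_mul hconj (traceNorm_tensorId_le hε h _)
          (traceNorm_nonneg _) (norm_nonneg _)

theorem norm_trace_mul_tensorId_le {Φ : Op A →ₗ[ℂ] Op B} {ε : ℝ} (hε : 0 ≤ ε)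
    (h : diamondNorm Φ ≤ ENNReal.ofReal ε) (M : Op (B × R)) {τ : Op (A × R)} (hτ : IsDensity τ) :
    ‖(M * tensorId Φ R τ).trace‖ ≤ ‖M‖ * ε := by
  obtain ⟨m, v, hv⟩ := Matrix.posSemidef_iff_eq_sum_vecMulVec.1 hτ.1
  have hτ_eq : τ = ∑ j, ketbra (v j) := hv
  have htrace : ∑ j, ∑ i, ‖v j i‖ ^ 2 = 1 := by
    have := hτ.2
    rw [hτ_eq, Matrix.trace_sum] at this
    simp only [trace_ketbra] at this
    exact_mod_cast this
  rw [hτ_eq, map_sum, Matrix.mul_sum, Matrix.trace_sum]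
  calc ‖∑ j, (M * tensorId Φ R (ketbra (v j))).trace‖
      ≤ ∑ j, ‖(M * tensorId Φ R (ketbra (v j))).trace‖ := norm_sum_le _ _
    _ ≤ ∑ j, ‖M‖ * (ε * ∑ i, ‖v j i‖ ^ 2) :=
      Finset.sum_le_sum fun j _ => norm_trace_mul_tensorId_ketbra_le hε h M (v j)
    _ = ‖M‖ * ε := by rw [← Finset.mul_sum, ← Finset.mul_sum, htrace, mul_one]

end DiamondNorm

/-! ### Channels -/

section Channel

open scoped Matrix Kronecker

/-- A channel: a completely positive trace-preserving map. -/
structure IsChannel {A B : Type} [Fintype A] [Fintype B] (Φ : Op A →ₗ[ℂ] Op B) : Prop where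
  posSemidef_tensorId : ∀ (R : Type) [Fintype R] (X : Op (A × R)),
    X.PosSemidef → (tensorId Φ R X).PosSemidef
  trace_apply : ∀ X, (Φ X).trace = X.trace

theorem trace_submatrix_equiv {A B : Type} [Fintype A] [Fintype B] (e : A ≃ B) (X : Op B) :
    (X.submatrix e e).trace = X.trace :=
  e.sum_comp fun b => X b b

theorem IsDensity.submatrix_equiv {A B : Type} [Fintype A] [Fintype B] (e : A ≃ B) {ρ : Op B}
    (h : IsDensity ρ) : IsDensity (ρ.submatrix e e) :=
  ⟨h.1.submatrix e, (trace_submatrix_equiv e ρ).trans h.2⟩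

theorem trace_tensorId {A B R : Type} [Fintype A] [Fintype B] [Fintype R] {Φ : Op A →ₗ[ℂ] Op B}
    (h : ∀ X, (Φ X).trace = X.trace) (X : Op (A × R)) :
    (tensorId Φ R X).trace = X.trace := by
  simp only [Matrix.trace, Matrix.diag, Fintype.sum_prod_type_right]
  exact Finset.sum_congr rfl fun r _ => h (fun a a' => X (a, r) (a', r))

namespace IsChannel

variable {A B C R : Type} [Fintype A] [Fintype B] [Fintype C] [Fintype R]

theorem id : IsChannel (LinearMap.id : Op A →ₗ[ℂ] Op A) := ⟨fun _ _ _ h => h, fun _ => rfl⟩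

theorem comp {Φ : Op B →ₗ[ℂ] Op C} {Ψ : Op A →ₗ[ℂ] Op B} (hΦ : IsChannel Φ) (hΨ : IsChannel Ψ) :
    IsChannel (Φ ∘ₗ Ψ) where
  posSemidef_tensorId R _ X h := hΦ.posSemidef_tensorId R _ (hΨ.posSemidef_tensorId R X h)
  trace_apply X := (hΦ.trace_apply _).trans (hΨ.trace_apply X)

theorem tensorId {Φ : Op A →ₗ[ℂ] Op B} (hΦ : IsChannel Φ) (R : Type) [Fintype R] :
    IsChannel (tensorId Φ R) where
  posSemidef_tensorId Z _ _ h :=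
    (hΦ.posSemidef_tensorId (R × Z) _
      (h.submatrix fun x : A × R × Z => ((x.1, x.2.1), x.2.2))).submatrix
        fun x : (B × R) × Z => (x.1.1, x.1.2, x.2)
  trace_apply := trace_tensorId hΦ.trace_apply

theorem isDensity_tensorId {Φ : Op A →ₗ[ℂ] Op B} (hΦ : IsChannel Φ) {ρ : Op (A × R)}
    (h : IsDensity ρ) : IsDensity (_root_.tensorId Φ R ρ) :=
  ⟨hΦ.posSemidef_tensorId R ρ h.1, (trace_tensorId hΦ.trace_apply ρ).trans h.2⟩

theorem isDensity_idTensor {Φ : Op A →ₗ[ℂ] Op B} (hΦ : IsChannel Φ) {ρ : Op (R × A)}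
    (h : IsDensity ρ) : IsDensity (idTensor R Φ ρ) :=
  (hΦ.isDensity_tensorId (h.submatrix_equiv (Equiv.prodComm A R))).submatrix_equiv
    (Equiv.prodComm R B)

end IsChannel

theorem kronecker_one_mul_apply {A B R Z : Type} [Fintype A] [Fintype R] [DecidableEq R]
    (K : Matrix B A ℂ) (Y : Matrix (A × R) Z ℂ) (x : B × R) (z : Z) :
    ((K ⊗ₖ (1 : Op R)) * Y) x z = ∑ c, K x.1 c * Y (c, x.2) z := by
  rw [Matrix.mul_apply, Fintype.sum_prod_type_right, Finset.sum_eq_single x.2]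
  · simp
  · intro r _ hr
    simp [Matrix.one_apply_ne hr.symm]
  · simp

theorem tensorId_eq_conj {A B R : Type} [Fintype A] [Fintype R] [DecidableEq R]
    {Φ : Op A →ₗ[ℂ] Op B} {K : Matrix B A ℂ} (h : ∀ X, Φ X = K * X * Kᴴ) (X : Op (A × R)) :
    tensorId Φ R X = (K ⊗ₖ (1 : Op R)) * X * (K ⊗ₖ (1 : Op R))ᴴ := by
  ext ⟨b, r⟩ ⟨b', r'⟩
  have hblock := congrFun (congrFun (h (Matrix.of fun a a' => X (a, r) (a', r'))) b) b'
  refine hblock.trans ?_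
  rw [Matrix.mul_assoc, Matrix.mul_assoc, ← Matrix.conjTranspose_conjTranspose X,
    ← Matrix.conjTranspose_mul, kronecker_one_mul_apply]
  simp only [Matrix.mul_apply (M := K), Matrix.mul_apply (N := Kᴴ), Matrix.conjTranspose_apply,
    kronecker_one_mul_apply, star_sum, star_mul', star_star, Matrix.of_apply, mul_comm (X _ _)]

theorem isChannel_of_conj {A B : Type} [Fintype A] [Fintype B] [DecidableEq A]
    {Φ : Op A →ₗ[ℂ] Op B} {K : Matrix B A ℂ} (h : ∀ X, Φ X = K * X * Kᴴ) (hK : Kᴴ * K = 1) :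
    IsChannel Φ := by
  classical
  refine ⟨fun R _ X hX => ?_, fun X => ?_⟩
  · rw [tensorId_eq_conj h]
    exact hX.mul_mul_conjTranspose_same _
  · rw [h, Matrix.trace_mul_comm, ← Matrix.mul_assoc, hK, Matrix.one_mul]

theorem isChannel_conjMap {A : Type} [Fintype A] [DecidableEq A] {U : Op A} (hU : Uᴴ * U = 1) :
    IsChannel (conjMap U) :=
  isChannel_of_conj (fun _ => (Matrix.mul_assoc _ _ _).symm) hU

theorem conjTranspose_mul_self_of_injective {A B : Type} [Fintype B] [DecidableEq A]
    [DecidableEq B] {f : A → B} (hf : Function.Injective f) {U : Matrix B A ℂ}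
    (hU : ∀ x y, U x y = if x = f y then 1 else 0) : Uᴴ * U = 1 := by
  ext x y
  simp [Matrix.mul_apply, hU, Matrix.one_apply, hf.eq_iff, eq_comm]

theorem posSemidef_of_ite {A B : Type} [Finite B] {X : Op A} (hX : X.PosSemidef)
    (p : B → Prop) [DecidablePred p] (f : B → A) :
    (Matrix.of fun x y => if p x ∧ p y then X (f x) (f y) else 0 : Op B).PosSemidef := by
  classical
  have := Fintype.ofFinite B
  convert (hX.submatrix f).mul_mul_conjTranspose_same
    (Matrix.diagonal fun x => if p x then (1 : ℂ) else 0) using 1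
  ext x y
  rw [Matrix.diagonal_conjTranspose, Matrix.mul_diagonal, Matrix.diagonal_mul]
  by_cases hx : p x <;> by_cases hy : p y <;> simp [hx, hy]

theorem isChannel_depolarizing (A B : Type) [Fintype A] [Fintype B] [DecidableEq B] [Nonempty B] :
    IsChannel (depolarizing A B) := by
  refine ⟨fun R _ X hX => ?_, fun X => by simp [depolarizing]⟩
  have hpartial : (∑ a, X.submatrix (fun r : R => (a, r)) (fun r => (a, r))).PosSemidef :=
    Matrix.posSemidef_sum _ fun a _ => hX.submatrix _
  have htensor : tensorId (depolarizing A B) R X = (Fintype.card B : ℂ)⁻¹ •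
      ((1 : Op B) ⊗ₖ ∑ a, X.submatrix (fun r : R => (a, r)) (fun r => (a, r))) := by
    ext x y
    change (∑ a, X (a, x.2) (a, y.2)) * ((Fintype.card B : ℂ)⁻¹ * (1 : Op B) x.1 y.1) =
      (Fintype.card B : ℂ)⁻¹ * ((1 : Op B) x.1 y.1 * _)
    simp only [Matrix.sum_apply, Matrix.submatrix_apply]
    ring
  rw [htensor]
  exact (Matrix.PosSemidef.one.kronecker hpartial).smul (inv_nonneg.2 (Nat.cast_nonneg _))

end Channel

section Gates

open scoped Matrix

theorem isChannel_hadamard {n : ℕ} (i : Fin n) : IsChannel (QGate.hadamard i).channel := by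
  refine isChannel_conjMap (mul_eq_one_comm.1 ?_)
  have hsqrt : ((√2 : ℝ) : ℂ)⁻¹ * ((√2 : ℝ) : ℂ)⁻¹ = 2⁻¹ := by
    rw [← mul_inv, ← Complex.ofReal_mul, Real.mul_self_sqrt zero_le_two, Complex.ofReal_ofNat]
  have hrow (x y : Qubits n) (a : Bool) : hadamardOp i y (Function.update x i a) =
      if ∀ j, j ≠ i → y j = x j then ((√2 : ℝ) : ℂ)⁻¹ * hadamardSign (y i) a else 0 := by
    have hoff : (∀ j, j ≠ i → y j = Function.update x i a j) ↔ ∀ j, j ≠ i → y j = x j :=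
      forall₂_congr fun j hj => by rw [Function.update_of_ne hj]
    simp only [hadamardOp, hadamardSign, hoff, Function.update_self]
  have horth (a b : Bool) :
      ∑ c, hadamardSign a c * hadamardSign b c = if b = a then 2 else 0 := by
    cases a <;> cases b <;> norm_num [hadamardSign]
  ext x y
  have heq : y = x ↔ (∀ j, j ≠ i → y j = x j) ∧ y i = x i :=
    ⟨fun h => by simp [h], fun h => funext fun j => by
      by_cases hj : j = i
      · rw [hj, h.2]
      · exact h.1 j hj⟩
  simp only [Matrix.mul_apply, Matrix.conjTranspose_apply, star_hadamardOp, sum_hadamardOp_mul,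
    hrow, Matrix.one_apply, eq_comm (a := x), heq]
  by_cases h : ∀ j, j ≠ i → y j = x j
  · simp only [if_pos h, mul_left_comm _ ((√2 : ℝ) : ℂ)⁻¹, ← Finset.mul_sum, horth]
    rw [← mul_assoc, hsqrt]
    by_cases hi : y i = x i
    · rw [if_pos hi, if_pos ⟨h, hi⟩, inv_mul_cancel₀ two_ne_zero]
    · rw [if_neg hi, if_neg fun hxy => hi hxy.2, mul_zero]
  · simp [h]

theorem isChannel_tGate {n : ℕ} (i : Fin n) : IsChannel (QGate.tGate i).channel := by
  refine isChannel_conjMap ?_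
  have hphase : star (Complex.exp (Complex.I * (Real.pi / 4 : ℝ))) *
      Complex.exp (Complex.I * (Real.pi / 4 : ℝ)) = 1 := by
    rw [Complex.star_def, ← Complex.exp_conj, ← Complex.exp_add, map_mul,
      Complex.conj_I, Complex.conj_ofReal, neg_mul, neg_add_cancel, Complex.exp_zero]
  rw [tOp, Matrix.diagonal_conjTranspose, Matrix.diagonal_mul_diagonal, ← Matrix.diagonal_one]
  congr 1
  funext x
  by_cases hx : x i = true
  · simpa [hx] using hphase
  · simp [hx]

theorem isChannel_ancilla (n : ℕ) : IsChannel (ancillaMap n) := by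
  refine ⟨fun R _ X hX => ?_, fun X => ?_⟩
  · exact posSemidef_of_ite hX (fun x : Qubits (n + 1) × R => x.1 0 = false)
      fun x => (Fin.tail x.1, x.2)
  · simp only [Matrix.trace, Matrix.diag]
    rw [sum_qubits_succ]
    simp [ancillaMap]

theorem isChannel_discard {n : ℕ} (i : Fin (n + 1)) : IsChannel (discardMap i) := by
  refine ⟨fun R _ X hX => ?_, fun X => ?_⟩
  · have hsum : tensorId (discardMap i) R X = ∑ b : Bool, X.submatrix
        (fun x => (Fin.insertNth (α := fun _ => Bool) i b x.1, x.2))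
        (fun x => (Fin.insertNth (α := fun _ => Bool) i b x.1, x.2)) := by
      ext x y
      rw [Matrix.sum_apply]
      rfl
    rw [hsum]
    exact Matrix.posSemidef_sum _ fun b _ => hX.submatrix _
  · simp only [Matrix.trace, Matrix.diag]
    rw [← (Fin.insertNthEquiv (fun _ => Bool) i).sum_comp, Fintype.sum_prod_type_right]
    rfl

theorem isChannel_attachKey {m : ℕ} (n : ℕ) (k : Qubits m) : IsChannel (attachKey n k) := by
  refine ⟨fun R _ X hX => ?_, fun X => ?_⟩
  · exact posSemidef_of_ite hX
      (fun x : Qubits (m + n) × R => (fun i => x.1 (Fin.castAdd n i)) = k)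
      fun x => (fun i => x.1 (Fin.natAdd m i), x.2)
  · simp only [Matrix.trace, Matrix.diag]
    rw [← (Fin.appendEquiv m n).sum_comp, Fintype.sum_prod_type]
    simp [attachKey, Fin.appendEquiv]

theorem conjTranspose_mul_self_padding {n l : ℕ} (h : n ≤ l) : (padding h)ᴴ * padding h = 1 := by
  let f (x : Qubits n) : Qubits l := fun j => if hj : (j : ℕ) < n then x ⟨j, hj⟩ else false
  have hf (y : Qubits l) (x : Qubits n) : padding h y x = if y = f x then 1 else 0 := by
    refine if_congr ⟨fun hy => funext fun j => ?_, ?_⟩ rfl rfl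
    · by_cases hj : (j : ℕ) < n
      · simpa [f, hj] using hy.1 ⟨j, hj⟩
      · simpa [f, hj] using hy.2 j (not_lt.1 hj)
    · rintro rfl
      exact ⟨fun i => by simp [f], fun j hj => by simp [f, not_lt.2 hj]⟩
  have hinj : Function.Injective f := fun x y hxy => funext fun i => by
    simpa [f] using congrFun hxy (Fin.castLE h i)
  exact conjTranspose_mul_self_of_injective hinj hf

theorem isChannel_paddingMap {n l : ℕ} (h : n ≤ l) : IsChannel (paddingMap h) :=
  isChannel_of_conj (fun _ => rfl) (conjTranspose_mul_self_padding h)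

theorem QGate.isChannel {n m : ℕ} (g : QGate n m) : IsChannel g.channel := by
  cases g with
  | hadamard i => exact isChannel_hadamard i
  | tGate i => exact isChannel_tGate i
  | cnot i j hij =>
    exact isChannel_conjMap (U := cnotOp i j)
      (conjTranspose_mul_self_of_injective (involutive_cnot hij).injective fun _ _ => rfl)
  | toffoli i j k hij hik hjk =>
    exact isChannel_conjMap (U := toffoliOp i j k)
      (conjTranspose_mul_self_of_injective (involutive_toffoli hik hjk).injective fun _ _ => rfl)
  | ancilla => exact isChannel_ancilla n
  | discard i => exact isChannel_discard i

theorem QCircuit.isChannel {n m : ℕ} (c : QCircuit n m) : IsChannel c.channel := by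
  induction c with
  | nil => exact IsChannel.id
  | cons g c ih => exact ih.comp g.isChannel

end Gates

namespace EncryptionCircuit

theorem isChannel_chan (E : EncryptionCircuit) (k : Qubits E.m) : IsChannel (E.chan k) :=
  E.circuit.isChannel.comp (isChannel_attachKey E.n k)

theorem tensorId_average (E : EncryptionCircuit) (R : Type) (X : Op (Qubits E.n × R)) :
    tensorId E.average R X = ((2 : ℂ) ^ E.m)⁻¹ • ∑ k, tensorId (E.chan k) R X := by
  ext x y
  have hentry (Y : Op (Qubits E.n)) :
      E.average Y x.1 y.1 = ((2 : ℂ) ^ E.m)⁻¹ * ∑ k, E.chan k Y x.1 y.1 := by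
    simp only [average, LinearMap.smul_apply, LinearMap.sum_apply, Matrix.smul_apply,
      Matrix.sum_apply, smul_eq_mul]
  rw [Matrix.smul_apply, Matrix.sum_apply]
  exact hentry fun a a' => X (a, x.2) (a', y.2)

theorem isChannel_average (E : EncryptionCircuit) : IsChannel E.average := by
  refine ⟨fun R _ X hX => ?_, fun X => ?_⟩
  · rw [E.tensorId_average]
    exact (Matrix.posSemidef_sum _ fun k _ =>
      (E.isChannel_chan k).posSemidef_tensorId R X hX).smul (by positivity)
  · simp only [average, LinearMap.smul_apply, LinearMap.sum_apply, Matrix.trace_smul,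
      Matrix.trace_sum, (E.isChannel_chan _).trace_apply]
    simp

end EncryptionCircuit

/-! ### Completeness of the swap test -/

section PureStates

open scoped Matrix Kronecker

theorem isDensity_ketbra {A : Type} [Fintype A] {v : A → ℂ} (hv : ∑ i, ‖v i‖ ^ 2 = 1) :
    IsDensity (ketbra v) :=
  ⟨posSemidef_ketbra v, by rw [trace_ketbra, hv, Complex.ofReal_one]⟩

theorem isIdempotentElem_ketbra {A : Type} [Fintype A] {v : A → ℂ} (hv : ∑ i, ‖v i‖ ^ 2 = 1) :
    IsIdempotentElem (ketbra v) := by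
  have hdot : star v ⬝ᵥ v = 1 := by
    rw [dotProduct_comm, ← Matrix.trace_vecMulVec]
    exact (isDensity_ketbra hv).2
  rw [IsIdempotentElem, ketbra, Matrix.vecMulVec_mul_vecMulVec, hdot, one_smul]

theorem ketbra_kronecker {A A' : Type} (v : A → ℂ) (w : A' → ℂ) :
    ketbra (fun x : A × A' => v x.1 * w x.2) = ketbra v ⊗ₖ ketbra w := by
  ext x y
  simp only [ketbra, Matrix.vecMulVec_apply, Matrix.kroneckerMap_apply, Pi.star_apply, star_mul']
  ring

theorem sum_norm_sq_mul {A A' : Type} [Fintype A] [Fintype A'] (v : A → ℂ) (w : A' → ℂ) :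
    ∑ x : A × A', ‖v x.1 * w x.2‖ ^ 2 = (∑ a, ‖v a‖ ^ 2) * ∑ b, ‖w b‖ ^ 2 := by
  simp only [norm_mul, mul_pow, Fintype.sum_prod_type, Finset.sum_mul_sum]

theorem isDensity_ketbra_mul {A A' : Type} [Fintype A] [Fintype A'] {v : A → ℂ} {w : A' → ℂ}
    (hv : ∑ i, ‖v i‖ ^ 2 = 1) (hw : ∑ i, ‖w i‖ ^ 2 = 1) :
    IsDensity (ketbra fun x : A × A' => v x.1 * w x.2) :=
  isDensity_ketbra (by rw [sum_norm_sq_mul, hv, hw, one_mul])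

theorem exists_mem_sum_norm_sq_eq_one {A : Type} [Fintype A] {S : Submodule ℂ (A → ℂ)}
    (hS : S ≠ ⊥) : ∃ s ∈ S, ∑ a, ‖s a‖ ^ 2 = 1 := by
  obtain ⟨v, hv, hv0⟩ := S.exists_mem_ne_zero_of_ne_bot hS
  set c := ‖WithLp.toLp 2 v‖
  have hc : c ≠ 0 := by simpa [c] using hv0
  have hsum : ∑ a, ‖v a‖ ^ 2 = c ^ 2 := (EuclideanSpace.norm_sq_eq (WithLp.toLp 2 v)).symm
  refine ⟨(c : ℂ)⁻¹ • v, S.smul_mem _ hv, ?_⟩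
  simp only [Pi.smul_apply, smul_eq_mul, norm_mul, norm_inv, Complex.norm_real, mul_pow,
    ← Finset.mul_sum, hsum, inv_pow, Real.norm_eq_abs, sq_abs]
  exact inv_mul_cancel₀ (pow_ne_zero 2 hc)

variable {A R : Type} [Fintype A] [Fintype R] {S : Submodule ℂ (A → ℂ)}

theorem isDensityOn_ketbra {v : A × R → ℂ} (hv : ∑ i, ‖v i‖ ^ 2 = 1)
    (hS : ∀ r, (fun a => v (a, r)) ∈ S) : IsDensityOn S (ketbra v) := by
  refine ⟨isDensity_ketbra hv, fun w r => ?_⟩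
  convert S.smul_mem (star v ⬝ᵥ w) (hS r) using 1
  funext a
  simp [ketbra, Matrix.vecMulVec_mulVec, mul_comm]

theorem exists_isDensityOn_ketbra [Nonempty R] (hS : S ≠ ⊥) :
    ∃ ψ : A × R → ℂ, ∑ i, ‖ψ i‖ ^ 2 = 1 ∧ IsDensityOn S (ketbra ψ) := by
  classical
  obtain ⟨s, hs, hsum⟩ := exists_mem_sum_norm_sq_eq_one hS
  obtain ⟨r₀⟩ := ‹Nonempty R›
  have hunit : ∑ x : A × R, ‖s x.1 * (Pi.single r₀ (1 : ℂ) : R → ℂ) x.2‖ ^ 2 = 1 := by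
    rw [sum_norm_sq_mul, hsum, one_mul, Finset.sum_eq_single r₀]
    · simp
    · intro r _ hr
      simp [hr]
    · simp
  refine ⟨_, hunit, isDensityOn_ketbra hunit fun r => ?_⟩
  convert S.smul_mem ((Pi.single r₀ (1 : ℂ) : R → ℂ) r) hs using 1
  funext a
  exact mul_comm _ _

theorem isIdempotentElem_conj {A B : Type} [Fintype A] [DecidableEq A] [Fintype B]
    {K : Matrix B A ℂ} (hK : Kᴴ * K = 1) {P : Op A} (hP : IsIdempotentElem P) :
    IsIdempotentElem (K * P * Kᴴ) :=
  calc K * P * Kᴴ * (K * P * Kᴴ) = K * P * (Kᴴ * K) * P * Kᴴ := by simp only [Matrix.mul_assoc]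
    _ = K * (P * P) * Kᴴ := by rw [hK, Matrix.mul_one, Matrix.mul_assoc K]
    _ = K * P * Kᴴ := by rw [hP.eq]

theorem isIdempotentElem_tensorId_of_conj {B : Type} [DecidableEq A] [Fintype B]
    {Φ : Op A →ₗ[ℂ] Op B} {K : Matrix B A ℂ} (h : ∀ X, Φ X = K * X * Kᴴ) (hK : Kᴴ * K = 1)
    {P : Op (A × R)} (hP : IsIdempotentElem P) : IsIdempotentElem (tensorId Φ R P) := by
  classical
  rw [tensorId_eq_conj h]
  refine isIdempotentElem_conj ?_ hP
  rw [Matrix.conjTranspose_kronecker, ← Matrix.mul_kronecker_mul, hK, Matrix.conjTranspose_one,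
    Matrix.one_mul, Matrix.one_kronecker_one]

end PureStates

section Completeness

open scoped Matrix Kronecker Matrix.Norms.L2Operator

theorem mapTensor_kronecker {A A' B B' : Type} (Φ : Op A →ₗ[ℂ] Op B) (Ψ : Op A' →ₗ[ℂ] Op B')
    (X : Op A) (Y : Op A') : mapTensor Φ Ψ (X ⊗ₖ Y) = Φ X ⊗ₖ Ψ Y := by
  ext ⟨b, b'⟩ ⟨c, c'⟩
  have hΨ (t : ℂ) : Ψ (t • Y) b' c' = Ψ Y b' c' * t := by
    rw [map_smul, Matrix.smul_apply, smul_eq_mul, mul_comm]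
  have hΦ : Φ (Ψ Y b' c' • X) b c = Φ X b c * Ψ Y b' c' := by
    rw [map_smul, Matrix.smul_apply, smul_eq_mul, mul_comm]
  refine Eq.trans ?_ hΦ
  exact congrArg (fun Z => Φ Z b c) (funext fun a => funext fun d => hΨ (X a d))

theorem trace_swapOp_mul_kronecker {A : Type} [Fintype A] [DecidableEq A] (X Y : Op A) :
    (swapOp A * (X ⊗ₖ Y)).trace = (Y * X).trace := by
  rw [trace_swapOp_mul, Fintype.sum_prod_type]
  simp only [Matrix.trace, Matrix.diag, Matrix.mul_apply, Matrix.kroneckerMap_apply,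
    Prod.swap_prod_mk]
  exact Finset.sum_congr rfl fun _ _ => Finset.sum_congr rfl fun _ _ => mul_comm _ _

theorem one_sub_two_mul_le_re_trace_mul_self {A : Type} [Fintype A] [DecidableEq A] {ε : ℝ}
    {σ P : Op A} (hσ : IsDensity σ) (hP : IsDensity P) (hPP : IsIdempotentElem P)
    (h : ∀ M : Op A, ‖M‖ ≤ 1 → ‖(M * (σ - P)).trace‖ ≤ ε) : 1 - 2 * ε ≤ (σ * σ).trace.re := by
  have hsplit : (σ * σ).trace = 1 + (P * (σ - P)).trace + (σ * (σ - P)).trace := by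
    rw [Matrix.mul_sub, Matrix.mul_sub, Matrix.trace_sub, Matrix.trace_sub, hPP.eq, hP.2,
      Matrix.trace_mul_comm σ P]
    ring
  have hPε := (abs_le.1 ((Complex.abs_re_le_norm _).trans (h P hP.norm_le_one))).1
  have hσε := (abs_le.1 ((Complex.abs_re_le_norm _).trans (h σ hσ.norm_le_one))).1
  rw [hsplit, Complex.add_re, Complex.add_re, Complex.one_re]
  linarith

namespace EncryptionCircuit

variable (E : EncryptionCircuit)

theorem isDensity_swapTestInput
    {ρ : Op ((Qubits E.n × Qubits E.n) × (Qubits E.n × Qubits E.n))} (hρ : IsDensity ρ) :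
    IsDensity (E.swapTestInput ρ) :=
  (E.isChannel_average.tensorId _).isDensity_tensorId
    ((E.isChannel_average.tensorId _).isDensity_idTensor hρ)

theorem protocolAcceptProb_of_isDensity
    {ρ : Op ((Qubits E.n × Qubits E.n) × (Qubits E.n × Qubits E.n))} (hρ : IsDensity ρ) :
    E.protocolAcceptProb ρ = 2⁻¹ * (1 + (swapOp _ * E.swapTestInput ρ).trace.re) := by
  rw [protocolAcceptProb_eq, trace_symProj_mul, (E.isDensity_swapTestInput hρ).2,
    ← Complex.ofReal_ofNat, ← Complex.ofReal_inv, Complex.re_ofReal_mul, Complex.add_re,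
    Complex.one_re]

theorem protocolAcceptProb_ketbra {ψ : Qubits E.n × Qubits E.n → ℂ} (hψ : ∑ i, ‖ψ i‖ ^ 2 = 1) :
    E.protocolAcceptProb (ketbra fun x => ψ x.1 * ψ x.2) =
      2⁻¹ * (1 + (tensorId E.average (Qubits E.n) (ketbra ψ) *
        tensorId E.average (Qubits E.n) (ketbra ψ)).trace.re) := by
  rw [E.protocolAcceptProb_of_isDensity (isDensity_ketbra_mul hψ hψ), swapTestInput,
    ketbra_kronecker, mapTensor_kronecker, trace_swapOp_mul_kronecker]

variable {E}

theorem norm_trace_mul_average_sub_padding_le {ε : ℝ} {R : Type} [Fintype R] [DecidableEq R]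
    {ρ : Op (Qubits E.n × R)} (h : ∀ k : Qubits E.m,
      traceNorm (tensorId (E.chan k) R ρ - tensorId (paddingMap E.le) R ρ) ≤ ε)
    (M : Op (Qubits E.l × R)) :
    ‖(M * (tensorId E.average R ρ - tensorId (paddingMap E.le) R ρ)).trace‖ ≤ ‖M‖ * ε := by
  set Δ : Qubits E.m → Op (Qubits E.l × R) := fun k =>
    tensorId (E.chan k) R ρ - tensorId (paddingMap E.le) R ρ
  have hmean : tensorId E.average R ρ - tensorId (paddingMap E.le) R ρ =
      ((2 : ℂ) ^ E.m)⁻¹ • ∑ k, Δ k := by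
    rw [tensorId_average, Finset.sum_sub_distrib, smul_sub, Finset.sum_const, Finset.card_univ,
      ← Nat.cast_smul_eq_nsmul ℂ, smul_smul]
    simp
  rw [hmean, Matrix.mul_smul, Matrix.trace_smul, Matrix.mul_sum, Matrix.trace_sum, norm_smul,
    norm_inv, norm_pow, Complex.norm_ofNat]
  have hsum : ‖∑ k, (M * Δ k).trace‖ ≤ 2 ^ E.m * (‖M‖ * ε) :=
    calc ‖∑ k, (M * Δ k).trace‖ ≤ ∑ _k : Qubits E.m, ‖M‖ * ε :=
          norm_sum_le_of_le _ fun k _ => (norm_trace_mul_le M (Δ k)).trans (by gcongr; exact h k)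
      _ = 2 ^ E.m * (‖M‖ * ε) := by simp
  calc _ ≤ ((2 : ℝ) ^ E.m)⁻¹ * (2 ^ E.m * (‖M‖ * ε)) := by gcongr
    _ = ‖M‖ * ε := inv_mul_cancel_left₀ (by positivity) _

theorem exists_le_protocolAcceptProb_ketbra {ε : ℝ} {S : Submodule ℂ (Qubits E.n → ℂ)}
    (hS : S ≠ ⊥) (h : ∀ ρ : Op (Qubits E.n × Qubits E.n), IsDensityOn S ρ →
      ∀ k : Qubits E.m, traceNorm (tensorId (E.chan k) (Qubits E.n) ρ -
        tensorId (paddingMap E.le) (Qubits E.n) ρ) ≤ ε) :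
    ∃ ψ : Qubits E.n × Qubits E.n → ℂ, ∑ i, ‖ψ i‖ ^ 2 = 1 ∧
      1 - ε ≤ E.protocolAcceptProb (ketbra fun x => ψ x.1 * ψ x.2) := by
  obtain ⟨ψ, hψ, hψS⟩ := exists_isDensityOn_ketbra (R := Qubits E.n) hS
  have hε : 0 ≤ ε := (traceNorm_nonneg _).trans (h _ hψS fun _ => false)
  have hpurity := one_sub_two_mul_le_re_trace_mul_self
    (E.isChannel_average.isDensity_tensorId (isDensity_ketbra hψ))
    ((isChannel_paddingMap E.le).isDensity_tensorId (isDensity_ketbra hψ))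
    (isIdempotentElem_tensorId_of_conj (fun _ => rfl) (conjTranspose_mul_self_padding E.le)
      (isIdempotentElem_ketbra hψ))
    fun M hM => (norm_trace_mul_average_sub_padding_le (h _ hψS) M).trans
      (mul_le_of_le_one_left hε hM)
  refine ⟨ψ, hψ, ?_⟩
  rw [E.protocolAcceptProb_ketbra hψ]
  linarith

end EncryptionCircuit

end Completeness

/-! ### Soundness of the swap test -/

section Soundness

open scoped Matrix Kronecker Matrix.Norms.L2Operator

theorem trace_mul_submatrix_equiv {A B : Type} [Fintype A] [Fintype B] (e : A ≃ B) (M : Op A)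
    (X : Op B) : (M * X.submatrix e e).trace = (M.submatrix e.symm e.symm * X).trace := by
  rw [← trace_submatrix_equiv e (M.submatrix e.symm e.symm * X),
    ← Matrix.submatrix_mul_equiv _ _ e e e]
  simp

theorem norm_submatrix_equiv {A B : Type} [Fintype A] [Fintype B] [DecidableEq A] [DecidableEq B]
    (e : A ≃ B) (M : Op B) : ‖M.submatrix e e‖ = ‖M‖ :=
  let φ : Op B ≃⋆ₐ[ℂ] Op A :=
    .ofAlgEquiv (Matrix.reindexAlgEquiv ℂ ℂ e.symm) (Matrix.conjTranspose_reindex _ _)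
  StarAlgEquiv.norm_map φ M

section ParallelUse

variable {A B R Z : Type} [Fintype A] [DecidableEq A] [Fintype B] [DecidableEq B] [Fintype R]
  [DecidableEq R] [Fintype Z] [DecidableEq Z]

theorem norm_trace_mul_tensorId_tensorId_le {Φ : Op A →ₗ[ℂ] Op B} {ε : ℝ} (hε : 0 ≤ ε)
    (h : diamondNorm Φ ≤ ENNReal.ofReal ε) (M : Op ((B × R) × Z)) {τ : Op ((A × R) × Z)}
    (hτ : IsDensity τ) : ‖(M * tensorId (tensorId Φ R) Z τ).trace‖ ≤ ‖M‖ * ε := by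
  have hassoc : tensorId (tensorId Φ R) Z τ = (tensorId Φ (R × Z)
      (τ.submatrix (Equiv.prodAssoc A R Z).symm (Equiv.prodAssoc A R Z).symm)).submatrix
      (Equiv.prodAssoc B R Z) (Equiv.prodAssoc B R Z) := rfl
  rw [hassoc, trace_mul_submatrix_equiv, ← norm_submatrix_equiv (Equiv.prodAssoc B R Z).symm M]
  exact norm_trace_mul_tensorId_le hε h _ (hτ.submatrix_equiv _)

theorem norm_trace_mul_idTensor_tensorId_le {Φ : Op A →ₗ[ℂ] Op B} {ε : ℝ} (hε : 0 ≤ ε)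
    (h : diamondNorm Φ ≤ ENNReal.ofReal ε) (M : Op (Z × (B × R))) {τ : Op (Z × (A × R))}
    (hτ : IsDensity τ) : ‖(M * idTensor Z (tensorId Φ R) τ).trace‖ ≤ ‖M‖ * ε := by
  have hcomm : idTensor Z (tensorId Φ R) τ = (tensorId (tensorId Φ R) Z
      (τ.submatrix (Equiv.prodComm _ _) (Equiv.prodComm _ _))).submatrix
      (Equiv.prodComm Z (B × R)) (Equiv.prodComm Z (B × R)) := rfl
  rw [hcomm, trace_mul_submatrix_equiv, ← norm_submatrix_equiv (Equiv.prodComm Z (B × R)).symm M]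
  exact norm_trace_mul_tensorId_tensorId_le hε h _ (hτ.submatrix_equiv _)

theorem mapTensor_eq_idTensor {A A' B B' : Type} [Finite A] [Finite A'] (Φ : Op A →ₗ[ℂ] Op B)
    (Ψ : Op A' →ₗ[ℂ] Op B') (X : Op (A × A')) :
    mapTensor Φ Ψ X = idTensor B Ψ (tensorId Φ A' X) := by
  ext ⟨b, b'⟩ ⟨c, c'⟩
  exact linearMap_apply_comm Φ Ψ (fun u u' v v' => X (u, u') (v, v')) b c b' c'

variable {A' B' R' : Type} [Fintype A'] [DecidableEq A'] [Fintype B'] [DecidableEq B'] [Fintype R']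
  [DecidableEq R']

theorem norm_trace_mul_mapTensor_sub_le {Φ Ψ : Op A →ₗ[ℂ] Op B} {Φ' Ψ' : Op A' →ₗ[ℂ] Op B'}
    (hΨ : IsChannel Ψ) (hΦ' : IsChannel Φ') {ε ε' : ℝ} (hε : 0 ≤ ε) (hε' : 0 ≤ ε')
    (h : diamondNorm (Φ - Ψ) ≤ ENNReal.ofReal ε) (h' : diamondNorm (Φ' - Ψ') ≤ ENNReal.ofReal ε')
    (M : Op ((B × R) × (B' × R'))) {ρ : Op ((A × R) × (A' × R'))} (hρ : IsDensity ρ) :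
    ‖(M * mapTensor (tensorId Φ R) (tensorId Φ' R') ρ).trace -
      (M * mapTensor (tensorId Ψ R) (tensorId Ψ' R') ρ).trace‖ ≤ ‖M‖ * (ε + ε') := by
  have hfst : mapTensor (tensorId Φ R) (tensorId Φ' R') ρ -
      mapTensor (tensorId Ψ R) (tensorId Φ' R') ρ = tensorId (tensorId (Φ - Ψ) R) (B' × R')
        (idTensor (A × R) (tensorId Φ' R') ρ) := rfl
  have hsnd : mapTensor (tensorId Ψ R) (tensorId Φ' R') ρ -
      mapTensor (tensorId Ψ R) (tensorId Ψ' R') ρ = idTensor (B × R) (tensorId (Φ' - Ψ') R')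
        (tensorId (tensorId Ψ R) (A' × R') ρ) := by
    rw [mapTensor_eq_idTensor, mapTensor_eq_idTensor]
    rfl
  have hfst_le := norm_trace_mul_tensorId_tensorId_le hε h M
    ((hΦ'.tensorId R').isDensity_idTensor hρ)
  have hsnd_le := norm_trace_mul_idTensor_tensorId_le hε' h' M
    ((hΨ.tensorId R).isDensity_tensorId hρ)
  rw [← hfst, Matrix.mul_sub, Matrix.trace_sub] at hfst_le
  rw [← hsnd, Matrix.mul_sub, Matrix.trace_sub] at hsnd_le
  rw [mul_add]
  exact (norm_sub_le_norm_sub_add_norm_sub _ _ _).trans (add_le_add hfst_le hsnd_le)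

end ParallelUse

theorem two_mul_re_apply_le_of_posSemidef {A : Type} [Finite A] {ρ : Op A} (h : ρ.PosSemidef)
    (x y : A) : 2 * (ρ x y).re ≤ (ρ x x).re + (ρ y y).re := by
  classical
  have := Fintype.ofFinite A
  have hnonneg :=
    (Complex.le_def.1 (h.dotProduct_mulVec_nonneg (Pi.single x 1 - Pi.single y 1))).1
  have hherm := congrArg Complex.re (h.isHermitian.apply x y)
  simp only [Complex.zero_re, star_sub, Pi.star_single, star_one, Matrix.mulVec_sub,
    Matrix.mulVec_single, MulOpposite.op_one, one_smul, dotProduct_sub, sub_dotProduct,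
    single_dotProduct, Matrix.col_apply, one_mul, Complex.sub_re] at hnonneg
  simp only [RCLike.star_def, Complex.conj_re] at hherm
  linarith

theorem IsDensity.re_sum_apply_le_one {A : Type} [Fintype A] {ρ : Op A} (h : IsDensity ρ)
    (σ : Equiv.Perm A) : (∑ z, ρ (σ z) z).re ≤ 1 := by
  have htrace : ∑ z, (ρ z z).re = 1 := by
    rw [← Complex.re_sum]
    exact congrArg Complex.re h.2
  have hle : ∑ z, 2 * (ρ (σ z) z).re ≤ ∑ z, ((ρ (σ z) (σ z)).re + (ρ z z).re) :=
    Finset.sum_le_sum fun z _ => two_mul_re_apply_le_of_posSemidef h.1 _ _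
  rw [← Finset.mul_sum, Finset.sum_add_distrib, Equiv.sum_comp σ fun z => (ρ z z).re, htrace] at hle
  rw [Complex.re_sum]
  linarith

section Depolarizing

variable {A B R : Type} [Fintype A] [Fintype B] [DecidableEq B]

theorem mapTensor_depolarizing_swap_apply (ρ : Op ((A × R) × (A × R))) (b b' : B) (r r' : R) :
    mapTensor (tensorId (depolarizing A B) R) (tensorId (depolarizing A B) R) ρ
        ((b', r'), (b, r)) ((b, r), (b', r')) =
      if b = b' then
        (∑ a, ∑ a', ρ ((a, r'), (a', r)) ((a, r), (a', r'))) *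
          ((Fintype.card B : ℂ)⁻¹ * (Fintype.card B : ℂ)⁻¹)
      else 0 := by
  change (∑ a, (∑ a', ρ ((a, r'), (a', r)) ((a, r), (a', r'))) *
    ((Fintype.card B : ℂ)⁻¹ * (1 : Op B) b b')) * ((Fintype.card B : ℂ)⁻¹ * (1 : Op B) b' b) = _
  rw [← Finset.sum_mul]
  split_ifs with hb
  · subst hb
    simp [mul_assoc]
  · simp [Matrix.one_apply_ne hb]

theorem trace_swapOp_mul_mapTensor_depolarizing [Nonempty B] [Fintype R] [DecidableEq R]
    (ρ : Op ((A × R) × (A × R))) :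
    (swapOp (B × R) * mapTensor (tensorId (depolarizing A B) R) (tensorId (depolarizing A B) R)
      ρ).trace =
      (Fintype.card B : ℂ)⁻¹ * ∑ r, ∑ r', ∑ a, ∑ a', ρ ((a, r'), (a', r)) ((a, r), (a', r')) := by
  have hcard : (Fintype.card B : ℂ) ≠ 0 := by simp
  have hdiag (G : R → R → ℂ) : ∑ b : B, ∑ r, ∑ b' : B, ∑ r', (if b = b' then G r r' else 0) =
      Fintype.card B * ∑ r, ∑ r', G r r' := by
    simp
  rw [trace_swapOp_mul]
  simp only [Fintype.sum_prod_type, Prod.swap_prod_mk, mapTensor_depolarizing_swap_apply]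
  rw [hdiag]
  simp only [← Finset.sum_mul]
  field_simp

theorem re_trace_swapOp_mul_mapTensor_depolarizing_le [Nonempty B] [Fintype R] [DecidableEq R]
    {ρ : Op ((A × R) × (A × R))} (h : IsDensity ρ) :
    (swapOp (B × R) * mapTensor (tensorId (depolarizing A B) R) (tensorId (depolarizing A B) R)
      ρ).trace.re ≤ (Fintype.card B : ℝ)⁻¹ := by
  let swapReferences : Equiv.Perm ((A × R) × (A × R)) :=
    Function.Involutive.toPerm (fun z => ((z.1.1, z.2.2), (z.2.1, z.1.2))) fun _ => rfl
  have hsum : ∑ r, ∑ r', ∑ a, ∑ a', ρ ((a, r'), (a', r)) ((a, r), (a', r')) =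
      ∑ z, ρ (swapReferences z) z := by
    simp only [Fintype.sum_prod_type]
    calc _ = ∑ r, ∑ a, ∑ r', ∑ a', ρ ((a, r'), (a', r)) ((a, r), (a', r')) :=
          Finset.sum_congr rfl fun _ _ => Finset.sum_comm
      _ = ∑ a, ∑ r, ∑ r', ∑ a', ρ ((a, r'), (a', r)) ((a, r), (a', r')) := Finset.sum_comm
      _ = _ := Finset.sum_congr rfl fun _ _ => Finset.sum_congr rfl fun _ _ => Finset.sum_comm
  rw [trace_swapOp_mul_mapTensor_depolarizing, hsum, ← Complex.ofReal_natCast,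
    ← Complex.ofReal_inv, Complex.re_ofReal_mul]
  exact mul_le_of_le_one_right (by positivity) (h.re_sum_apply_le_one swapReferences)

end Depolarizing

theorem norm_swapOp_le_one (A : Type) [Fintype A] [DecidableEq A] : ‖swapOp A‖ ≤ 1 := by
  have hisometry : (swapOp A)ᴴ * swapOp A = 1 :=
    conjTranspose_mul_self_of_injective Prod.swap_injective fun _ _ => rfl
  exact norm_le_one_of_isStarProjection (hisometry ▸ IsStarProjection.one (Op (A × A)))

theorem EncryptionCircuit.protocolAcceptProb_le (E : EncryptionCircuit) {ε : ℝ} (hε : 0 ≤ ε)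
    (h : diamondNorm (depolarizing (Qubits E.n) (Qubits E.l) - E.average) ≤ ENNReal.ofReal ε)
    {ρ : Op ((Qubits E.n × Qubits E.n) × (Qubits E.n × Qubits E.n))} (hρ : IsDensity ρ) :
    E.protocolAcceptProb ρ ≤ 1 / 2 + 1 / (2 * 2 ^ E.l) + ε := by
  have hdepolarizing := re_trace_swapOp_mul_mapTensor_depolarizing_le (B := Qubits E.l) hρ
  have hclose := norm_trace_mul_mapTensor_sub_le E.isChannel_average (isChannel_depolarizing _ _)
    hε hε h h (swapOp (Qubits E.l × Qubits E.n)) hρ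
  have hnorm : ‖swapOp (Qubits E.l × Qubits E.n)‖ * (ε + ε) ≤ ε + ε :=
    mul_le_of_le_one_left (by positivity) (norm_swapOp_le_one _)
  have hre := (abs_le.1 ((Complex.abs_re_le_norm _).trans (hclose.trans hnorm))).1
  have hcard : (Fintype.card (Qubits E.l) : ℝ)⁻¹ = (2 ^ E.l)⁻¹ := by simp
  have hhalf : 1 / (2 * 2 ^ E.l : ℝ) = 2⁻¹ * (2 ^ E.l)⁻¹ := by rw [one_div, mul_inv]
  rw [Complex.sub_re] at hre
  rw [hcard] at hdepolarizing
  rw [E.protocolAcceptProb_of_isDensity hρ, hhalf, swapTestInput]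
  linarith

end Soundness

/-! ### The protocol -/

/-- The promise problem on which the protocol already works: on a yes instance all `E_k` nearly fix
the states on `S ⊗ R` for some nonzero subspace `S`, where `dim R = dim H`; a no instance is on
average nearly depolarizing, and no decryption circuit is required. -/
def detectLeakage (ε : ℝ) : PromiseProblem EncryptionCircuit where
  yes := {E | ∃ S : Submodule ℂ (Qubits E.n → ℂ), S ≠ ⊥ ∧
    ∀ ρ : Op (Qubits E.n × Qubits E.n), IsDensityOn S ρ → ∀ k : Qubits E.m,
      traceNorm (tensorId (E.chan k) (Qubits E.n) ρ -
        tensorId (paddingMap E.le) (Qubits E.n) ρ) ≤ ε}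
  no := {E | diamondNorm (depolarizing (Qubits E.n) (Qubits E.l) - E.average) ≤ ENNReal.ofReal ε}

theorem detectInsecure_yes_subset (ε δ : ℝ) (p : Polynomial ℕ) :
    (detectInsecure ε δ p).yes ⊆ (detectLeakage ε).yes := by
  rintro E ⟨S, hdim, hS⟩
  refine ⟨S, fun hbot => ?_, hS (Qubits E.n)⟩
  have hpos : (0 : ℝ) < ((2 : ℝ) ^ E.n) ^ (1 - δ) := by positivity
  rw [hbot, finrank_bot] at hdim
  exact hpos.not_ge (by exact_mod_cast hdim)

theorem detectInsecure_no_subset (ε δ : ℝ) (p : Polynomial ℕ) :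
    (detectInsecure ε δ p).no ⊆ (detectLeakage ε).no :=
  fun _ hE => hE.1

theorem IsQMAProtocol.mono {α : Type} {enc : α → List CircuitSym} {L L' : PromiseProblem α}
    {c s : ℝ} {V : α → VerifierCircuit} (h : IsQMAProtocol enc L' c s V) (hyes : L.yes ⊆ L'.yes)
    (hno : L.no ⊆ L'.no) : IsQMAProtocol enc L c s V where
  polyTime := h.polyTime
  gap := h.gap
  complete x hx := h.complete x (hyes hx)
  sound x hx := h.sound x (hno hx)

/-- Concatenation of the four registers of a proof state, as a bijection. -/
def joinRegistersEquiv (n : ℕ) :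
    (Qubits n × Qubits n) × (Qubits n × Qubits n) ≃ Qubits ((n + n) + (n + n)) :=
  ((Fin.appendEquiv n n).prodCongr (Fin.appendEquiv n n)).trans (Fin.appendEquiv (n + n) (n + n))

theorem coe_joinRegistersEquiv (n : ℕ) : ⇑(joinRegistersEquiv n) = joinRegisters := rfl

theorem isQMAProtocol_detectLeakage
    {V : (E : EncryptionCircuit) → QCircuit ((E.n + E.n) + (E.n + E.n)) 1}
    (hV : ∀ E, (V E).symbols = verifierWord E.m E.n E.l E.circuit.symbols)
    (hacc : ∀ E ρ, (V E).acceptProb ρ =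
      E.protocolAcceptProb (ρ.submatrix joinRegisters joinRegisters))
    {ε : ℝ} (hε : 0 ≤ ε) (hε' : ε < 1 / 8) :
    IsQMAProtocol EncryptionCircuit.encode (detectLeakage ε) (1 - ε) (3 / 4 + ε)
      (fun E => ⟨_, V E⟩) where
  polyTime := computableInPolyTime_of_symbols_eq V hV
  gap := ⟨by linarith, by linarith, by linarith⟩
  complete := by
    rintro E ⟨S, hS, h⟩
    obtain ⟨ψ, hψ, haccept⟩ := EncryptionCircuit.exists_le_protocolAcceptProb_ketbra hS h
    refine ⟨_, (isDensity_ketbra_mul hψ hψ).submatrix_equiv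
      (joinRegistersEquiv E.n).symm, ?_⟩
    rw [hacc, ← coe_joinRegistersEquiv]
    simpa using haccept
  sound := by
    intro E hE ρ hρ
    have hdim : (2 : ℝ) ≤ 2 ^ E.l := le_self_pow₀ one_le_two E.pos.ne'
    calc (V E).acceptProb ρ
        = E.protocolAcceptProb (ρ.submatrix (joinRegistersEquiv E.n) (joinRegistersEquiv E.n)) := by
          rw [hacc, coe_joinRegistersEquiv]
      _ ≤ 1 / 2 + 1 / (2 * 2 ^ E.l) + ε := E.protocolAcceptProb_le hε hE (hρ.submatrix_equiv _)
      _ ≤ 1 / 2 + 1 / (2 * 2) + ε := by gcongr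
      _ = 3 / 4 + ε := by norm_num

theorem mainTheorem4_general :
    ∃ V : (E : EncryptionCircuit) → QCircuit ((E.n + E.n) + (E.n + E.n)) 1,
      (∀ (E : EncryptionCircuit) (ρ : Op (Qubits ((E.n + E.n) + (E.n + E.n)))),
        (V E).acceptProb ρ = E.protocolAcceptProb (ρ.submatrix joinRegisters joinRegisters)) ∧
      ∀ ε : ℝ, 0 ≤ ε → ε < 1 / 8 →
        IsQMAProtocol EncryptionCircuit.encode (detectLeakage ε) (1 - ε) (3 / 4 + ε)
          (fun E => ⟨_, V E⟩) ∧
        (∀ E ∈ (detectLeakage ε).yes,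
          ∃ ψ : Qubits E.n × Qubits E.n → ℂ, ∑ i, ‖ψ i‖ ^ 2 = 1 ∧
            1 - ε ≤ E.protocolAcceptProb (ketbra fun x => ψ x.1 * ψ x.2)) ∧
        (∀ E ∈ (detectLeakage ε).no, ∀ ρ, IsDensity ρ →
          E.protocolAcceptProb ρ ≤ 1 / 2 + 1 / (2 * 2 ^ E.l) + ε) := by
  choose V hV hacc using exists_verifier
  refine ⟨V, hacc, fun ε hε hε' => ⟨isQMAProtocol_detectLeakage hV hacc hε hε', ?_, ?_⟩⟩
  · rintro E ⟨S, hS, h⟩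
    exact EncryptionCircuit.exists_le_protocolAcceptProb_ketbra hS h
  · exact fun E hE ρ hρ => E.protocolAcceptProb_le hε hE hρ

end

theorem mainTheorem4 :
    ∃ V : (E : EncryptionCircuit) → QCircuit ((E.n + E.n) + (E.n + E.n)) 1,
      (∀ (E : EncryptionCircuit) (ρ : Op (Qubits ((E.n + E.n) + (E.n + E.n)))), IsDensity ρ →
        (V E).acceptProb ρ = E.protocolAcceptProb (ρ.submatrix joinRegisters joinRegisters)) ∧
      ∀ (ε δ : ℝ) (p : Polynomial ℕ), 0 < ε → ε < 1 / 8 → 0 < δ → δ ≤ 1 →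
        IsQMAProtocol EncryptionCircuit.encode (detectInsecure ε δ p) (1 - ε) (3 / 4 + ε)
          (fun E => ⟨_, V E⟩) ∧
        (∀ E ∈ (detectInsecure ε δ p).yes,
          ∃ ψ : Qubits E.n × Qubits E.n → ℂ, ∑ i, ‖ψ i‖ ^ 2 = 1 ∧
            1 - ε ≤ E.protocolAcceptProb (Matrix.vecMulVec
              (fun x => ψ x.1 * ψ x.2) (star fun x => ψ x.1 * ψ x.2))) ∧
        (∀ E ∈ (detectInsecure ε δ p).no, ∀ ρ, IsDensity ρ →
          E.protocolAcceptProb ρ ≤ 1 / 2 + 1 / (2 * 2 ^ E.l) + ε) := by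
  obtain ⟨V, hacc, h⟩ := mainTheorem4_general
  refine ⟨V, fun E ρ _ => hacc E ρ, fun ε δ p hε hε' _ _ => ?_⟩
  obtain ⟨hprotocol, hcomplete, hsound⟩ := h ε hε.le hε'
  have hyes := detectInsecure_yes_subset ε δ p
  have hno := detectInsecure_no_subset ε δ p
  exact ⟨hprotocol.mono hyes hno, fun E hE => hcomplete E (hyes hE),
    fun E hE => hsound E (hno hE)⟩
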